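/- **Problems.** For positive integers $N$, $d$, $1\le k\le d$ and $\theta>0$, the detection problem $\textsc{USPCA}_D(N,k,d,\theta)$ has the simple hypotheses $$H_0: X_1,\dots,X_N\sim N(0,I_d)^{\otimes N},\qquad H_1: X_1,\dots,X_N\sim N(0,I_d+\theta vv^\top)^{\otimes N}\ \text{ with } v\sim\mathrm{Unif}[S_k],$$ where $S_k\subseteq\mathbb R^d$ is the set of $k$-sparse unit vectors whose nonzero coordinates all equal $\pm1/\sqrt k$. The problem $\textsc{UBSPCA}_D(N,k,d,\theta)$ is the same with $S_k$ replaced by the set $BS_k$ of $k$-sparse unit vectors whose nonzero coordinates all equal $1/\sqrt k$. The Type I$+$II error of a test $\phi$ is $\mathbb P_{H_0}[\phi(X)=1]+\mathbb P_{H_1}[\phi(X)=0]$. **Algorithms.** A randomized algorithm is a program for a machine with real registers that executes one instruction per step; the instructions are real constants, exact $+,-,\times,/$, $\sqrt{\cdot}$, $\exp$, $\log$, comparison, a fair random bit, and sampling $N(0,1)$ or $\mathrm{Poisson}(\lambda)$. (Branches are written as arithmetic selections and loops are unrolled, so the running time of a program is its length.) A sequence of algorithms, one for each $n$, is polynomial-time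 if the running time of the $n$-th is at most a fixed polynomial in the size of its input: the number of vertices for a graph, the number of entries for a matrix. **PC conjecture for $p\in(0,1)$.** For every sequence of randomized polynomial-time algorithms $A_n$ mapping graphs on $[n]$ to $\{0,1\}$ and every sequence of positive integers $k_n$ with $\limsup_{n\to\infty}\log_n k_n<\tfrac12$, $$\liminf_{n\to\infty}\left(\mathbb P_{G\sim G(n,p)}[A_n(G)=1]+\mathbb P_{G\sim G(n,k_n,p)}[A_n(G)=0]\right)\ge 1,$$ where $G(n,p)$ is the Erdős–Rényi graph and $G(n,k,p)$ is $G(n,p)$ with a clique planted on a uniformly random set of $k$ vertices. **Theorem.** Let $\alpha>0$ and $\beta\in(0,1)$ be such that $\frac{1-\alpha}2<\beta<\frac{1+\alpha}2$. There is a sequence $\{(N_n,K_n,d_n,\theta_n)\}_{n\in\mathbb N}$ of parameters ($N_n,K_n,d_n$ positive integers, $K_n\le d_n$, $\theta_n>0$, $N_n\to\infty$) such that: 1. $d_n=\Theta(N_n)$, $\theta_n=\tilde\Theta(N_n^{-\alpha})$ and $K_n=\tilde\Theta(N_n^{\beta})$, the latter two meaning $$\lim_{n\to\infty}\frac{\log\theta_n^{-1}}{\log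 N_n}=\alpha\qquad\text{and}\qquad\lim_{n\to\infty}\frac{\log K_n}{\log N_n}=\beta .$$ 2. Assuming the PC conjecture for $p=\frac12$, for every sequence of randomized polynomial-time tests $\phi_n:\mathbb R^{d_n\times N_n}\to\{0,1\}$, the Type I$+$II errors of $\phi_n$ on $\textsc{USPCA}_D(N_n,K_n,d_n,\theta_n)$ and on $\textsc{UBSPCA}_D(N_n,K_n,d_n,\theta_n)$ both have $\liminf_{n\to\infty}\ge 1$ (and so the asymptotic Type I$+$II error is at least $1$). -/

import Mathlib

open MeasureTheory ProbabilityTheory Filter Topology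
open scoped ENNReal NNReal

noncomputable section

/-! ### Randomized algorithms in exact real arithmetic

The memory is a sequence of real registers. A program is a finite list of instructions `(r, o)`;
executing one of them takes one step and writes the result of the operation `o` to register `r`.
A conditional assignment is `b * x + (1 - b) * y` with the result `b` of a comparison, and loops are
unrolled, so the running time of a program on every input is its length. -/

/-- The unit-cost operations: constants, arithmetic, square root, exponential, logarithm, comparison
of two registers, a fair random bit, and fresh standard normal and Poisson samples. -/
inductive RealOp
  | const (c : ℝ)
  | add (a b : ℕ)
  | sub (a b : ℕ)
  | mul (a b : ℕ)
  | div (a b : ℕ)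
  | sqrt (a : ℕ)
  | exp (a : ℕ)
  | log (a : ℕ)
  | le (a b : ℕ)
  | bit
  | gauss
  | poisson (a : ℕ)

/-- The Poisson distribution on `ℝ` as a function of its rate (rate `0` if `x` is negative). -/
def poissonRealKernel : Kernel ℝ ℝ where
  toFun x := (poissonMeasure x.toNNReal).map (Nat.cast : ℕ → ℝ)
  measurable' := by
    refine (Measure.measurable_map _ measurable_from_top).comp ?_
    refine Measure.measurable_of_measurable_coe _ fun s hs => ?_
    simp only [poissonMeasure, Measure.sum_apply _ hs, Measure.smul_apply, smul_eq_mul]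
    refine Measurable.tsum fun n => Measurable.mul_const ?_ _
    fun_prop

instance : IsMarkovKernel poissonRealKernel :=
  ⟨fun x => by
    change IsProbabilityMeasure ((poissonMeasure x.toNNReal).map (Nat.cast : ℕ → ℝ))
    infer_instance⟩

/-- The law of the result of an operation, given the contents `s` of the registers. -/
def RealOp.law : RealOp → Kernel (ℕ → ℝ) ℝ
  | .const c => Kernel.deterministic (fun _ => c) (by fun_prop)
  | .add a b => Kernel.deterministic (fun s => s a + s b) (by fun_prop)
  | .sub a b => Kernel.deterministic (fun s => s a - s b) (by fun_prop)
  | .mul a b => Kernel.deterministic (fun s => s a * s b) (by fun_prop)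
  | .div a b => Kernel.deterministic (fun s => s a / s b) (by fun_prop)
  | .sqrt a => Kernel.deterministic (fun s => Real.sqrt (s a)) (by fun_prop)
  | .exp a => Kernel.deterministic (fun s => Real.exp (s a)) (by fun_prop)
  | .log a => Kernel.deterministic (fun s => Real.log (s a)) (by fun_prop)
  | .le a b => Kernel.deterministic (fun s => if s a ≤ s b then 1 else 0)
      (Measurable.ite (measurableSet_le (by fun_prop) (by fun_prop)) (by fun_prop) (by fun_prop))
  | .bit => Kernel.const _ ((2⁻¹ : ℝ≥0∞) • Measure.dirac 0 + (2⁻¹ : ℝ≥0∞) • Measure.dirac 1)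
  | .gauss => Kernel.const _ (gaussianReal 0 1)
  | .poisson a => poissonRealKernel.comap (fun s => s a) (by fun_prop)

instance (o : RealOp) : IsMarkovKernel o.law := by
  have : IsProbabilityMeasure
      ((2⁻¹ : ℝ≥0∞) • Measure.dirac (0 : ℝ) + (2⁻¹ : ℝ≥0∞) • Measure.dirac (1 : ℝ)) :=
    ⟨by simp [ENNReal.inv_two_add_inv_two]⟩
  cases o <;> unfold RealOp.law <;> infer_instance

/-- A program: a list of pairs (target register, operation). Its length is its running time. -/
abbrev RealProgram := List (ℕ × RealOp)

/-- One step: the result of `o` is written to register `r`, the other registers are kept. -/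
def RealOp.step (r : ℕ) (o : RealOp) : Kernel (ℕ → ℝ) (ℕ → ℝ) :=
  (Kernel.id ×ₖ o.law).map fun q => Function.update q.1 r q.2

/-- The law of the final contents of the registers, given their initial contents. -/
def RealProgram.run : RealProgram → Kernel (ℕ → ℝ) (ℕ → ℝ)
  | [] => Kernel.id
  | (r, o) :: P => RealProgram.run P ∘ₖ RealOp.step r o

/-- The probability that the program outputs `1` when it is started on `s`. The output bit is `1` if
register `0` finally holds a positive number, and `0` otherwise. -/
def RealProgram.probOne (P : RealProgram) (s : ℕ → ℝ) : ℝ≥0∞ := RealProgram.run P s {t | 0 < t 0}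

/-- The probability that the program outputs `0` when it is started on `s`. -/
def RealProgram.probZero (P : RealProgram) (s : ℕ → ℝ) : ℝ≥0∞ := RealProgram.run P s {t | ¬ 0 < t 0}

/-- The algorithms `A n`, run on inputs of size `size n`, take polynomial time. -/
def IsPolyTime (A : ℕ → RealProgram) (size : ℕ → ℕ) : Prop :=
  ∃ p : Polynomial ℕ, ∀ n, (A n).length ≤ p.eval (size n)

/-- The Type I + Type II error `P_{X ∼ μ₀}[A(X) = 1] + P_{X ∼ μ₁}[A(X) = 0]` of the test `A`,
where the observation `X` is loaded into the registers by `load`. -/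
def typeError {Ω : Type*} [MeasurableSpace Ω] (A : RealProgram) (load : Ω → ℕ → ℝ)
    (μ₀ μ₁ : Measure Ω) : ℝ≥0∞ :=
  ∫⁻ X, A.probOne (load X) ∂μ₀ + ∫⁻ X, A.probZero (load X) ∂μ₁

/-! ### Planted clique -/

/-- A graph is loaded as its adjacency matrix, row by row; all other registers are `0`. -/
def loadGraph (n : ℕ) (G : SimpleGraph (Fin n)) (r : ℕ) : ℝ :=
  open Classical in
  if h : r < n * n then
    if G.Adj (finProdFinEquiv.symm ⟨r, h⟩).1 (finProdFinEquiv.symm ⟨r, h⟩).2 then 1 else 0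
  else 0

/-- `G(n, k, p)`: a sample of `G(n, p)` together with a clique on a uniformly random set of `k`
vertices. -/
def plantedClique (n k : ℕ) (p : unitInterval) : Measure (SimpleGraph (Fin n)) :=
  (uniformOn {S : Set (Fin n) | S.ncard = k}).bind fun S =>
    (SimpleGraph.binomialRandom (Fin n) p).map fun G =>
      G ⊔ SimpleGraph.fromEdgeSet {e | ∀ v ∈ e, v ∈ S}

/-- The planted clique conjecture with edge density `p`. -/
def PCConjecture (p : unitInterval) : Prop :=
  ∀ A : ℕ → RealProgram, IsPolyTime A (fun n => n) →
    ∀ k : ℕ → ℕ, (∀ n, 0 < k n) →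
      limsup (fun n : ℕ => ((Real.log (k n) / Real.log n : ℝ) : EReal)) atTop
        < ((1 / 2 : ℝ) : EReal) →
      1 ≤ liminf (fun n : ℕ => typeError (A n) (loadGraph n)
        (SimpleGraph.binomialRandom (Fin n) p) (plantedClique n (k n) p)) atTop

/-! ### Sparse PCA -/

/-- `N` samples in `ℝ^d` are loaded one after the other; all other registers are `0`. -/
def loadSamples (N d : ℕ) (X : Fin N → EuclideanSpace ℝ (Fin d)) (r : ℕ) : ℝ :=
  if h : r < N * d then
    X (finProdFinEquiv.symm ⟨r, h⟩).1 (finProdFinEquiv.symm ⟨r, h⟩).2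
  else 0

/-- `k`-sparse unit vectors in `ℝ^d` whose nonzero coordinates equal `±1/√k`. -/
def signedSpikes (d k : ℕ) : Set (EuclideanSpace ℝ (Fin d)) :=
  {v | ‖v‖ = 1 ∧ {i | v i ≠ 0}.ncard ≤ k ∧
    ∀ i, v i ≠ 0 → v i = 1 / Real.sqrt k ∨ v i = -(1 / Real.sqrt k)}

/-- `k`-sparse unit vectors in `ℝ^d` whose nonzero coordinates equal `1/√k`. -/
def biasedSpikes (d k : ℕ) : Set (EuclideanSpace ℝ (Fin d)) :=
  {v | ‖v‖ = 1 ∧ {i | v i ≠ 0}.ncard ≤ k ∧ ∀ i, v i ≠ 0 → v i = 1 / Real.sqrt k}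

/-- `N(0, I_d)^{⊗ N}`. -/
def pcaNull (N d : ℕ) : Measure (Fin N → EuclideanSpace ℝ (Fin d)) :=
  Measure.pi fun _ => multivariateGaussian 0 1

/-- `N(0, I_d + θ v vᵀ)^{⊗ N}`. -/
def spikedSamples (N d : ℕ) (θ : ℝ) (v : EuclideanSpace ℝ (Fin d)) :
    Measure (Fin N → EuclideanSpace ℝ (Fin d)) :=
  Measure.pi fun _ => multivariateGaussian 0 (1 + θ • Matrix.vecMulVec v v)

/-- The law of `N` samples from the spiked covariance model whose spike is uniform on `V`. -/
def pcaPlanted (N d : ℕ) (θ : ℝ) (V : Set (EuclideanSpace ℝ (Fin d))) :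
    Measure (Fin N → EuclideanSpace ℝ (Fin d)) :=
  (uniformOn V).bind (spikedSamples N d θ)

/-- Type I + Type II error of `φ` on `USPCA_D(N, k, d, θ)`. -/
def uspcaError (N k d : ℕ) (θ : ℝ) (φ : RealProgram) : ℝ≥0∞ :=
  typeError φ (loadSamples N d) (pcaNull N d) (pcaPlanted N d θ (signedSpikes d k))

/-- Type I + Type II error of `φ` on `UBSPCA_D(N, k, d, θ)`. -/
def ubspcaError (N k d : ℕ) (θ : ℝ) (φ : RealProgram) : ℝ≥0∞ :=
  typeError φ (loadSamples N d) (pcaNull N d) (pcaPlanted N d θ (biasedSpikes d k))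

end

/-! A test for sparse PCA is turned into a test for planted clique. Take `N = d = n * t` and `K = k
* t`, with `t ≈ n ^ b` and a clique of size `k ≈ n ^ g`, `g < 1/2`.

Each edge bit is replaced by a real `y p` so that a fair bit becomes `N(0,1)` and the constant bit
`1` becomes nearly `N(ν,1)` (`exists_gaussian_rejection_pair`). Let `b j` be orthonormal in `ℝ^d`
and let `A` be an `N × n` matrix with independent `N(0,v)` entries. Sample `a` is `W a + ∑ p, y p •
τ p a`, where `τ p a = (A a i • b j + A a j • b i) / √2` for the pair `p = (i, j)`. If `A` is a
contraction, Gaussian noise `W` exists that makes the null output exactly standard Gaussian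
(`exists_noise`); this fails with probability at most `2 ^ (-N)`, by a net of integer points.

A clique on `S` shifts the mean of row `a` by a linear function of row `a` of `A`. Averaged over
`A`, the rows are independent with covariance `1 + θ w wᵀ + σ2 ∑_{j ∈ S} b j (b j)ᵀ`, where `w =
k^{-1/2} ∑_{j ∈ S} b j`, `σ2 = v ν² / 2` and `θ = σ2 k (k - 2)`. The surplus last term is removed at
a chi-square cost of order `√(n N σ2²)` (`lintegral_planted_le`). With the normalised indicators of
disjoint blocks of size `t` as `b j`, followed by a random signed permutation of the coordinates,
`w` becomes a uniform spike. One argument serves both problems: the signs range over a subgroup `U`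
of `ℤˣ`, either `⊥` or `⊤`.

Nothing random in this construction has to be sampled by the reduction. For fixed values of `W`, of
the candidate values of `y`, of `A` and of the signed permutation, the map from graphs to samples is
affine in the adjacency matrix, and its coefficients can be constants of a polynomially long
program. Every such program followed by the test has error at least the minimum `m` over programs of
that length, so the average has too (`reduction_bound`, `ReductionParameters.le_typeError`). The
conjecture, applied to nearly optimal programs, says that `m` is asymptotically at least `1`.

The exponents have to satisfy `g + b = β (1 + b)` and `(1 + b)(1 - α) < 2 g`. The second leaves room
for `N v` to be small and also makes the chi-square cost vanish. The assumptions on `α` and `β` make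
this solvable with `g < 1/2` (`exists_exponents`). -/

/-! ### Deterministic programs -/

/-- The program `P` deterministically transforms the register contents `s` to `s'`. -/
def RealProgram.Computes (P : RealProgram) (s s' : ℕ → ℝ) : Prop :=
  ∀ Φ : RealProgram, RealProgram.run (P ++ Φ) s = RealProgram.run Φ s'

theorem RealProgram.Computes.nil (s : ℕ → ℝ) : RealProgram.Computes [] s s := fun _ => rfl

theorem RealProgram.Computes.append {P Q : RealProgram} {s s' s'' : ℕ → ℝ}
    (hP : P.Computes s s') (hQ : Q.Computes s' s'') :
    RealProgram.Computes (P ++ Q) s s'' := fun Φ => by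
  rw [List.append_assoc, hP, hQ]

theorem RealOp.step_apply_of_law_eq_dirac {r : ℕ} {o : RealOp} {s : ℕ → ℝ} {x : ℝ}
    (h : o.law s = Measure.dirac x) :
    RealOp.step r o s = Measure.dirac (Function.update s r x) := by
  have hm : Measurable fun q : (ℕ → ℝ) × ℝ => Function.update q.1 r q.2 := by
    refine measurable_pi_lambda _ fun i => ?_
    by_cases hi : i = r
    · subst hi; simpa using measurable_snd
    · simp only [Function.update_of_ne hi]; fun_prop
  rw [RealOp.step, Kernel.map_apply _ hm, Kernel.prod_apply, h, Kernel.id_apply,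
    Measure.dirac_prod_dirac, Measure.map_dirac' hm]

theorem RealProgram.Computes.single {r : ℕ} {o : RealOp} {s : ℕ → ℝ} {x : ℝ}
    (h : o.law s = Measure.dirac x) :
    RealProgram.Computes [(r, o)] s (Function.update s r x) := fun Φ => by
  change (RealProgram.run Φ ∘ₖ RealOp.step r o) s = _
  rw [Kernel.comp_apply, RealOp.step_apply_of_law_eq_dirac h,
    Measure.dirac_bind (Kernel.measurable _)]

theorem RealProgram.Computes.const (r : ℕ) (c : ℝ) (s : ℕ → ℝ) :
    RealProgram.Computes [(r, .const c)] s (Function.update s r c) :=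
  .single (by simp [RealOp.law, Kernel.deterministic_apply])

theorem RealProgram.Computes.add (r a b : ℕ) (s : ℕ → ℝ) :
    RealProgram.Computes [(r, .add a b)] s (Function.update s r (s a + s b)) :=
  .single (by simp [RealOp.law, Kernel.deterministic_apply])

theorem RealProgram.Computes.mul (r a b : ℕ) (s : ℕ → ℝ) :
    RealProgram.Computes [(r, .mul a b)] s (Function.update s r (s a * s b)) :=
  .single (by simp [RealOp.law, Kernel.deterministic_apply])

/-- A linear combination of registers is accumulated in register `R`, with scratch register `T`. -/
theorem exists_linearCombination_program (C : ℕ → ℝ) (m R T : ℕ) (hR : m ≤ R) (hT : m ≤ T)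
    (hRT : R ≠ T) :
    ∃ P : RealProgram, P.length = 3 * m ∧ ∀ s, ∃ s', P.Computes s s' ∧
      s' R = s R + ∑ j ∈ Finset.range m, C j * s j ∧ ∀ r, r ≠ R → r ≠ T → s' r = s r := by
  induction m with
  | zero => exact ⟨[], rfl, fun s => ⟨s, .nil s, by simp, fun _ _ _ => rfl⟩⟩
  | succ m ih =>
    obtain ⟨P, hP, h⟩ := ih (by omega) (by omega)
    refine ⟨P ++ ([(T, .const (C m))] ++ ([(T, .mul T m)] ++ [(R, .add R T)])), by simp [hP]; ring,
      fun s => ?_⟩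
    obtain ⟨s', h1, h2, h3⟩ := h s
    refine ⟨_, h1.append ((RealProgram.Computes.const _ _ _).append
      ((RealProgram.Computes.mul _ _ _ _).append (RealProgram.Computes.add _ _ _ _))), ?_, ?_⟩
    · have hm : m ≠ T := by omega
      have hm' : m ≠ R := by omega
      simp [Finset.sum_range_succ, Function.update_of_ne hRT, Function.update_of_ne hm, h2,
        h3 m hm' hm]
      ring
    · intro r hr hr'
      simp [Function.update_of_ne hr, Function.update_of_ne hr', h3 r hr hr']

/-- `M` affine functions of the first `q` registers are computed into fresh registers. -/
theorem exists_affine_fresh_program (c : ℕ → ℝ) (C : ℕ → ℕ → ℝ) (q T B M : ℕ) (hT : q ≤ T)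
    (hB : T < B) :
    ∃ P : RealProgram, P.length = (3 * q + 1) * M ∧ ∀ s, ∃ s', P.Computes s s' ∧
      (∀ i < M, s' (B + i) = c i + ∑ j ∈ Finset.range q, C i j * s j) ∧
      ∀ r, r < B ∨ B + M ≤ r → r ≠ T → s' r = s r := by
  induction M with
  | zero => exact ⟨[], rfl, fun s => ⟨s, .nil s, by simp, fun _ _ _ => rfl⟩⟩
  | succ M ih =>
    obtain ⟨P, hP, h⟩ := ih
    obtain ⟨Q, hQ, h'⟩ := exists_linearCombination_program (C M) q (B + M) T (by omega) hT
      (by omega)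
    refine ⟨P ++ ([(B + M, .const (c M))] ++ Q), by simp [hP, hQ]; ring, fun s => ?_⟩
    obtain ⟨s', h1, h2, h3⟩ := h s
    obtain ⟨s'', g1, g2, g3⟩ := h' (Function.update s' (B + M) (c M))
    refine ⟨s'', h1.append ((RealProgram.Computes.const _ _ _).append g1), ?_, ?_⟩
    · intro i hi
      rcases Nat.lt_succ_iff_lt_or_eq.1 hi with hi | rfl
      · rw [g3 _ (by omega) (by omega), Function.update_of_ne (by omega), h2 i hi]
      · rw [g2, Function.update_self]
        congr 1
        refine Finset.sum_congr rfl fun j hj => ?_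
        have := Finset.mem_range.1 hj
        rw [Function.update_of_ne (by omega), h3 j (by omega) (by omega)]
    · intro r hr hr'
      rw [g3 r (by omega) hr', Function.update_of_ne (by omega), h3 r (by omega) hr']

/-- Copying `M` registers; register `z` holds `0`. -/
theorem exists_copy_program (z B M : ℕ) (hz : M ≤ z) (hB : M ≤ B) :
    ∃ P : RealProgram, P.length = M ∧ ∀ s, s z = 0 → ∃ s', P.Computes s s' ∧
      (∀ i < M, s' i = s (B + i)) ∧ ∀ r, M ≤ r → s' r = s r := by
  have key : ∀ m ≤ M, ∃ P : RealProgram, P.length = m ∧ ∀ s, s z = 0 → ∃ s', P.Computes s s' ∧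
      (∀ i < m, s' i = s (B + i)) ∧ ∀ r, m ≤ r → s' r = s r := by
    intro m hm
    induction m with
    | zero => exact ⟨[], rfl, fun s _ => ⟨s, .nil s, by simp, fun _ _ => rfl⟩⟩
    | succ m ih =>
      obtain ⟨P, hP, h⟩ := ih (by omega)
      refine ⟨P ++ [(m, .add (B + m) z)], by simp [hP], fun s hs => ?_⟩
      obtain ⟨s', h1, h2, h3⟩ := h s hs
      refine ⟨_, h1.append (RealProgram.Computes.add _ _ _ _), ?_, ?_⟩
      · intro i hi
        rcases Nat.lt_succ_iff_lt_or_eq.1 hi with hi | rfl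
        · rw [Function.update_of_ne (by omega), h2 i hi]
        · rw [Function.update_self, h3 _ (by omega), h3 _ (by omega), hs, add_zero]
      · intro r hr
        rw [Function.update_of_ne (by omega), h3 r (by omega)]
  exact key M le_rfl

/-- `loadSamples` sets all registers beyond the sample to `0`, so the scratch space must be erased
before the test is started. -/
theorem exists_clear_program (a m : ℕ) :
    ∃ P : RealProgram, P.length = m ∧ ∀ s, ∃ s', P.Computes s s' ∧
      (∀ r, a ≤ r → r < a + m → s' r = 0) ∧ ∀ r, (r < a ∨ a + m ≤ r) → s' r = s r := by
  induction m with
  | zero => exact ⟨[], rfl, fun s => ⟨s, .nil s, fun r h h' => by omega, fun _ _ => rfl⟩⟩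
  | succ m ih =>
    obtain ⟨P, hP, h⟩ := ih
    refine ⟨P ++ [(a + m, .const 0)], by simp [hP], fun s => ?_⟩
    obtain ⟨s', h1, h2, h3⟩ := h s
    refine ⟨_, h1.append (RealProgram.Computes.const _ _ _), ?_, ?_⟩
    · intro r hr hr'
      by_cases hm : r = a + m
      · subst hm; simp
      · rw [Function.update_of_ne hm, h2 r hr (by omega)]
    · intro r hr
      rw [Function.update_of_ne (by omega), h3 r (by omega)]

/-- A short program which replaces the contents of the first `q` registers by `M` affine functions
of them. -/
theorem exists_affine_program (c : ℕ → ℝ) (C : ℕ → ℕ → ℝ) (q M : ℕ) :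
    ∃ P : RealProgram, P.length ≤ (3 * q + 4) * (M + 1) ∧ ∀ s, (∀ r, q ≤ r → s r = 0) →
      P.Computes s fun r => if r < M then c r + ∑ j ∈ Finset.range q, C r j * s j else 0 := by
  -- Layout: scratch at `q + M`, a register that stays `0` at `q + M + 1`, results from `q + M + 2`
  -- on. The results go to fresh registers first, because every one of them reads all inputs.
  obtain ⟨P, hP, h⟩ := exists_affine_fresh_program c C q (q + M) (q + M + 2) M (by omega) (by omega)
  obtain ⟨Q, hQ, h'⟩ := exists_copy_program (q + M + 1) (q + M + 2) M (by omega) (by omega)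
  obtain ⟨R, hR, h''⟩ := exists_clear_program M (q + 2 + M)
  refine ⟨P ++ (Q ++ R), by simp [hP, hQ, hR]; nlinarith, fun s hs => ?_⟩
  obtain ⟨s₁, a1, a2, a3⟩ := h s
  obtain ⟨s₂, b1, b2, b3⟩ := h' s₁ (by rw [a3 _ (by omega) (by omega), hs _ (by omega)])
  obtain ⟨s₃, c1, c2, c3⟩ := h'' s₂
  have hres := a1.append (b1.append c1)
  convert hres using 1
  funext r
  split_ifs with hr
  · rw [c3 r (Or.inl hr), b2 r hr, a2 r hr]
  · by_cases hr' : r < M + (q + 2 + M)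
    · exact (c2 r (by omega) hr').symm
    · rw [c3 r (by omega), b3 r (by omega), a3 r (by omega) (by omega), hs r (by omega)]

/-! ### Rejection sampling -/

/-- If `Q` is dominated by `3/2 P` on an event of `Q`-measure at least `1/2`, then `P` is the
average of two probability measures, one of which is close to `Q`. -/
theorem exists_rejection_pair {Ω : Type*} [MeasurableSpace Ω] (P Q : Measure Ω)
    [IsProbabilityMeasure P] [IsProbabilityMeasure Q] {s : Set Ω} (hs : MeasurableSet s)
    (hPQ : Q.restrict s ≤ (3 / 2 : ℝ≥0∞) • P) (hQ : Q sᶜ ≤ 1 / 2) :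
    ∃ Q₀ Q₁ : Measure Ω, IsProbabilityMeasure Q₀ ∧ IsProbabilityMeasure Q₁ ∧
      Q₀ + Q₁ = (2 : ℝ≥0∞) • P ∧ Q₁ ≤ Q + Q sᶜ • P := by
  -- The mass that `Q` loses outside `s` is given back as a multiple of `P`. Since `3/2 + 1/2 = 2`,
  -- this is at most `2 • P`, and the remainder serves as `Q₀`.
  set Q₁ : Measure Ω := Q.restrict s + Q sᶜ • P with hQ₁
  have h1 : Q₁ Set.univ = 1 := by
    simp [hQ₁, prob_add_prob_compl hs]
  have hp : IsProbabilityMeasure Q₁ := ⟨h1⟩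
  have hle : Q₁ ≤ (2 : ℝ≥0∞) • P := by
    have : (2 : ℝ≥0∞) • P = (3 / 2 : ℝ≥0∞) • P + (1 / 2 : ℝ≥0∞) • P := by
      rw [← add_smul, ENNReal.div_add_div_same]
      congr 1
      rw [ENNReal.eq_div_iff (by simp) (by simp)]
      norm_num
    rw [this]
    refine add_le_add hPQ ?_
    refine Measure.le_iff.2 fun t _ => ?_
    simp only [Measure.smul_apply, smul_eq_mul]
    gcongr
  have hsub : (2 : ℝ≥0∞) • P - Q₁ + Q₁ = (2 : ℝ≥0∞) • P := Measure.sub_add_cancel_of_le hle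
  refine ⟨(2 : ℝ≥0∞) • P - Q₁, Q₁, ⟨?_⟩, hp, hsub, ?_⟩
  · have := congrArg (fun μ : Measure Ω => μ Set.univ) hsub
    simp only [Measure.add_apply, h1, Measure.smul_apply, measure_univ, smul_eq_mul,
      mul_one] at this
    exact (ENNReal.add_left_inj ENNReal.one_ne_top).1 (this.trans one_add_one_eq_two.symm)
  · exact add_le_add Measure.restrict_le_self le_rfl

/-- Chernoff's bound with parameter `1`. It is crude but sufficient, because it is used with `c = 1
/ (3 * ν)` for small `ν`. -/
theorem gaussianReal_one_Ioi_le (ν c : ℝ) :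
    gaussianReal ν 1 (Set.Ioi c) ≤ ENNReal.ofReal (Real.exp (ν + 1 / 2 - c)) := by
  have h := measure_ge_le_exp_mul_mgf (μ := gaussianReal ν 1) (X := id) (t := 1) c zero_le_one
    (by simpa using integrable_exp_mul_gaussianReal (μ := ν) (v := 1) 1)
  rw [mgf_id_gaussianReal] at h
  have h2 : gaussianReal ν 1 (Set.Ioi c) ≤ gaussianReal ν 1 {x | c ≤ id x} :=
    measure_mono fun x hx => le_of_lt (Set.mem_Ioi.1 hx)
  refine h2.trans ?_
  rw [← ofReal_measureReal]
  refine ENNReal.ofReal_le_ofReal (h.trans_eq ?_)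
  rw [← Real.exp_add]
  congr 1
  simp
  ring

/-- The likelihood ratio is `exp (ν x - ν² / 2)`, which for `x ≤ 1 / (3ν)` is at most `exp (1/3) ≤
3/2`. -/
theorem gaussianReal_restrict_Iic_le {ν : ℝ} (hν : 0 < ν) :
    (gaussianReal ν 1).restrict (Set.Iic (1 / (3 * ν))) ≤ (3 / 2 : ℝ≥0∞) • gaussianReal 0 1 := by
  refine Measure.le_iff.2 fun t ht => ?_
  rw [Measure.restrict_apply ht]
  have hle : ((3 / 2 : ℝ≥0∞) • gaussianReal 0 1) (t ∩ Set.Iic (1 / (3 * ν))) ≤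
      ((3 / 2 : ℝ≥0∞) • gaussianReal 0 1) t := measure_mono Set.inter_subset_left
  refine le_trans ?_ hle
  simp only [Measure.smul_apply, smul_eq_mul]
  have hm : MeasurableSet (t ∩ Set.Iic (1 / (3 * ν))) := ht.inter measurableSet_Iic
  rw [gaussianReal_apply _ one_ne_zero, gaussianReal_apply _ one_ne_zero,
    ← lintegral_const_mul _ (measurable_gaussianPDF _ _)]
  refine setLIntegral_mono (by fun_prop) fun x hx => ?_
  have h3 : (3 / 2 : ℝ≥0∞) = ENNReal.ofReal (3 / 2) := by
    rw [ENNReal.ofReal_div_of_pos (by norm_num)]; simp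
  rw [h3, gaussianPDF, gaussianPDF, ← ENNReal.ofReal_mul (by norm_num)]
  refine ENNReal.ofReal_le_ofReal ?_
  have hx2 : ν * x ≤ 1 / 3 := by
    have h1 : x ≤ 1 / (3 * ν) := hx.2
    calc ν * x ≤ ν * (1 / (3 * ν)) := by gcongr
      _ = 1 / 3 := by field_simp
  simp only [gaussianPDFReal, NNReal.coe_one, mul_one, sub_zero]
  rw [mul_left_comm]
  refine mul_le_mul_of_nonneg_left ?_ (by positivity)
  have he : Real.exp (-(x - ν) ^ 2 / 2) = Real.exp (-x ^ 2 / 2) * Real.exp (ν * x - ν ^ 2 / 2) := by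
    rw [← Real.exp_add]; ring_nf
  have h4 : Real.exp (ν * x - ν ^ 2 / 2) ≤ 3 / 2 := by
    have h5 : Real.exp (ν * x - ν ^ 2 / 2) ≤ Real.exp (1 / 3) :=
      Real.exp_le_exp.2 (by nlinarith [sq_nonneg ν])
    have h6 : Real.exp (1 / 3) ≤ 3 / 2 := by
      have h7 : (1 / 3 : ℝ) ≤ Real.log (3 / 2) := by
        have := Real.one_sub_inv_le_log_of_pos (x := (3 / 2 : ℝ)) (by norm_num)
        norm_num at this ⊢; linarith
      calc Real.exp (1 / 3) ≤ Real.exp (Real.log (3 / 2)) := Real.exp_le_exp.2 h7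
        _ = 3 / 2 := Real.exp_log (by norm_num)
    linarith
  rw [he]
  nlinarith [Real.exp_pos (-x ^ 2 / 2)]

/-- A fair bit can be mapped to `N(0,1)` and the bit `1` approximately to `N(ν,1)`. -/
theorem exists_gaussian_rejection_pair {ν : ℝ} (hν : 0 < ν) {δ : ℝ≥0∞} (hδ : δ ≤ 1 / 2)
    (h : ENNReal.ofReal (Real.exp (ν + 1 / 2 - 1 / (3 * ν))) ≤ δ) :
    ∃ Q₀ Q₁ : Measure ℝ, IsProbabilityMeasure Q₀ ∧ IsProbabilityMeasure Q₁ ∧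
      Q₀ + Q₁ = (2 : ℝ≥0∞) • gaussianReal 0 1 ∧
      Q₁ ≤ gaussianReal ν 1 + δ • gaussianReal 0 1 := by
  have htail : gaussianReal ν 1 (Set.Iic (1 / (3 * ν)))ᶜ ≤ δ := by
    rw [Set.compl_Iic]
    exact (gaussianReal_one_Ioi_le ν _).trans h
  obtain ⟨Q₀, Q₁, h0, h1, h2, h3⟩ := exists_rejection_pair (gaussianReal 0 1) (gaussianReal ν 1)
    measurableSet_Iic (gaussianReal_restrict_Iic_le hν) (htail.trans hδ)
  refine ⟨Q₀, Q₁, h0, h1, h2, h3.trans (add_le_add le_rfl ?_)⟩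
  refine Measure.le_iff.2 fun t _ => ?_
  simp only [Measure.smul_apply, smul_eq_mul]
  gcongr

/-! ### Products of measures -/

/-- Comparing two measures on boxes does not order them in general. Here it does, because the
product comes from the largest outer measure that is bounded by the products on boxes. -/
theorem MeasureTheory.Measure.pi_mono_of_le {ι : Type*} [Fintype ι] {X : ι → Type*}
    [∀ i, MeasurableSpace (X i)] {μ ν : ∀ i, Measure (X i)} [∀ i, IsFiniteMeasure (μ i)]
    [∀ i, IsFiniteMeasure (ν i)] (h : ∀ i, μ i ≤ ν i) : Measure.pi μ ≤ Measure.pi ν := by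
  refine Measure.le_iff.2 fun s hs => ?_
  rw [Measure.pi, Measure.pi, toMeasure_apply _ _ hs, toMeasure_apply _ _ hs]
  refine OuterMeasure.le_pi.2 (fun t _ => ?_) s
  refine (OuterMeasure.pi_pi_le _ _).trans (Finset.prod_le_prod' fun i _ => ?_)
  exact Measure.le_iff'.1 (h i) _

theorem lintegral_le_add_of_measure_le {Ω : Type*} [MeasurableSpace Ω] {μ ν : Measure Ω}
    [IsFiniteMeasure μ] (h : μ ≤ ν) {f : Ω → ℝ≥0∞} (hf : ∀ x, f x ≤ 1) :
    ∫⁻ x, f x ∂ν ≤ ∫⁻ x, f x ∂μ + (ν Set.univ - μ Set.univ) := by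
  have h1 : ν - μ + μ = ν := Measure.sub_add_cancel_of_le h
  have h2 : (ν - μ) Set.univ = ν Set.univ - μ Set.univ := Measure.sub_apply MeasurableSet.univ h
  rw [← h2]
  conv_lhs => rw [← h1]
  rw [lintegral_add_measure, add_comm]
  gcongr
  calc ∫⁻ x, f x ∂(ν - μ) ≤ ∫⁻ _, 1 ∂(ν - μ) := lintegral_mono hf
    _ = _ := by simp

/-- A product of averages of two measures is an average of products. -/
theorem pi_average {ι : Type*} [Fintype ι] [DecidableEq ι] {X : Type*} [MeasurableSpace X]
    (μ₀ μ₁ μ : ι → Measure X) [∀ i, IsProbabilityMeasure (μ₀ i)] [∀ i, IsProbabilityMeasure (μ₁ i)]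
    [∀ i, IsProbabilityMeasure (μ i)]
    (h : ∀ i, μ₀ i + μ₁ i = (2 : ℝ≥0∞) • μ i) :
    Measure.pi μ = ((2 : ℝ≥0∞) ^ Fintype.card ι)⁻¹ •
      ∑ u : ι → Bool, Measure.pi fun i => if u i then μ₁ i else μ₀ i := by
  have hu : ∀ u : ι → Bool, ∀ i, IsProbabilityMeasure (if u i then μ₁ i else μ₀ i) := by
    intro u i; split_ifs <;> infer_instance
  refine Measure.pi_eq fun s hs => ?_
  simp only [Measure.smul_apply, Measure.finsetSum_apply, Measure.pi_pi, smul_eq_mul]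
  have h2 : ∀ i, μ i (s i) = 2⁻¹ * ∑ b : Bool, (if b then μ₁ i else μ₀ i) (s i) := by
    intro i
    have := congrArg (fun m : Measure X => m (s i)) (h i)
    simp only [Measure.add_apply, Measure.smul_apply, smul_eq_mul] at this
    simp only [Fintype.sum_bool, if_true, Bool.false_eq_true, if_false]
    rw [add_comm, this, ← mul_assoc, ENNReal.inv_mul_cancel (by simp) (by simp), one_mul]
  simp_rw [h2, Finset.prod_mul_distrib, Finset.prod_univ_sum]
  rw [ENNReal.inv_pow, Fintype.piFinset_univ]
  simp

/-! ### The uniform random graph -/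

/-- The unordered pairs of distinct vertices, as ordered pairs `i < j`. -/
abbrev EdgeIndex (n : ℕ) := {p : Fin n × Fin n // p.1 < p.2}

/-- The graph with the given edges, indexed by the pairs `i < j`. -/
def graphOfEdges {n : ℕ} (u : EdgeIndex n → Bool) : SimpleGraph (Fin n) :=
  SimpleGraph.fromRel fun i j => ∃ h : i < j, u ⟨(i, j), h⟩ = true

theorem graphOfEdges_adj {n : ℕ} (u : EdgeIndex n → Bool)
    (p : EdgeIndex n) :
    (graphOfEdges u).Adj p.1.1 p.1.2 ↔ u p = true := by
  obtain ⟨⟨i, j⟩, h⟩ := p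
  have h' : i < j := h
  simp only [graphOfEdges, SimpleGraph.fromRel_adj]
  constructor
  · rintro ⟨_, ⟨_, h2⟩ | ⟨h1, _⟩⟩
    · exact h2
    · exact absurd h1 h'.not_gt
  · exact fun hu => ⟨h'.ne, Or.inl ⟨h', hu⟩⟩

theorem graphOfEdges_bijective (n : ℕ) : Function.Bijective (graphOfEdges (n := n)) := by
  classical
  refine ⟨fun u v h => funext fun p => ?_, fun G => ⟨fun p => decide (G.Adj p.1.1 p.1.2), ?_⟩⟩
  · have h1 := graphOfEdges_adj u p
    rw [h, graphOfEdges_adj] at h1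
    exact Bool.eq_iff_iff.2 h1.symm
  · ext i j
    rcases lt_trichotomy i j with h | rfl | h
    · rw [graphOfEdges_adj _ ⟨(i, j), h⟩]; simp
    · simp
    · rw [SimpleGraph.adj_comm, graphOfEdges_adj _ ⟨(j, i), h⟩, SimpleGraph.adj_comm]; simp

instance SimpleGraph.measurableSingletonClass_of_countable {V : Type*} [Countable V] :
    MeasurableSingletonClass (SimpleGraph V) := by
  refine ⟨fun G => ?_⟩
  have h : ({G} : Set (SimpleGraph V)) = SimpleGraph.edgeSet ⁻¹' {G.edgeSet} := by
    ext H; simp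
  rw [h]
  exact SimpleGraph.measurable_edgeSet (MeasurableSet.singleton _)

theorem lintegral_binomialRandom_half (n : ℕ) (f : SimpleGraph (Fin n) → ℝ≥0∞) :
    ∫⁻ G, f G ∂SimpleGraph.binomialRandom (Fin n) ⟨1 / 2, by norm_num, by norm_num⟩ =
      ((2 : ℝ≥0∞) ^ Fintype.card (EdgeIndex n))⁻¹ *
        ∑ u : EdgeIndex n → Bool, f (graphOfEdges u) := by
  classical
  set μ := SimpleGraph.binomialRandom (Fin n) ⟨1 / 2, by norm_num, by norm_num⟩ with hμ
  obtain ⟨c, hc⟩ : ∃ c : ℝ≥0∞, ∀ G, μ {G} = c := by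
    refine ⟨(2⁻¹ : ℝ≥0∞) ^ (n.choose 2), fun G => ?_⟩
    have h1 : unitInterval.toNNReal ⟨1 / 2, by norm_num, by norm_num⟩ = 2⁻¹ := by
      ext; simp
    have h2 : unitInterval.toNNReal (unitInterval.symm ⟨1 / 2, by norm_num, by norm_num⟩) =
        2⁻¹ := by
      ext; simp; norm_num
    have h3 : G.edgeSet.ncard ≤ n.choose 2 := by
      rw [← SimpleGraph.coe_edgeFinset, Set.ncard_coe_finset]
      simpa using G.card_edgeFinset_le_card_choose_two
    rw [hμ, SimpleGraph.binomialRandom_singleton, h1, h2, Nat.card_fin, ← pow_add,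
      Nat.add_sub_cancel' h3]
    simp
  have hf : ∀ g : SimpleGraph (Fin n) → ℝ≥0∞, ∫⁻ G, g G ∂μ =
      c * ∑ u : EdgeIndex n → Bool, g (graphOfEdges u) := by
    intro g
    rw [lintegral_fintype, Finset.mul_sum]
    simp_rw [hc]
    rw [← (graphOfEdges_bijective n).sum_comp fun G => g G * c]
    simp_rw [mul_comm c]
  -- All graphs have equal mass `c` at density `1/2`. The value of `c` is read off from total mass
  -- `1`, without counting the pairs.
  have h1 := hf fun _ => 1
  simp only [lintegral_const, measure_univ, mul_one, Finset.sum_const, Finset.card_univ,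
    Fintype.card_fun, Fintype.card_bool, nsmul_eq_mul] at h1
  rw [hf f]
  congr 1
  exact ENNReal.eq_inv_of_mul_eq_one_left (by simpa using h1.symm)

theorem lintegral_plantedClique (n k : ℕ) (p : unitInterval) (f : SimpleGraph (Fin n) → ℝ≥0∞) :
    ∫⁻ G, f G ∂plantedClique n k p =
      ∫⁻ S, ∫⁻ G, f (G ⊔ SimpleGraph.fromEdgeSet {e | ∀ v ∈ e, v ∈ S})
        ∂SimpleGraph.binomialRandom (Fin n) p ∂uniformOn {S : Set (Fin n) | S.ncard = k} := by
  have hf : ∀ {Y : Type} [MeasurableSpace Y] (g : SimpleGraph (Fin n) → Y), Measurable g :=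
    fun g => measurable_of_finite g
  have hS : ∀ {Y : Type} [MeasurableSpace Y] (g : Set (Fin n) → Y), Measurable g :=
    fun g => measurable_of_finite g
  rw [plantedClique, Measure.lintegral_bind (hS _).aemeasurable (hf _).aemeasurable]
  refine lintegral_congr fun S => ?_
  rw [lintegral_map (hf _) (hf _)]

/-! ### Gaussian laws -/

open scoped RealInnerProductSpace in
-- Gaussian laws are compared below through characteristic functions: a covariance then enters only
-- through its quadratic form, and no matrix square root is needed.
theorem charFun_pi_gaussianReal_map {E ι : Type*} [NormedAddCommGroup E]
    [InnerProductSpace ℝ E] [FiniteDimensional ℝ E] [MeasurableSpace E] [BorelSpace E] [Fintype ι]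
    (v : ι → ℝ≥0) (t : ι → E) (ξ : E) :
    charFun ((Measure.pi fun i => gaussianReal 0 (v i)).map fun y => ∑ i, y i • t i) ξ =
      Complex.exp (-((∑ i, (v i : ℝ) * ⟪t i, ξ⟫ ^ 2 : ℝ) : ℂ) / 2) := by
  have hlin : Measurable fun y : ι → ℝ => ∑ i, y i • t i := by fun_prop
  rw [charFun_apply, integral_map hlin.aemeasurable (Measurable.aestronglyMeasurable (by fun_prop))]
  simp_rw [sum_inner, Complex.ofReal_sum, Finset.sum_mul, Complex.exp_sum,
    integral_fintype_prod_eq_prod (f := fun i x => Complex.exp (⟪x • t i, ξ⟫ * Complex.I)),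
    real_inner_smul_left, mul_comm _ (⟪_, _⟫), Complex.ofReal_mul, ← charFun_apply_real,
    charFun_gaussianReal]
  rw [← Complex.exp_sum]
  congr 1
  simp only [Complex.ofReal_zero, mul_zero, zero_mul, zero_sub]
  rw [neg_div, Finset.sum_div, Finset.sum_neg_distrib]
  congr 1
  exact Finset.sum_congr rfl fun i _ => by push_cast; rfl

open scoped RealInnerProductSpace in
theorem charFun_prod_pi_gaussianReal_map {E ι : Type*} [NormedAddCommGroup E]
    [InnerProductSpace ℝ E] [FiniteDimensional ℝ E] [MeasurableSpace E] [BorelSpace E] [Fintype ι]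
    (ρ : Measure E) [IsProbabilityMeasure ρ] (v : ι → ℝ≥0) (t : ι → E) (ξ : E) :
    charFun ((ρ.prod (Measure.pi fun i => gaussianReal 0 (v i))).map
      fun q => q.1 + ∑ i, q.2 i • t i) ξ =
      charFun ρ ξ * Complex.exp (-((∑ i, (v i : ℝ) * ⟪t i, ξ⟫ ^ 2 : ℝ) : ℂ) / 2) := by
  have hlin : Measurable fun y : ι → ℝ => ∑ i, y i • t i := by fun_prop
  have hconv : (ρ.prod (Measure.pi fun i => gaussianReal 0 (v i))).map
      (fun q => q.1 + ∑ i, q.2 i • t i) =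
      Measure.conv ρ ((Measure.pi fun i => gaussianReal 0 (v i)).map fun y => ∑ i, y i • t i) := by
    have : ρ.prod ((Measure.pi fun i => gaussianReal 0 (v i)).map fun y => ∑ i, y i • t i) =
        (ρ.prod (Measure.pi fun i => gaussianReal 0 (v i))).map
          (Prod.map id fun y => ∑ i, y i • t i) := by
      rw [← Measure.map_prod_map _ _ measurable_id hlin, Measure.map_id]
    rw [Measure.conv, this, Measure.map_map (by fun_prop) (by fun_prop)]
    rfl
  have := Measure.isProbabilityMeasure_map (μ := Measure.pi fun i => gaussianReal 0 (v i))
    hlin.aemeasurable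
  rw [hconv, charFun_conv, charFun_pi_gaussianReal_map]

/-! ### Gaussian laws with prescribed quadratic forms -/

section Covariance

open scoped RealInnerProductSpace

variable {ι : Type*} [Fintype ι]

theorem sum_inner_sq_le_of_orthonormal {κ : Type*} {b : κ → EuclideanSpace ℝ ι}
    (hb : Orthonormal ℝ b)
    (S : Finset κ) (ξ : EuclideanSpace ℝ ι) : ∑ j ∈ S, ⟪b j, ξ⟫ ^ 2 ≤ ‖ξ‖ ^ 2 := by
  simpa using hb.sum_inner_products_le (s := S) ξ

theorem dotProduct_vecMulVec_mulVec (v x : EuclideanSpace ℝ ι) :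
    x.ofLp ⬝ᵥ (Matrix.vecMulVec v v).mulVec x = ⟪v, x⟫ ^ 2 := by
  have h : ⟪v, x⟫ = v.ofLp ⬝ᵥ x.ofLp := by
    simp [PiLp.inner_apply, dotProduct, mul_comm]
  rw [h, Matrix.vecMulVec_mulVec]
  simp [dotProduct_comm x.ofLp, sq]

theorem dotProduct_self_eq_norm_sq (x : EuclideanSpace ℝ ι) : x.ofLp ⬝ᵥ x.ofLp = ‖x‖ ^ 2 := by
  rw [EuclideanSpace.real_norm_sq_eq]
  simp [dotProduct, sq]

variable {κ : Type*} [Fintype κ] [DecidableEq ι]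

/-- A centered Gaussian law with covariance `1 - ∑ tᵢ tᵢᵀ + θ v vᵀ`. -/
theorem exists_gaussian_of_quadratic_nonneg (t : κ → EuclideanSpace ℝ ι) (θ : ℝ)
    (v : EuclideanSpace ℝ ι)
    (h : ∀ ξ, 0 ≤ ‖ξ‖ ^ 2 - ∑ i, ⟪t i, ξ⟫ ^ 2 + θ * ⟪v, ξ⟫ ^ 2) :
    ∃ ρ : Measure (EuclideanSpace ℝ ι), IsProbabilityMeasure ρ ∧ ∀ ξ, charFun ρ ξ =
      Complex.exp (-((‖ξ‖ ^ 2 - ∑ i, ⟪t i, ξ⟫ ^ 2 + θ * ⟪v, ξ⟫ ^ 2 : ℝ) : ℂ) / 2) := by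
  set S : Matrix ι ι ℝ := 1 - ∑ i, Matrix.vecMulVec (t i) (t i) + θ • Matrix.vecMulVec v v with hS
  have hq : ∀ x : EuclideanSpace ℝ ι, x.ofLp ⬝ᵥ S.mulVec x =
      ‖x‖ ^ 2 - ∑ i, ⟪t i, x⟫ ^ 2 + θ * ⟪v, x⟫ ^ 2 := by
    intro x
    simp only [hS, Matrix.add_mulVec, Matrix.sub_mulVec, Matrix.one_mulVec, Matrix.smul_mulVec,
      Matrix.sum_mulVec, dotProduct_add, dotProduct_sub, dotProduct_sum, dotProduct_smul,
      dotProduct_vecMulVec_mulVec, dotProduct_self_eq_norm_sq, smul_eq_mul]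
  have hps : S.PosSemidef := by
    refine Matrix.PosSemidef.of_dotProduct_mulVec_nonneg ?_ fun x => ?_
    · have hv : ∀ w : EuclideanSpace ℝ ι, (Matrix.vecMulVec w w : Matrix ι ι ℝ).IsHermitian := by
        intro w
        ext i j
        simp [Matrix.vecMulVec_apply, mul_comm]
      refine Matrix.IsHermitian.add (Matrix.IsHermitian.sub Matrix.isHermitian_one ?_) ?_
      · ext i j
        simp [Matrix.sum_apply, Matrix.vecMulVec_apply, mul_comm]
      · ext i j
        simp [Matrix.vecMulVec_apply, mul_comm]
    · have := h (WithLp.toLp 2 x)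
      rw [← hq] at this
      simpa using this
  refine ⟨multivariateGaussian 0 S, inferInstance, fun ξ => ?_⟩
  rw [charFun_multivariateGaussian hps]
  congr 1
  rw [hq]
  simp
  ring

theorem charFun_spiked {θ : ℝ} (hθ : 0 ≤ θ) (v ξ : EuclideanSpace ℝ ι) :
    charFun (multivariateGaussian 0 (1 + θ • Matrix.vecMulVec v v)) ξ =
      Complex.exp (-((‖ξ‖ ^ 2 + θ * ⟪v, ξ⟫ ^ 2 : ℝ) : ℂ) / 2) := by
  have hq : ∀ x : EuclideanSpace ℝ ι, x.ofLp ⬝ᵥ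
      (1 + θ • Matrix.vecMulVec v v : Matrix ι ι ℝ).mulVec x = ‖x‖ ^ 2 + θ * ⟪v, x⟫ ^ 2 := by
    intro x
    simp only [Matrix.add_mulVec, Matrix.one_mulVec, Matrix.smul_mulVec, dotProduct_add,
      dotProduct_smul, dotProduct_vecMulVec_mulVec, dotProduct_self_eq_norm_sq, smul_eq_mul]
  have hps : (1 + θ • Matrix.vecMulVec v v : Matrix ι ι ℝ).PosSemidef := by
    refine Matrix.PosSemidef.of_dotProduct_mulVec_nonneg ?_ fun x => ?_
    · refine Matrix.IsHermitian.add Matrix.isHermitian_one ?_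
      ext i j
      simp [Matrix.vecMulVec_apply, mul_comm]
    · have : 0 ≤ ‖WithLp.toLp 2 x‖ ^ 2 + θ * ⟪v, WithLp.toLp 2 x⟫ ^ 2 := by positivity
      rw [← hq] at this
      simpa using this
  rw [charFun_multivariateGaussian hps, hq]
  congr 1
  simp
  ring

/-- A random vector `∑ yᵢ tᵢ` with bounded covariance is completed to a standard Gaussian. -/
theorem exists_gaussian_completion (t : κ → EuclideanSpace ℝ ι)
    (h : ∀ ξ, ∑ i, ⟪t i, ξ⟫ ^ 2 ≤ ‖ξ‖ ^ 2) :
    ∃ ρ : Measure (EuclideanSpace ℝ ι), IsProbabilityMeasure ρ ∧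
      (ρ.prod (Measure.pi fun _ : κ => gaussianReal 0 1)).map (fun q => q.1 + ∑ i, q.2 i • t i) =
        stdGaussian (EuclideanSpace ℝ ι) := by
  obtain ⟨ρ, hρ, hc⟩ := exists_gaussian_of_quadratic_nonneg t 0 0
    (fun ξ => by simpa using h ξ)
  refine ⟨ρ, hρ, ?_⟩
  have : IsProbabilityMeasure ((ρ.prod (Measure.pi fun _ : κ => gaussianReal 0 1)).map
      (fun q => q.1 + ∑ i, q.2 i • t i)) :=
    Measure.isProbabilityMeasure_map (Measurable.aemeasurable (by fun_prop))
  refine Measure.ext_of_charFun (funext fun ξ => ?_)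
  rw [charFun_prod_pi_gaussianReal_map ρ (fun _ => 1), hc, charFun_stdGaussian, ← Complex.exp_add]
  congr 1
  push_cast
  simp
  ring

variable [DecidableEq κ]

/-- The law of one row of the transformed planted instance, and of the spiked covariance model,
through independent Gaussian coordinates of variance `1 + σ²`, respectively `1`. -/
theorem exists_spiked_row_decomposition {b : κ → EuclideanSpace ℝ ι} (hb : Orthonormal ℝ b)
    (S : Finset κ) (hS : 2 < S.card) (v : ℝ≥0) (c : ℝ) {σ2 θ : ℝ} (hσ : (v : ℝ) * c ^ 2 = σ2)
    (hθ : θ = σ2 * (S.card * (S.card - 2))) :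
    ∃ ρ : Measure (EuclideanSpace ℝ ι), IsProbabilityMeasure ρ ∧
      ((stdGaussian (EuclideanSpace ℝ ι)).prod (Measure.pi fun _ : κ => gaussianReal 0 v)).map
        (fun q => q.1 + ∑ i, q.2 i • if i ∈ S then c • ∑ j ∈ S.erase i, b j else 0) =
      (ρ.prod (Measure.pi fun _ : κ => gaussianReal 0 (1 + σ2).toNNReal)).map
        (fun q => q.1 + ∑ j, q.2 j • if j ∈ S then b j else 0) ∧
      multivariateGaussian 0 (1 + θ • Matrix.vecMulVec
          ((√S.card)⁻¹ • ∑ j ∈ S, b j : EuclideanSpace ℝ ι)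
          ((√S.card)⁻¹ • ∑ j ∈ S, b j : EuclideanSpace ℝ ι)) =
      (ρ.prod (Measure.pi fun _ : κ => gaussianReal 0 1)).map
        (fun q => q.1 + ∑ j, q.2 j • if j ∈ S then b j else 0) := by
  have hk : (2 : ℝ) < S.card := by exact_mod_cast hS
  have hσ0 : 0 ≤ σ2 := by rw [← hσ]; positivity
  have hθ0 : 0 ≤ θ := by
    rw [hθ]; exact mul_nonneg hσ0 (mul_nonneg (by linarith) (by linarith))
  set w : EuclideanSpace ℝ ι := (√S.card)⁻¹ • ∑ j ∈ S, b j with hw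
  have hx : ∀ ξ, ∑ j, ⟪if j ∈ S then b j else 0, ξ⟫ ^ 2 = ∑ j ∈ S, ⟪b j, ξ⟫ ^ 2 := by
    intro ξ
    rw [← Finset.sum_filter_add_sum_filter_not Finset.univ (· ∈ S)]
    simp only [Finset.filter_univ_mem]
    rw [Finset.sum_congr rfl (g := fun j => ⟪b j, ξ⟫ ^ 2) fun j hj => by simp [hj],
      Finset.sum_eq_zero (s := Finset.filter _ _) fun j hj => by
        simp [(Finset.mem_filter.1 hj).2], add_zero]
  -- `ρ` has covariance `1 - ∑_{j ∈ S} b j (b j)ᵀ + θ w wᵀ`, nonnegative by Bessel's inequality.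
  -- Coordinates of variance `1` along the `b j` restore the spiked law; variance `1 + σ2` gives the
  -- transformed clique.
  obtain ⟨ρ, hρ, hc⟩ := exists_gaussian_of_quadratic_nonneg (fun j => if j ∈ S then b j else 0) θ w
    (fun ξ => by
      rw [hx]
      have := sum_inner_sq_le_of_orthonormal hb S ξ
      have : 0 ≤ θ * ⟪w, ξ⟫ ^ 2 := by positivity
      linarith)
  refine ⟨ρ, hρ, ?_, ?_⟩
  · have : IsProbabilityMeasure (((stdGaussian (EuclideanSpace ℝ ι)).prod
        (Measure.pi fun _ : κ => gaussianReal 0 v)).map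
        (fun q => q.1 + ∑ i, q.2 i • if i ∈ S then c • ∑ j ∈ S.erase i, b j else 0)) :=
      Measure.isProbabilityMeasure_map (Measurable.aemeasurable (by fun_prop))
    have : IsProbabilityMeasure
        ((ρ.prod (Measure.pi fun _ : κ => gaussianReal 0 (1 + σ2).toNNReal)).map
        (fun q => q.1 + ∑ j, q.2 j • if j ∈ S then b j else 0)) :=
      Measure.isProbabilityMeasure_map (Measurable.aemeasurable (by fun_prop))
    refine Measure.ext_of_charFun (funext fun ξ => ?_)
    rw [charFun_prod_pi_gaussianReal_map _ (fun _ => v),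
      charFun_prod_pi_gaussianReal_map ρ (fun _ => (1 + σ2).toNNReal), hc, charFun_stdGaussian,
      ← Complex.exp_add, ← Complex.exp_add]
    congr 1
    have key : ‖ξ‖ ^ 2 + ∑ i, (v : ℝ) *
        ⟪if i ∈ S then c • ∑ j ∈ S.erase i, b j else 0, ξ⟫ ^ 2 =
        (‖ξ‖ ^ 2 - ∑ j, ⟪if j ∈ S then b j else 0, ξ⟫ ^ 2 + θ * ⟪w, ξ⟫ ^ 2) +
          ∑ j, ((1 + σ2).toNNReal : ℝ) * ⟪if j ∈ S then b j else 0, ξ⟫ ^ 2 := by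
      rw [← Finset.mul_sum, ← Finset.mul_sum, hx, Real.coe_toNNReal _ (by linarith)]
      set P := ∑ j ∈ S, ⟪b j, ξ⟫ with hP
      have h1 : ∑ i, ⟪if i ∈ S then c • ∑ j ∈ S.erase i, b j else 0, ξ⟫ ^ 2 =
          ∑ i ∈ S, c ^ 2 * (P - ⟪b i, ξ⟫) ^ 2 := by
        rw [← Finset.sum_filter_add_sum_filter_not Finset.univ (· ∈ S)]
        simp only [Finset.filter_univ_mem]
        rw [Finset.sum_eq_zero (s := Finset.filter _ _) fun j hj => by
          simp [(Finset.mem_filter.1 hj).2], add_zero]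
        refine Finset.sum_congr rfl fun i hi => ?_
        rw [if_pos hi, real_inner_smul_left, sum_inner, mul_pow, hP, ← Finset.add_sum_erase S _ hi]
        ring
      have h2 : ⟪w, ξ⟫ ^ 2 = P ^ 2 / S.card := by
        rw [hw, real_inner_smul_left, sum_inner, mul_pow, inv_pow,
          Real.sq_sqrt (by linarith)]
        ring
      -- The diagonal is absent because a graph has no loops. This is the source of the factor `k -
      -- 2` in `θ` and of the surplus variance `σ2` along each `b i`.
      have h3 : ∑ i ∈ S, c ^ 2 * (P - ⟪b i, ξ⟫) ^ 2 =
          c ^ 2 * ((S.card - 2) * P ^ 2 + ∑ i ∈ S, ⟪b i, ξ⟫ ^ 2) := by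
        rw [← Finset.mul_sum]
        congr 1
        simp_rw [sub_sq, Finset.sum_add_distrib, Finset.sum_sub_distrib, ← Finset.mul_sum,
          Finset.sum_const, nsmul_eq_mul, ← hP]
        ring
      rw [h1, h2, h3, hθ, ← hσ]
      field_simp
      ring
    have key' := congrArg (fun x : ℝ => -(x : ℂ) / 2) key
    simp only [Complex.ofReal_add, neg_add, add_div] at key' ⊢
    convert key' using 2
    push_cast; ring
  · have : IsProbabilityMeasure
        ((ρ.prod (Measure.pi fun _ : κ => gaussianReal 0 1)).map
        (fun q => q.1 + ∑ j, q.2 j • if j ∈ S then b j else 0)) :=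
      Measure.isProbabilityMeasure_map (Measurable.aemeasurable (by fun_prop))
    refine Measure.ext_of_charFun (funext fun ξ => ?_)
    rw [charFun_prod_pi_gaussianReal_map ρ (fun _ => 1), hc, charFun_spiked hθ0, ← Complex.exp_add]
    congr 1
    push_cast
    simp
    ring

end Covariance

/-! ### Quadratic exponential moments and products -/

theorem lintegral_exp_mul_sq_gaussianReal {c : ℝ} (hc : c < 1 / 2) :
    ∫⁻ x, ENNReal.ofReal (Real.exp (c * x ^ 2)) ∂gaussianReal 0 1 =
      ENNReal.ofReal (√(1 - 2 * c))⁻¹ := by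
  have hb : 0 < 1 / 2 - c := by linarith
  rw [gaussianReal_of_var_ne_zero _ one_ne_zero,
    lintegral_withDensity_eq_lintegral_mul _ (measurable_gaussianPDF _ _) (by fun_prop)]
  have h : ∀ x : ℝ, (gaussianPDF 0 1 * fun x => ENNReal.ofReal (Real.exp (c * x ^ 2))) x =
      ENNReal.ofReal ((√(2 * Real.pi))⁻¹ * Real.exp (-(1 / 2 - c) * x ^ 2)) := by
    intro x
    simp only [Pi.mul_apply, gaussianPDF]
    rw [← ENNReal.ofReal_mul (gaussianPDFReal_nonneg _ _ _)]
    simp only [gaussianPDFReal, NNReal.coe_one, mul_one, sub_zero]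
    rw [mul_assoc, ← Real.exp_add]
    ring_nf
  simp_rw [h]
  rw [← ofReal_integral_eq_lintegral_ofReal ((integrable_exp_neg_mul_sq hb).const_mul _)
    (ae_of_all _ fun x => by positivity), integral_const_mul, integral_gaussian]
  congr 1
  rw [← Real.sqrt_inv, ← Real.sqrt_mul (by positivity), ← Real.sqrt_inv]
  congr 1
  have : 1 - 2 * c ≠ 0 := by linarith
  have : 1 / 2 - c ≠ 0 := by linarith
  field_simp

theorem lintegral_pi_prod {ι : Type*} [Fintype ι] {X : ι → Type*} [∀ i, MeasurableSpace (X i)]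
    (μ : ∀ i, Measure (X i)) [∀ i, IsProbabilityMeasure (μ i)] {f : ∀ i, X i → ℝ≥0∞}
    (hf : ∀ i, Measurable (f i)) :
    ∫⁻ x, ∏ i, f i (x i) ∂Measure.pi μ = ∏ i, ∫⁻ x, f i x ∂μ i := by
  classical
  refine (lintegral_prod_eq_prod_lintegral_of_indepFun Finset.univ
    (fun i (x : ∀ i, X i) => f i (x i))
    (iIndepFun_pi fun i => (hf i).aemeasurable)
    (fun i => (hf i).comp (measurable_pi_apply i))).trans ?_
  refine Finset.prod_congr rfl fun i _ => ?_
  rw [← lintegral_map (hf i) (measurable_pi_apply i), Measure.pi_map_eval]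
  simp

theorem pi_pi_eq_map_curry {ι κ X : Type*} [Fintype ι] [Fintype κ] [MeasurableSpace X]
    (μ : ι → κ → Measure X) [∀ i j, IsProbabilityMeasure (μ i j)] :
    (Measure.pi fun i => Measure.pi fun j => μ i j) =
      (Measure.pi fun p : ι × κ => μ p.1 p.2).map fun y i j => y (i, j) := by
  have h := Measure.infinitePi_map_curry μ
  simp only [Measure.infinitePi_eq_pi] at h
  exact h.symm

/-! ### The operator norm of a Gaussian matrix -/

/-- Different coordinates of the image use different columns of `A`, hence are independent, and each
has variance `v * ‖z‖²`. -/
theorem map_gaussian_matrix_mulVec {ι κ : Type*} [Fintype ι] [Fintype κ] [DecidableEq κ]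
    (v : ℝ≥0) (z : ι → ℝ) :
    (Measure.pi fun _ : ι => Measure.pi fun _ : κ => gaussianReal 0 v).map
      (fun A i => ∑ a, A a i * z a) =
      Measure.pi fun _ : κ => gaussianReal 0 (v * (∑ a, z a ^ 2).toNNReal) := by
  rw [pi_pi_eq_map_curry (fun _ _ => gaussianReal 0 v), Measure.map_map (by fun_prop) (by fun_prop)]
  have hinj : Function.Injective fun μ : Measure (κ → ℝ) => μ.map (WithLp.toLp 2) :=
    (MeasurableEquiv.toLp 2 (κ → ℝ)).map_measurableEquiv_injective
  apply hinj
  simp only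
  rw [Measure.map_map (by fun_prop) (by fun_prop)]
  have h1 : (WithLp.toLp 2 ∘ (fun (A : ι → κ → ℝ) i => ∑ a, A a i * z a) ∘
      fun (y : ι × κ → ℝ) i j => y (i, j)) =
      fun y => ∑ p : ι × κ, y p • (z p.1 • EuclideanSpace.single p.2 (1 : ℝ)) := by
    funext y
    ext i
    simp [Fintype.sum_prod_type, Finset.sum_apply, Pi.single_apply]
  rw [h1]
  have : IsProbabilityMeasure ((Measure.pi fun _ : ι × κ => gaussianReal 0 v).map
      fun y => ∑ p : ι × κ, y p • (z p.1 • EuclideanSpace.single p.2 (1 : ℝ))) :=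
    Measure.isProbabilityMeasure_map (Measurable.aemeasurable (by fun_prop))
  have : IsProbabilityMeasure ((Measure.pi fun _ : κ =>
      gaussianReal 0 (v * (∑ a, z a ^ 2).toNNReal)).map (WithLp.toLp 2)) :=
    Measure.isProbabilityMeasure_map (Measurable.aemeasurable (by fun_prop))
  refine Measure.ext_of_charFun (E := EuclideanSpace ℝ κ) (funext fun ξ => ?_)
  rw [charFun_pi_gaussianReal_map (fun _ => v), charFun_pi]
  simp_rw [charFun_gaussianReal]
  rw [← Complex.exp_sum]
  congr 1
  have hz : (0 : ℝ) ≤ ∑ a, z a ^ 2 := Finset.sum_nonneg fun _ _ => sq_nonneg _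
  simp only [Complex.ofReal_zero, mul_zero, zero_mul, zero_sub, NNReal.coe_mul,
    Real.coe_toNNReal _ hz, Finset.sum_neg_distrib, neg_div]
  rw [← Finset.sum_div]
  congr 2
  rw [Fintype.sum_prod_type]
  simp only [real_inner_smul_left, EuclideanSpace.inner_single_left]
  push_cast
  simp only [mul_pow, Finset.sum_mul, Finset.mul_sum]
  rw [Finset.sum_comm]
  refine Finset.sum_congr rfl fun i _ => Finset.sum_congr rfl fun a _ => ?_
  simp
  ring

/-- Each coordinate contributes `(1 - 2 c w)^{-1/2} ≤ √2`, rounded up to `2`. -/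
theorem lintegral_exp_sum_sq_gaussian_le {κ : Type*} [Fintype κ] (w : ℝ≥0) {c : ℝ}
    (hc : c * w ≤ 1 / 4) :
    ∫⁻ y, ENNReal.ofReal (Real.exp (c * ∑ i, y i ^ 2)) ∂(Measure.pi fun _ : κ => gaussianReal 0 w) ≤
      2 ^ Fintype.card κ := by
  have h1 : ∀ y : κ → ℝ, ENNReal.ofReal (Real.exp (c * ∑ i, y i ^ 2)) =
      ∏ i, ENNReal.ofReal (Real.exp (c * y i ^ 2)) := by
    intro y
    rw [← ENNReal.ofReal_prod_of_nonneg fun i _ => (Real.exp_pos _).le, ← Real.exp_sum,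
      Finset.mul_sum]
  simp_rw [h1]
  rw [lintegral_pi_prod (fun _ => gaussianReal 0 w) (f := fun _ x =>
    ENNReal.ofReal (Real.exp (c * x ^ 2))) (fun _ => by fun_prop), Finset.prod_const,
    Finset.card_univ]
  refine pow_le_pow_left' ?_ _
  have h2 : gaussianReal 0 w = (gaussianReal 0 1).map (√w * ·) := by
    rw [gaussianReal_map_const_mul]
    simp only [mul_zero, mul_one]
    congr 1
    ext
    simp
  rw [h2, lintegral_map (by fun_prop) (by fun_prop)]
  calc ∫⁻ x, ENNReal.ofReal (Real.exp (c * (√w * x) ^ 2)) ∂gaussianReal 0 1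
      ≤ ∫⁻ x, ENNReal.ofReal (Real.exp (1 / 4 * x ^ 2)) ∂gaussianReal 0 1 := by
        refine lintegral_mono fun x => ENNReal.ofReal_le_ofReal (Real.exp_le_exp.2 ?_)
        rw [mul_pow, Real.sq_sqrt w.coe_nonneg, ← mul_assoc]
        gcongr
    _ = ENNReal.ofReal (√(1 - 2 * (1 / 4)))⁻¹ :=
        lintegral_exp_mul_sq_gaussianReal (by norm_num)
    _ ≤ ENNReal.ofReal 2 := by
        refine ENNReal.ofReal_le_ofReal (inv_le_of_inv_le₀ (by norm_num) ?_)
        refine Real.le_sqrt_of_sq_le ?_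
        norm_num
    _ = 2 := by simp

/-! ### A net of integer points -/

theorem sum_Icc_half_pow_natAbs_le (M : ℕ) :
    ∑ k ∈ Finset.Icc (-(M : ℤ)) M, (1 / 2 : ℝ) ^ k.natAbs ≤ 3 := by
  have h : ∑ k ∈ Finset.Icc (-(M : ℤ)) M, (1 / 2 : ℝ) ^ k.natAbs = 3 - 2 * (1 / 2) ^ M := by
    induction M with
    | zero => norm_num
    | succ M ih =>
      have h1 : Finset.Icc (-((M + 1 : ℕ) : ℤ)) ((M + 1 : ℕ) : ℤ) =
          insert ((M + 1 : ℕ) : ℤ) (insert (-((M + 1 : ℕ) : ℤ)) (Finset.Icc (-(M : ℤ)) M)) := by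
        ext k
        simp only [Finset.mem_Icc, Finset.mem_insert]
        omega
      have h2 : (-((M + 1 : ℕ) : ℤ)) ∉ Finset.Icc (-(M : ℤ)) M := by
        simp only [Finset.mem_Icc]; omega
      have h3 : ((M + 1 : ℕ) : ℤ) ∉ insert (-((M + 1 : ℕ) : ℤ)) (Finset.Icc (-(M : ℤ)) M) := by
        simp only [Finset.mem_insert, Finset.mem_Icc]; omega
      rw [h1, Finset.sum_insert h3, Finset.sum_insert h2, ih, Int.natAbs_neg, Int.natAbs_natCast]
      ring
  rw [h]
  have : (0 : ℝ) ≤ 2 * (1 / 2) ^ M := by positivity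
  linarith

/-- The integer points in the ball of squared radius `R`. -/
noncomputable def integerBall (N R : ℕ) : Finset (Fin N → ℤ) :=
  {z ∈ Fintype.piFinset fun _ => Finset.Icc (-(R : ℤ)) R | ∑ a, z a ^ 2 ≤ R}

theorem mem_integerBall {N R : ℕ} {z : Fin N → ℤ} :
    z ∈ integerBall N R ↔ ∑ a, z a ^ 2 ≤ (R : ℤ) := by
  simp only [integerBall, Finset.mem_filter, Fintype.mem_piFinset, Finset.mem_Icc,
    and_iff_right_iff_imp]
  intro h a
  have h1 : z a ^ 2 ≤ R := (Finset.single_le_sum (fun i _ => sq_nonneg (z i))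
    (Finset.mem_univ a)).trans h
  have h2 := Int.natAbs_le_self_sq (z a)
  omega

/-- For integers `∑ |z a| ≤ ∑ (z a)² ≤ R`, so every point of the ball has weight at least `1` under
`2 ^ R * ∏ 2 ^ (-|z a|)`. The total weight factorises over the coordinates. -/
theorem card_integerBall_le (N R : ℕ) : ((integerBall N R).card : ℝ) ≤ 2 ^ R * 3 ^ N := by
  have h1 : ∀ z ∈ integerBall N R, (1 : ℝ) ≤ 2 ^ R * ∏ a, (1 / 2 : ℝ) ^ (z a).natAbs := by
    intro z hz
    have h2 := mem_integerBall.1 hz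
    have h3 : ∑ a, (z a).natAbs ≤ R := by
      have : ((∑ a, (z a).natAbs : ℕ) : ℤ) ≤ ∑ a, z a ^ 2 := by
        push_cast
        exact Finset.sum_le_sum fun a _ => by simpa using Int.natAbs_le_self_sq (z a)
      omega
    rw [Finset.prod_pow_eq_pow_sum]
    calc (1 : ℝ) = 2 ^ R * (1 / 2) ^ R := by rw [← mul_pow]; norm_num
      _ ≤ _ := by
        gcongr 2 ^ R * ?_
        exact pow_le_pow_of_le_one (by norm_num) (by norm_num) h3
  calc ((integerBall N R).card : ℝ) = ∑ z ∈ integerBall N R, (1 : ℝ) := by simp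
    _ ≤ ∑ z ∈ integerBall N R, 2 ^ R * ∏ a, (1 / 2 : ℝ) ^ (z a).natAbs := Finset.sum_le_sum h1
    _ ≤ ∑ z ∈ Fintype.piFinset fun _ : Fin N => Finset.Icc (-(R : ℤ)) R,
          2 ^ R * ∏ a, (1 / 2 : ℝ) ^ (z a).natAbs :=
        Finset.sum_le_sum_of_subset_of_nonneg (Finset.filter_subset _ _)
          fun _ _ _ => by positivity
    _ = 2 ^ R * ∏ _a : Fin N, ∑ k ∈ Finset.Icc (-(R : ℤ)) R, (1 / 2 : ℝ) ^ k.natAbs := by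
        rw [← Finset.mul_sum, Finset.prod_univ_sum]
    _ ≤ 2 ^ R * 3 ^ N := by
        rw [Finset.prod_const, Finset.card_univ, Fintype.card_fin]
        gcongr
        exact sum_Icc_half_pow_natAbs_le R

/-- A bound on integer points bounds a matrix on all vectors. -/
theorem contraction_of_integerBall {N n : ℕ} (A : Fin N → Fin n → ℝ)
    (h : ∀ z ∈ integerBall N (7 * N), ∑ i, (∑ a, A a i * z a) ^ 2 ≤ (2 * N : ℝ)) (x : Fin N → ℝ) :
    ∑ i, (∑ a, A a i * x a) ^ 2 ≤ ∑ a, x a ^ 2 := by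
  rcases Nat.eq_zero_or_pos N with rfl | hN
  · simp
  have hN' : (0 : ℝ) < N := by exact_mod_cast hN
  let T : EuclideanSpace ℝ (Fin N) →L[ℝ] EuclideanSpace ℝ (Fin n) :=
    LinearMap.toContinuousLinearMap (Matrix.toEuclideanLin (Matrix.of fun i a => A a i))
  have hT : ∀ y i, T y i = ∑ a, A a i * y a := by
    intro y i
    simp [T, Matrix.toLpLin_apply, Matrix.mulVec, dotProduct]
  have hTn : ∀ y, ‖T y‖ ^ 2 = ∑ i, (∑ a, A a i * y a) ^ 2 := by
    intro y
    rw [EuclideanSpace.real_norm_sq_eq]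
    simp_rw [hT]
  set τ := ‖T‖ with hτ
  have hτ0 : 0 ≤ τ := norm_nonneg _
  have hs : 0 < √(N : ℝ) := Real.sqrt_pos.2 hN'
  have hss : √(N : ℝ) ^ 2 = N := Real.sq_sqrt hN'.le
  -- Net argument: a unit vector scaled by `2√N` is rounded to an integer point `z`. The error is at
  -- most `√N / 2`, so `‖z‖² ≤ 25/4 * N ≤ 7 * N`. The hypothesis bounds the image of `z`, and the
  -- error costs `τ / 4`, which is absorbed on the left.
  have hle : τ ≤ √2 / 2 + τ / 4 := by
    refine T.opNorm_le_of_unit_norm (by positivity) fun y hy => ?_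
    let z : Fin N → ℤ := fun a => round (2 * √(N : ℝ) * y a)
    let zr : EuclideanSpace ℝ (Fin N) := WithLp.toLp 2 fun a => (z a : ℝ)
    have hd : ‖(2 * √(N : ℝ)) • y - zr‖ ≤ √N / 2 := by
      have h2 : ‖(2 * √(N : ℝ)) • y - zr‖ ^ 2 ≤ (√N / 2) ^ 2 := by
        rw [EuclideanSpace.real_norm_sq_eq, div_pow, hss]
        calc ∑ a, ((2 * √(N : ℝ)) • y - zr) a ^ 2 ≤ ∑ _a : Fin N, (1 / 2 : ℝ) ^ 2 := by
              refine Finset.sum_le_sum fun a _ => ?_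
              have := abs_sub_round (2 * √(N : ℝ) * y a)
              rw [← sq_abs]
              exact pow_le_pow_left₀ (abs_nonneg _) (by simpa [zr, z] using this) 2
          _ = N / 2 ^ 2 := by simp; ring
      exact abs_le_of_sq_le_sq' h2 (by positivity) |>.2
    have hz : ‖zr‖ ≤ 5 / 2 * √N := by
      calc ‖zr‖ = ‖(2 * √(N : ℝ)) • y - ((2 * √(N : ℝ)) • y - zr)‖ := by congr 1; abel
        _ ≤ ‖(2 * √(N : ℝ)) • y‖ + ‖(2 * √(N : ℝ)) • y - zr‖ := norm_sub_le _ _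
        _ ≤ 2 * √N + √N / 2 := by
          gcongr
          rw [norm_smul, hy, mul_one, Real.norm_of_nonneg (by positivity)]
        _ = _ := by ring
    have hzmem : z ∈ integerBall N (7 * N) := by
      rw [mem_integerBall]
      have h3 : ((∑ a, z a ^ 2 : ℤ) : ℝ) ≤ 7 * (N : ℝ) := by
        have h4 : ‖zr‖ ^ 2 = ((∑ a, z a ^ 2 : ℤ) : ℝ) := by
          rw [EuclideanSpace.real_norm_sq_eq]
          simp [zr]
        rw [← h4]
        calc ‖zr‖ ^ 2 ≤ (5 / 2 * √(N : ℝ)) ^ 2 := by gcongr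
          _ = 25 / 4 * (N : ℝ) := by rw [mul_pow, hss]; norm_num
          _ ≤ 7 * (N : ℝ) := by nlinarith
      exact_mod_cast h3
    have hTz : ‖T zr‖ ≤ √2 * √N := by
      have h5 : ‖T zr‖ ^ 2 ≤ (√2 * √N) ^ 2 := by
        rw [hTn, mul_pow, hss, Real.sq_sqrt (by norm_num)]
        exact h z hzmem
      exact abs_le_of_sq_le_sq' h5 (by positivity) |>.2
    have hfin : 2 * √N * ‖T y‖ ≤ √2 * √N + τ * (√N / 2) := by
      calc 2 * √N * ‖T y‖ = ‖T ((2 * √(N : ℝ)) • y)‖ := by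
            rw [map_smul, norm_smul, Real.norm_of_nonneg (by positivity)]
        _ = ‖T zr + T ((2 * √(N : ℝ)) • y - zr)‖ := by rw [← map_add]; congr 2; abel
        _ ≤ ‖T zr‖ + ‖T ((2 * √(N : ℝ)) • y - zr)‖ := norm_add_le _ _
        _ ≤ √2 * √N + τ * (√N / 2) := by
          gcongr
          exact (T.le_opNorm _).trans (by gcongr)
    have : 2 * √N * ‖T y‖ ≤ 2 * √N * (√2 / 2 + τ / 4) := by
      refine hfin.trans_eq (by ring)
    exact le_of_mul_le_mul_left this (by positivity)
  have hτ1 : τ ≤ 1 := by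
    have : √2 ≤ 3 / 2 := Real.sqrt_le_iff.2 ⟨by norm_num, by norm_num⟩
    linarith
  have h6 := T.le_opNorm (WithLp.toLp 2 x)
  have h7 : ‖T (WithLp.toLp 2 x)‖ ≤ ‖WithLp.toLp 2 x‖ :=
    h6.trans (mul_le_of_le_one_left (norm_nonneg _) hτ1)
  have h8 := pow_le_pow_left₀ (norm_nonneg _) h7 2
  rw [hTn, EuclideanSpace.real_norm_sq_eq] at h8
  simpa using h8

/-- Union bound over at most `(2 ^ 7 * 3) ^ N` points, each with failure probability at most `2 ^ n
* exp (-14 N)`; here `2 ^ 7 * 3 * 2 * 2 ^ (-14) ≤ 1/2`. -/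
theorem gaussian_matrix_integerBall_bound {N n : ℕ} (hN : 0 < N) (hn : n ≤ N) {v : ℝ≥0} (hv : 0 < v)
    (hNv : N * v ≤ 1 / 200) :
    (Measure.pi fun _ : Fin N => Measure.pi fun _ : Fin n => gaussianReal 0 v)
      {A | ¬ ∀ z ∈ integerBall N (7 * N), ∑ i, (∑ a, A a i * (z a : ℝ)) ^ 2 ≤ (2 * N : ℝ)} ≤
      ENNReal.ofReal ((1 / 2) ^ N) := by
  set μ := Measure.pi fun _ : Fin N => Measure.pi fun _ : Fin n => gaussianReal 0 v with hμ
  have hN' : (0 : ℝ) < N := by exact_mod_cast hN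
  have hv' : (0 : ℝ) < v := hv
  -- The largest `c` with `c * v * (7 * N) ≤ 1/4`. Then `N * v ≤ 1/200` yields `c ≥ 7`, so that
  -- exceeding `2 * N` costs the factor `exp (-14 N)`.
  set c : ℝ := 1 / (28 * (N * v)) with hc
  have hc0 : 0 < c := by positivity
  have hpoint : ∀ z ∈ integerBall N (7 * N),
      μ {A | (2 * N : ℝ) < ∑ i, (∑ a, A a i * (z a : ℝ)) ^ 2} ≤
        2 ^ n * ENNReal.ofReal (Real.exp (-(14 * N))) := by
    intro z hz
    have hz2 : ∑ a, (z a : ℝ) ^ 2 ≤ 7 * N := by exact_mod_cast mem_integerBall.1 hz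
    have hz0 : (0 : ℝ) ≤ ∑ a, (z a : ℝ) ^ 2 := Finset.sum_nonneg fun _ _ => sq_nonneg _
    have hm : Measurable fun (A : Fin N → Fin n → ℝ) i => ∑ a, A a i * (z a : ℝ) := by fun_prop
    have hms : MeasurableSet {y : Fin n → ℝ | (2 * N : ℝ) < ∑ i, y i ^ 2} :=
      measurableSet_lt (by fun_prop) (by fun_prop)
    have h1 : μ {A | (2 * N : ℝ) < ∑ i, (∑ a, A a i * (z a : ℝ)) ^ 2} =
        (Measure.pi fun _ : Fin n => gaussianReal 0 (v * (∑ a, (z a : ℝ) ^ 2).toNNReal))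
          {y | (2 * N : ℝ) < ∑ i, y i ^ 2} := by
      rw [← map_gaussian_matrix_mulVec, Measure.map_apply hm hms]
      rfl
    rw [h1]
    have h2 := lintegral_exp_sum_sq_gaussian_le (κ := Fin n)
      (v * (∑ a, (z a : ℝ) ^ 2).toNNReal) (c := c) (by
        rw [NNReal.coe_mul, Real.coe_toNNReal _ hz0]
        calc c * (v * ∑ a, (z a : ℝ) ^ 2) ≤ c * (v * (7 * N)) := by gcongr
          _ = 1 / 4 := by rw [hc]; field_simp; norm_num)
    rw [Fintype.card_fin] at h2
    set π := Measure.pi fun _ : Fin n => gaussianReal 0 (v * (∑ a, (z a : ℝ) ^ 2).toNNReal)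
    have h3 := mul_meas_ge_le_lintegral (μ := π)
      (f := fun y => ENNReal.ofReal (Real.exp (c * ∑ i, y i ^ 2))) (by fun_prop)
      (ENNReal.ofReal (Real.exp (14 * N)))
    have h4 : π {y | (2 * N : ℝ) < ∑ i, y i ^ 2} ≤
        π {y | ENNReal.ofReal (Real.exp (14 * N)) ≤
          ENNReal.ofReal (Real.exp (c * ∑ i, y i ^ 2))} := by
      refine measure_mono fun y hy => ENNReal.ofReal_le_ofReal (Real.exp_le_exp.2 ?_)
      have hy' : (2 * N : ℝ) < ∑ i, y i ^ 2 := hy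
      have hc2 : 7 ≤ c := by
        rw [hc, le_div_iff₀ (by positivity)]
        nlinarith
      nlinarith
    have h5 : ENNReal.ofReal (Real.exp (14 * N)) * ENNReal.ofReal (Real.exp (-(14 * N))) = 1 := by
      rw [← ENNReal.ofReal_mul (Real.exp_pos _).le, ← Real.exp_add]
      simp
    calc π {y | (2 * N : ℝ) < ∑ i, y i ^ 2}
        = ENNReal.ofReal (Real.exp (14 * N)) * π {y | (2 * N : ℝ) < ∑ i, y i ^ 2} *
            ENNReal.ofReal (Real.exp (-(14 * N))) := by
          rw [mul_right_comm, h5, one_mul]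
      _ ≤ 2 ^ n * ENNReal.ofReal (Real.exp (-(14 * N))) := by
          gcongr
          exact (mul_le_mul_right h4 _).trans (h3.trans h2)
  have hunion : {A : Fin N → Fin n → ℝ | ¬ ∀ z ∈ integerBall N (7 * N),
      ∑ i, (∑ a, A a i * (z a : ℝ)) ^ 2 ≤ (2 * N : ℝ)} =
      ⋃ z ∈ integerBall N (7 * N), {A | (2 * N : ℝ) < ∑ i, (∑ a, A a i * (z a : ℝ)) ^ 2} := by
    ext A
    simp
  rw [hunion]
  calc _ ≤ ∑ z ∈ integerBall N (7 * N),
        μ {A | (2 * N : ℝ) < ∑ i, (∑ a, A a i * (z a : ℝ)) ^ 2} := measure_biUnion_finset_le _ _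
    _ ≤ ∑ z ∈ integerBall N (7 * N), 2 ^ n * ENNReal.ofReal (Real.exp (-(14 * N))) :=
        Finset.sum_le_sum hpoint
    _ = ENNReal.ofReal ((integerBall N (7 * N)).card * (2 ^ n * Real.exp (-(14 * N)))) := by
        rw [Finset.sum_const, nsmul_eq_mul, ENNReal.ofReal_mul (by positivity),
          ENNReal.ofReal_mul (by positivity), ENNReal.ofReal_natCast, ENNReal.ofReal_pow (by simp)]
        simp
    _ ≤ ENNReal.ofReal ((1 / 2) ^ N) := by
        refine ENNReal.ofReal_le_ofReal ?_
        have he : Real.exp (-(14 * N)) ≤ ((1 / 2) ^ 14) ^ N := by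
          have : Real.exp (-1) ≤ 1 / 2 := by
            rw [Real.exp_neg, one_div]
            exact inv_anti₀ (by norm_num) (by linarith [Real.add_one_le_exp 1])
          calc Real.exp (-(14 * N)) = (Real.exp (-1) ^ 14) ^ N := by
                rw [← Real.exp_nat_mul, ← Real.exp_nat_mul]; congr 1; push_cast; ring
            _ ≤ _ := by gcongr
        calc ((integerBall N (7 * N)).card : ℝ) * (2 ^ n * Real.exp (-(14 * N)))
            ≤ (2 ^ (7 * N) * 3 ^ N) * (2 ^ N * ((1 / 2) ^ 14) ^ N) := by
              gcongr
              · exact card_integerBall_le _ _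
              · norm_num
          _ = (2 ^ 7 * 3 * 2 * (1 / 2) ^ 14) ^ N := by
              rw [pow_mul, ← mul_pow, ← mul_pow, ← mul_pow]; norm_num
          _ ≤ (1 / 2) ^ N := by gcongr; norm_num

/-! ### Chi-square bounds -/

/-- `μ` has a density with respect to `ν` whose second moment is at most `C`. -/
def HasSquareDensity {Ω : Type*} [MeasurableSpace Ω] (μ ν : Measure Ω) (C : ℝ≥0∞) : Prop :=
  ∃ L : Ω → ℝ≥0∞, Measurable L ∧ μ = ν.withDensity L ∧ ∫⁻ x, L x ^ 2 ∂ν ≤ C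

theorem HasSquareDensity.pi {ι : Type*} [Fintype ι] {X : Type*} [MeasurableSpace X]
    {μ ν : Measure X} [IsProbabilityMeasure μ] [IsProbabilityMeasure ν] {C : ℝ≥0∞}
    (h : HasSquareDensity μ ν C) :
    HasSquareDensity (Measure.pi fun _ : ι => μ) (Measure.pi fun _ : ι => ν)
      (C ^ Fintype.card ι) := by
  obtain ⟨L, hL, hμ, hC⟩ := h
  refine ⟨fun x => ∏ i, L (x i), by fun_prop, ?_, ?_⟩
  · refine Measure.pi_eq fun s hs => ?_
    rw [withDensity_apply _ (MeasurableSet.univ_pi hs), ← lintegral_indicator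
      (MeasurableSet.univ_pi hs)]
    have h1 : ∀ x : ι → X, (Set.univ.pi s).indicator (fun x => ∏ i, L (x i)) x =
        ∏ i, (s i).indicator L (x i) := by
      intro x
      by_cases hx : x ∈ Set.univ.pi s
      · rw [Set.indicator_of_mem hx]
        exact Finset.prod_congr rfl fun i _ => (Set.indicator_of_mem (hx i trivial) _).symm
      · rw [Set.indicator_of_notMem hx]
        simp only [Set.mem_pi, Set.mem_univ, true_implies, not_forall] at hx
        obtain ⟨i, hi⟩ := hx
        exact (Finset.prod_eq_zero (Finset.mem_univ i) (Set.indicator_of_notMem hi _)).symm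
    simp_rw [h1]
    rw [lintegral_pi_prod (fun _ => ν) (f := fun i => (s i).indicator L)
      fun i => hL.indicator (hs i)]
    refine Finset.prod_congr rfl fun i _ => ?_
    rw [lintegral_indicator (hs i), hμ, withDensity_apply _ (hs i)]
  · simp_rw [← Finset.prod_pow]
    rw [lintegral_pi_prod (fun _ => ν) (f := fun _ x => L x ^ 2) (fun _ => by fun_prop),
      Finset.prod_const, Finset.card_univ]
    exact pow_le_pow_left' hC _

/-- For truncated subtraction, the expansion of the square survives only as an inequality, strict
for `x < 1`. -/
theorem ENNReal.tsub_one_sq_add_two_mul_le (x : ℝ≥0∞) : (x - 1) ^ 2 + 2 * x ≤ x ^ 2 + 1 := by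
  induction x with
  | top => simp
  | coe x =>
    rcases le_total x 1 with h | h
    · have h1 : (x : ℝ≥0∞) - 1 = 0 := tsub_eq_zero_of_le (by exact_mod_cast h)
      rw [h1]
      norm_cast
      rw [← NNReal.coe_le_coe]
      push_cast
      nlinarith [sq_nonneg ((x : ℝ) - 1)]
    · obtain ⟨y, rfl⟩ := exists_add_of_le h
      have h1 : ((1 + y : ℝ≥0) : ℝ≥0∞) - 1 = y := by
        rw [ENNReal.coe_add, ENNReal.coe_one]
        exact ENNReal.add_sub_cancel_left ENNReal.one_ne_top
      rw [h1]
      norm_cast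
      apply le_of_eq
      ring

/-- Cauchy–Schwarz applied to the positive part of `L - 1`, which suffices for a one-sided
comparison of tests with values at most `1`. -/
theorem HasSquareDensity.lintegral_le {Ω : Type*} [MeasurableSpace Ω] {μ ν : Measure Ω}
    [IsProbabilityMeasure μ] [IsProbabilityMeasure ν] {C : ℝ≥0∞} (h : HasSquareDensity μ ν C)
    {f : Ω → ℝ≥0∞} (hf : Measurable f) (hf1 : ∀ x, f x ≤ 1) :
    ∫⁻ x, f x ∂μ ≤ ∫⁻ x, f x ∂ν + (C - 1) ^ (1 / 2 : ℝ) := by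
  obtain ⟨L, hL, hμ, hC⟩ := h
  have hL1 : ∫⁻ x, L x ∂ν = 1 := by
    have : μ Set.univ = 1 := measure_univ
    rwa [hμ, withDensity_apply _ MeasurableSet.univ, Measure.restrict_univ] at this
  have h2 : ∫⁻ x, (L x - 1) ^ 2 ∂ν ≤ C - 1 := by
    have h3 : ∫⁻ x, (L x - 1) ^ 2 ∂ν + 2 ≤ C + 1 := by
      calc ∫⁻ x, (L x - 1) ^ 2 ∂ν + 2 = ∫⁻ x, ((L x - 1) ^ 2 + 2 * L x) ∂ν := by
            rw [lintegral_add_left (by fun_prop), lintegral_const_mul _ hL, hL1, mul_one]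
        _ ≤ ∫⁻ x, (L x ^ 2 + 1) ∂ν := lintegral_mono fun x => ENNReal.tsub_one_sq_add_two_mul_le _
        _ = ∫⁻ x, L x ^ 2 ∂ν + 1 := by
            rw [lintegral_add_left (by fun_prop)]; simp
        _ ≤ C + 1 := by gcongr
    refine ENNReal.le_sub_of_add_le_right (by simp) ?_
    rw [← ENNReal.add_le_add_iff_right (ENNReal.one_ne_top), add_assoc, one_add_one_eq_two]
    exact h3
  have h4 : ∫⁻ x, (L x - 1) ∂ν ≤ (C - 1) ^ (1 / 2 : ℝ) := by
    have h5 := ENNReal.lintegral_mul_le_Lp_mul_Lq ν Real.HolderConjugate.two_two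
      (f := fun x => L x - 1) (g := fun _ => 1) (by fun_prop) (by fun_prop)
    simp only [Pi.mul_apply, mul_one, ENNReal.one_rpow, lintegral_const, measure_univ] at h5
    refine h5.trans ?_
    gcongr
    simpa using h2
  calc ∫⁻ x, f x ∂μ = ∫⁻ x, L x * f x ∂ν := by
        rw [hμ, lintegral_withDensity_eq_lintegral_mul _ hL hf]; rfl
    _ ≤ ∫⁻ x, (f x + (L x - 1)) ∂ν := by
        refine lintegral_mono fun x => ?_
        calc L x * f x ≤ (1 + (L x - 1)) * f x := by gcongr; exact le_add_tsub
          _ = f x + (L x - 1) * f x := by ring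
          _ ≤ f x + (L x - 1) := by
            gcongr
            exact mul_le_of_le_one_right' (hf1 x)
    _ = ∫⁻ x, f x ∂ν + ∫⁻ x, (L x - 1) ∂ν := lintegral_add_left hf _
    _ ≤ _ := by gcongr

/-- The density is `(1 + τ)^{-1/2} exp (τ x² / (2 (1 + τ)))`. Its second moment exceeds `1` only to
order `τ²`, which is why the reduction needs `n N σ2²`, not `n N σ2`, to be small. -/
theorem hasSquareDensity_gaussianReal {τ : ℝ} (h0 : 0 ≤ τ) (h1 : τ < 1) :
    HasSquareDensity (gaussianReal 0 (1 + τ).toNNReal) (gaussianReal 0 1)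
      (ENNReal.ofReal (√(1 - τ ^ 2))⁻¹) := by
  have hp : 0 < 1 + τ := by linarith
  refine ⟨fun x => ENNReal.ofReal ((√(1 + τ))⁻¹ * Real.exp (τ / (2 * (1 + τ)) * x ^ 2)),
    by fun_prop, ?_, ?_⟩
  · rw [gaussianReal_of_var_ne_zero _ one_ne_zero, gaussianReal_of_var_ne_zero _ (by
      simpa using hp), ← withDensity_mul _ (measurable_gaussianPDF _ _) (by fun_prop)]
    congr 1
    funext x
    simp only [Pi.mul_apply, gaussianPDF]
    rw [← ENNReal.ofReal_mul (gaussianPDFReal_nonneg _ _ _)]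
    congr 1
    simp only [gaussianPDFReal, NNReal.coe_one, mul_one, sub_zero, Real.coe_toNNReal _ hp.le]
    rw [Real.sqrt_mul (by positivity), mul_inv]
    have : Real.exp (-x ^ 2 / (2 * (1 + τ))) =
        Real.exp (-x ^ 2 / 2) * Real.exp (τ / (2 * (1 + τ)) * x ^ 2) := by
      rw [← Real.exp_add]
      congr 1
      field_simp
      ring
    rw [this]
    ring
  · have hsq : ∀ x : ℝ, ENNReal.ofReal ((√(1 + τ))⁻¹ * Real.exp (τ / (2 * (1 + τ)) * x ^ 2)) ^ 2 =
        ENNReal.ofReal (1 + τ)⁻¹ * ENNReal.ofReal (Real.exp (τ / (1 + τ) * x ^ 2)) := by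
      intro x
      rw [← ENNReal.ofReal_pow (by positivity), ← ENNReal.ofReal_mul (by positivity), mul_pow,
        inv_pow, Real.sq_sqrt hp.le, ← Real.exp_nat_mul]
      congr 3
      push_cast
      field_simp
    simp_rw [hsq]
    rw [lintegral_const_mul _ (by fun_prop), lintegral_exp_mul_sq_gaussianReal (by
      rw [div_lt_div_iff₀ hp (by norm_num)]; linarith), ← ENNReal.ofReal_mul (by positivity)]
    refine ENNReal.ofReal_le_ofReal (le_of_eq ?_)
    rw [← mul_inv]
    congr 1
    have h2 : 1 - τ ^ 2 = (1 + τ) ^ 2 * (1 - 2 * (τ / (1 + τ))) := by field_simp; ring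
    rw [h2, Real.sqrt_mul (by positivity), Real.sqrt_sq hp.le]

/-! ### Tests as functions of the observation -/

instance (r : ℕ) (o : RealOp) : IsMarkovKernel (RealOp.step r o) := by
  have hm : Measurable fun q : (ℕ → ℝ) × ℝ => Function.update q.1 r q.2 := by
    refine measurable_pi_lambda _ fun i => ?_
    by_cases hi : i = r
    · subst hi; simpa using measurable_snd
    · simp only [Function.update_of_ne hi]; fun_prop
  unfold RealOp.step
  exact Kernel.IsMarkovKernel.map _ hm

instance RealProgram.isMarkovKernel_run (P : RealProgram) : IsMarkovKernel (RealProgram.run P) := by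
  induction P with
  | nil => unfold RealProgram.run; infer_instance
  | cons q P ih =>
    obtain ⟨r, o⟩ := q
    have : RealProgram.run ((r, o) :: P) = RealProgram.run P ∘ₖ RealOp.step r o := rfl
    rw [this]
    infer_instance

theorem measurable_loadSamples (N d : ℕ) : Measurable (loadSamples N d) := by
  refine measurable_pi_lambda _ fun r => ?_
  unfold loadSamples
  split_ifs <;> fun_prop

theorem measurable_probOne (P : RealProgram) : Measurable P.probOne :=
  Kernel.measurable_coe _ (measurableSet_lt measurable_const (measurable_pi_apply 0))

theorem measurable_probZero (P : RealProgram) : Measurable P.probZero :=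
  Kernel.measurable_coe _ (measurableSet_lt measurable_const (measurable_pi_apply 0)).compl

theorem probZero_le_one (P : RealProgram) (s : ℕ → ℝ) : P.probZero s ≤ 1 := prob_le_one

/-- A program which maps a graph to a sample that is affine in the edge indicators, and then runs
the given test. -/
theorem exists_reduction_program (φ : RealProgram) (n N d : ℕ)
    (X₀ : Fin N → EuclideanSpace ℝ (Fin d))
    (D : EdgeIndex n → Fin N → EuclideanSpace ℝ (Fin d)) :
    ∃ P : RealProgram, P.length ≤ (3 * (n * n) + 4) * (N * d + 1) + φ.length ∧
      ∀ (G : SimpleGraph (Fin n)) (u : EdgeIndex n → Bool),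
        (∀ p, G.Adj p.1.1 p.1.2 ↔ u p = true) →
        RealProgram.run P (loadGraph n G) =
          RealProgram.run φ (loadSamples N d fun a => X₀ a + ∑ p, if u p then D p a else 0) := by
  classical
  -- Only entries above the diagonal of the adjacency matrix get a coefficient, so every edge is
  -- read once.
  let C : ℕ → ℕ → ℝ := fun r q =>
    if hq : q < n * n then
      if h : (finProdFinEquiv.symm ⟨q, hq⟩ : Fin n × Fin n).1 <
          (finProdFinEquiv.symm ⟨q, hq⟩ : Fin n × Fin n).2 then
        loadSamples N d (D ⟨finProdFinEquiv.symm ⟨q, hq⟩, h⟩) r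
      else 0
    else 0
  obtain ⟨P, hP, h⟩ := exists_affine_program (loadSamples N d X₀) C (n * n) (N * d)
  refine ⟨P ++ φ, by rw [List.length_append]; omega, fun G u hu => ?_⟩
  rw [h (loadGraph n G) (fun r hr => by simp [loadGraph, not_lt.2 hr]) φ]
  congr 1
  funext r
  split_ifs with hr
  · have hsum : ∑ j ∈ Finset.range (n * n), C r j * loadGraph n G j =
        ∑ p : EdgeIndex n, if u p then loadSamples N d (D p) r else 0 := by
      rw [Finset.sum_range]
      rw [← finProdFinEquiv.sum_comp]
      have hterm : ∀ p : Fin n × Fin n,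
          C r (finProdFinEquiv p) * loadGraph n G (finProdFinEquiv p) =
          if h : p.1 < p.2 then (if u ⟨p, h⟩ then loadSamples N d (D ⟨p, h⟩) r else 0) else 0 := by
        intro p
        have hlt : (finProdFinEquiv p : ℕ) < n * n := (finProdFinEquiv p).2
        have hC : C r (finProdFinEquiv p) = if h : p.1 < p.2 then
            loadSamples N d (D ⟨p, h⟩) r else 0 := by
          simp only [C, hlt, dif_pos, Fin.eta, Equiv.symm_apply_apply]
        have hG : loadGraph n G (finProdFinEquiv p) = if G.Adj p.1 p.2 then 1 else 0 := by
          simp only [loadGraph, hlt, dif_pos, Fin.eta, Equiv.symm_apply_apply]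
        rw [hC, hG]
        by_cases hp : p.1 < p.2
        · have := hu ⟨p, hp⟩
          simp only at this
          simp [hp, this]
        · simp [hp]
      simp_rw [hterm]
      rw [← Finset.sum_filter_add_sum_filter_not Finset.univ (fun p : Fin n × Fin n => p.1 < p.2),
        Finset.sum_eq_zero (s := Finset.filter (fun p => ¬ _) _) fun p hp => by
          simp [(Finset.mem_filter.1 hp).2], add_zero,
        Finset.sum_subtype _ (p := fun p : Fin n × Fin n => p.1 < p.2) (by simp)]
      exact Finset.sum_congr rfl fun p _ => by simp [p.2]
    rw [hsum]
    simp only [loadSamples, hr, dif_pos, PiLp.add_apply, WithLp.ofLp_sum, Finset.sum_apply]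
    congr 1
    exact Finset.sum_congr rfl fun p _ => by split_ifs <;> simp
  · simp [loadSamples, hr]

/-! ### The planted samples averaged over the Gaussian matrix -/

theorem lintegral_pi_map_prod {ι X Y W : Type*} [Fintype ι] [MeasurableSpace X]
    [MeasurableSpace Y] [MeasurableSpace W] (μ : Measure X) (ν : Measure Y)
    [IsProbabilityMeasure μ] [IsProbabilityMeasure ν] {ψ : X × Y → W} (hψ : Measurable ψ)
    {g : (ι → W) → ℝ≥0∞} (hg : Measurable g) :
    ∫⁻ y, ∫⁻ x, g (fun a => ψ (x a, y a)) ∂(Measure.pi fun _ => μ) ∂(Measure.pi fun _ => ν) =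
      ∫⁻ w, g w ∂(Measure.pi fun _ => (μ.prod ν).map ψ) := by
  have : IsProbabilityMeasure ((μ.prod ν).map ψ) := Measure.isProbabilityMeasure_map hψ.aemeasurable
  have hm : Measurable fun (q : (ι → X) × (ι → Y)) (a : ι) => ψ (q.1 a, q.2 a) := by
    refine measurable_pi_lambda _ fun a => hψ.comp ?_
    fun_prop
  rw [← Measure.pi_map_pi (μ := fun _ : ι => μ.prod ν) (f := fun _ => ψ)
    (fun _ => hψ.aemeasurable), lintegral_map hg (by fun_prop)]
  have h1 :=
    (measurePreserving_arrowProdEquivProdArrow X Y ι (fun _ => μ) (fun _ => ν)).lintegral_comp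
    (hg.comp hm)
  have h2 : ∀ z : ι → X × Y, (g ∘ fun (q : (ι → X) × (ι → Y)) (a : ι) => ψ (q.1 a, q.2 a))
      (MeasurableEquiv.arrowProdEquivProdArrow X Y ι z) = g fun a => ψ (z a) := fun z => rfl
  simp_rw [h2] at h1
  rw [h1, lintegral_prod_symm _ (hg.comp hm).aemeasurable]
  rfl

/-- Both laws are images of `ρ` and independent Gaussian coordinates under the same map. After
integration over `ρ`, the test is a bounded function of the `n * N` coordinates alone, whose
variances `1 + σ2` and `1` are compared by chi-square. -/
theorem lintegral_planted_le {n N d : ℕ} {b : Fin n → EuclideanSpace ℝ (Fin d)}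
    (hb : Orthonormal ℝ b) (S : Finset (Fin n)) (hS : 2 < S.card) (v : ℝ≥0) (c : ℝ) {σ2 θ : ℝ}
    (hσ : (v : ℝ) * c ^ 2 = σ2) (hσ1 : σ2 < 1) (hθ : θ = σ2 * (S.card * (S.card - 2)))
    {g : (Fin N → EuclideanSpace ℝ (Fin d)) → ℝ≥0∞} (hg : Measurable g) (hg1 : ∀ X, g X ≤ 1) :
    ∫⁻ A, ∫⁻ Z, g (fun a => Z a + ∑ i, A a i • if i ∈ S then c • ∑ j ∈ S.erase i, b j else 0)
        ∂(Measure.pi fun _ => stdGaussian (EuclideanSpace ℝ (Fin d)))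
        ∂(Measure.pi fun _ : Fin N => Measure.pi fun _ : Fin n => gaussianReal 0 v) ≤
      ∫⁻ X, g X ∂spikedSamples N d θ ((√S.card)⁻¹ • ∑ j ∈ S, b j) +
        ((ENNReal.ofReal (√(1 - σ2 ^ 2))⁻¹ ^ n) ^ N - 1) ^ (1 / 2 : ℝ) := by
  obtain ⟨ρ, hρ, h1, h2⟩ := exists_spiked_row_decomposition hb S hS v c hσ hθ
  have hσ0 : 0 ≤ σ2 := by rw [← hσ]; positivity
  have e1 := lintegral_pi_map_prod (ι := Fin N) (stdGaussian (EuclideanSpace ℝ (Fin d)))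
    (Measure.pi fun _ : Fin n => gaussianReal 0 v)
    (ψ := fun q => q.1 + ∑ i, q.2 i • if i ∈ S then c • ∑ j ∈ S.erase i, b j else 0)
    (by fun_prop) hg
  simp only at e1
  rw [e1, h1, spikedSamples, h2]
  rw [← lintegral_pi_map_prod (ι := Fin N) ρ _
    (ψ := fun q : EuclideanSpace ℝ (Fin d) × (Fin n → ℝ) =>
      q.1 + ∑ j, q.2 j • if j ∈ S then b j else 0) (by fun_prop) hg,
    ← lintegral_pi_map_prod (ι := Fin N) ρ _
    (ψ := fun q : EuclideanSpace ℝ (Fin d) × (Fin n → ℝ) =>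
      q.1 + ∑ j, q.2 j • if j ∈ S then b j else 0) (by fun_prop) hg]
  have h3 := ((hasSquareDensity_gaussianReal hσ0 hσ1).pi (ι := Fin n)).pi (ι := Fin N)
  rw [Fintype.card_fin, Fintype.card_fin] at h3
  refine h3.lintegral_le (Measurable.lintegral_prod_left' (f := fun q :
    (Fin N → EuclideanSpace ℝ (Fin d)) × (Fin N → Fin n → ℝ) =>
      g fun a => q.1 a + ∑ j, q.2 a j • if j ∈ S then b j else 0) (hg.comp (by fun_prop)))
    fun y => ?_
  calc _ ≤ ∫⁻ _, 1 ∂(Measure.pi fun _ => ρ) := lintegral_mono fun x => hg1 _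
    _ = 1 := by simp

/-! ### Completing the noise -/

theorem sum_edgeIndex_add_swap {n : ℕ} {M : Type*} [AddCommMonoid M] (F : Fin n × Fin n → M) :
    ∑ p : EdgeIndex n, (F p.1 + F p.1.swap) = ∑ p with p.1 ≠ p.2, F p := by
  have h1 : ∀ G : Fin n × Fin n → M, ∑ p : EdgeIndex n, G p.1 =
      ∑ p with p.1 < p.2, G p := fun G => (Finset.sum_subtype _ (by simp) G).symm
  rw [Finset.sum_add_distrib, h1 F, h1 fun p => F p.swap]
  have h2 : ∑ p : Fin n × Fin n with p.1 < p.2, F p.swap = ∑ p with p.2 < p.1, F p :=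
    Finset.sum_nbij' Prod.swap Prod.swap (by simp) (by simp) (by simp) (by simp) (by simp)
  rw [h2, ← Finset.sum_union]
  · congr 1
    ext p
    simp [lt_or_lt_iff_ne]
  · exact Finset.disjoint_filter.2 fun p _ h => h.not_gt

-- All `N` samples are treated as one vector in `ℝ^(N × d)`, since an edge variable is shared by all
-- rows. The covariance contributed by the edges is at most the identity: the contraction property
-- handles the sample index and Bessel's inequality the dimension.
open scoped RealInnerProductSpace in
theorem exists_noise {n N d : ℕ} {b : Fin n → EuclideanSpace ℝ (Fin d)} (hb : Orthonormal ℝ b)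
    (A : Fin N → Fin n → ℝ) (hA : ∀ x : Fin N → ℝ, ∑ i, (∑ a, A a i * x a) ^ 2 ≤ ∑ a, x a ^ 2) :
    ∃ ρ : Measure (Fin N → EuclideanSpace ℝ (Fin d)), IsProbabilityMeasure ρ ∧
      (ρ.prod (Measure.pi fun _ : EdgeIndex n => gaussianReal 0 1)).map
        (fun q a => q.1 a + ∑ p, q.2 p •
          ((√2)⁻¹ • (A a p.1.1 • b p.1.2 + A a p.1.2 • b p.1.1))) =
        Measure.pi fun _ => stdGaussian (EuclideanSpace ℝ (Fin d)) := by
  let τ : EdgeIndex n → Fin N → EuclideanSpace ℝ (Fin d) := fun p a =>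
    (√2)⁻¹ • (A a p.1.1 • b p.1.2 + A a p.1.2 • b p.1.1)
  let t : EdgeIndex n → EuclideanSpace ℝ (Fin N × Fin d) := fun p =>
    WithLp.toLp 2 fun ac => τ p ac.1 ac.2
  let Ψ : EuclideanSpace ℝ (Fin N × Fin d) → Fin N → EuclideanSpace ℝ (Fin d) := fun ξ a =>
    WithLp.toLp 2 fun c => ξ (a, c)
  have hΨm : Measurable Ψ := by fun_prop
  have hinner : ∀ p ξ, ⟪t p, ξ⟫ = ∑ a, ⟪τ p a, Ψ ξ a⟫ := by
    intro p ξ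
    simp [PiLp.inner_apply, Fintype.sum_prod_type, t, Ψ]
  have hnorm : ∀ ξ, ‖ξ‖ ^ 2 = ∑ a, ‖Ψ ξ a‖ ^ 2 := by
    intro ξ
    simp_rw [EuclideanSpace.real_norm_sq_eq]
    rw [Fintype.sum_prod_type]
  have hcontr : ∀ ξ, ∑ p, ⟪t p, ξ⟫ ^ 2 ≤ ‖ξ‖ ^ 2 := by
    intro ξ
    let q : Fin n × Fin n → ℝ := fun ij => ∑ a, A a ij.1 * ⟪b ij.2, Ψ ξ a⟫
    -- The factor `1/√2` in `τ` pays for using one Gaussian for both orientations of a pair: `(x +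
    -- y)² / 2 ≤ x² + y²`.
    have h1 : ∀ p, ⟪t p, ξ⟫ ^ 2 ≤ q p.1 ^ 2 + q p.1.swap ^ 2 := by
      intro p
      have : ⟪t p, ξ⟫ = (√2)⁻¹ * (q p.1 + q p.1.swap) := by
        rw [hinner]
        simp only [τ, q, real_inner_smul_left, inner_add_left, Prod.fst_swap, Prod.snd_swap]
        rw [← Finset.sum_add_distrib, Finset.mul_sum]
      rw [this, mul_pow, inv_pow, Real.sq_sqrt (by norm_num)]
      nlinarith [sq_nonneg (q p.1 - q p.1.swap)]
    calc ∑ p, ⟪t p, ξ⟫ ^ 2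
        ≤ ∑ p : EdgeIndex n, (q p.1 ^ 2 + q p.1.swap ^ 2) :=
          Finset.sum_le_sum fun p _ => h1 p
      _ ≤ ∑ ij, q ij ^ 2 := (sum_edgeIndex_add_swap fun ij => q ij ^ 2).trans_le
            (Finset.sum_le_sum_of_subset_of_nonneg (Finset.subset_univ _)
              fun _ _ _ => sq_nonneg _)
      _ = ∑ j, ∑ i, (∑ a, A a i * ⟪b j, Ψ ξ a⟫) ^ 2 := by
          rw [Fintype.sum_prod_type, Finset.sum_comm]
      _ ≤ ∑ j, ∑ a, ⟪b j, Ψ ξ a⟫ ^ 2 := Finset.sum_le_sum fun j _ => hA _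
      _ = ∑ a, ∑ j, ⟪b j, Ψ ξ a⟫ ^ 2 := Finset.sum_comm
      _ ≤ ∑ a, ‖Ψ ξ a‖ ^ 2 :=
          Finset.sum_le_sum fun a _ => sum_inner_sq_le_of_orthonormal hb Finset.univ _
      _ = ‖ξ‖ ^ 2 := (hnorm ξ).symm
  obtain ⟨ρ, hρ, hmap⟩ := exists_gaussian_completion t hcontr
  have hstd : (stdGaussian (EuclideanSpace ℝ (Fin N × Fin d))).map Ψ =
      Measure.pi fun _ => stdGaussian (EuclideanSpace ℝ (Fin d)) := by
    rw [← map_pi_eq_stdGaussian, ← map_pi_eq_stdGaussian, Measure.map_map hΨm (by fun_prop),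
      ← Measure.pi_map_pi (f := fun _ => WithLp.toLp 2) (fun _ => by fun_prop),
      pi_pi_eq_map_curry fun _ _ => gaussianReal 0 1, Measure.map_map (by fun_prop) (by fun_prop)]
    rfl
  refine ⟨ρ.map Ψ, Measure.isProbabilityMeasure_map hΨm.aemeasurable, ?_⟩
  rw [← hstd, ← hmap, Measure.map_map hΨm (by fun_prop)]
  have hprod : (ρ.map Ψ).prod (Measure.pi fun _ : EdgeIndex n =>
      gaussianReal 0 1) = (ρ.prod (Measure.pi fun _ => gaussianReal 0 1)).map (Prod.map Ψ id) := by
    rw [← Measure.map_prod_map _ _ hΨm measurable_id, Measure.map_id]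
  rw [hprod, Measure.map_map (by fun_prop) (by fun_prop)]
  congr 1
  funext q a
  ext c
  simp [Ψ, t, τ, mul_add]

/-! ### The reduction with fixed coefficients -/

theorem graphOfEdges_sup_clique_adj {n : ℕ} (u : EdgeIndex n → Bool)
    (S : Set (Fin n)) (p : EdgeIndex n) :
    (graphOfEdges u ⊔ SimpleGraph.fromEdgeSet {e | ∀ v ∈ e, v ∈ S}).Adj p.1.1 p.1.2 ↔
      (u p = true ∨ p.1.1 ∈ S ∧ p.1.2 ∈ S) := by
  rw [SimpleGraph.sup_adj, graphOfEdges_adj, SimpleGraph.fromEdgeSet_adj]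
  simp [p.2.ne]

/-- The product of the dominating measures also dominates `Measure.pi ν`, and its excess mass is `(1
+ δ) ^ card ι - 1`. No hybrid argument over the coordinates is needed. -/
theorem pi_le_pi_add_smul {ι X : Type*} [Fintype ι] [MeasurableSpace X] (μ ν : ι → Measure X)
    (γ : Measure X) [∀ i, IsProbabilityMeasure (μ i)] [∀ i, IsProbabilityMeasure (ν i)]
    [IsProbabilityMeasure γ] {δ : ℝ≥0∞} (hδ : δ ≠ ∞) (h : ∀ i, μ i ≤ ν i + δ • γ)
    {f : (ι → X) → ℝ≥0∞} (hf : ∀ x, f x ≤ 1) :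
    ∫⁻ x, f x ∂(Measure.pi μ) ≤
      ∫⁻ x, f x ∂(Measure.pi ν) + ((1 + δ) ^ Fintype.card ι - 1) := by
  have hfin : ∀ i, IsFiniteMeasure (ν i + δ • γ) := fun i => ⟨by simp [hδ.lt_top]⟩
  calc ∫⁻ x, f x ∂(Measure.pi μ) ≤ ∫⁻ x, f x ∂(Measure.pi fun i => ν i + δ • γ) :=
        lintegral_mono' (Measure.pi_mono_of_le h) le_rfl
    _ ≤ ∫⁻ x, f x ∂(Measure.pi ν) + ((Measure.pi fun i => ν i + δ • γ) Set.univ -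
          Measure.pi ν Set.univ) :=
        lintegral_le_add_of_measure_le
          (Measure.pi_mono_of_le fun i => Measure.le_add_right le_rfl) hf
    _ = _ := by simp [Measure.pi_univ]

/-- The seed holds two candidate values for each edge, and the edge bit selects one. Averaging over
a fair bit produces `N(0,1)`; a planted edge always selects the `Q₁` candidate. -/
theorem sum_lintegral_select_eq {ι : Type*} [Fintype ι] [DecidableEq ι] (Q₀ Q₁ : Measure ℝ)
    [IsProbabilityMeasure Q₀] [IsProbabilityMeasure Q₁]
    (hQ : Q₀ + Q₁ = (2 : ℝ≥0∞) • gaussianReal 0 1) (T : Set ι) [DecidablePred (· ∈ T)]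
    {h : (ι → ℝ) → ℝ≥0∞} (hh : Measurable h) :
    ((2 : ℝ≥0∞) ^ Fintype.card ι)⁻¹ * ∑ u : ι → Bool,
      ∫⁻ y : ι → ℝ × ℝ, h (fun p => if u p || decide (p ∈ T) then (y p).2 else (y p).1)
        ∂(Measure.pi fun _ => Q₀.prod Q₁) =
      ∫⁻ y, h y ∂(Measure.pi fun p => if p ∈ T then Q₁ else gaussianReal 0 1) := by
  have hp0 : ∀ p, IsProbabilityMeasure (if p ∈ T then Q₁ else Q₀) := by
    intro p; split_ifs <;> infer_instance
  have hp : ∀ p, IsProbabilityMeasure (if p ∈ T then Q₁ else gaussianReal 0 1) := by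
    intro p; split_ifs <;> infer_instance
  rw [pi_average (fun p => if p ∈ T then Q₁ else Q₀) (fun _ => Q₁)
    (fun p => if p ∈ T then Q₁ else gaussianReal 0 1) (by
      intro p
      by_cases hpT : p ∈ T
      · simp only [hpT, if_true]; rw [two_smul]
      · simp only [hpT, if_false]; exact hQ),
    lintegral_smul_measure, smul_eq_mul, lintegral_finsetSum_measure]
  congr 1
  refine Finset.sum_congr rfl fun u _ => ?_
  have hm : ∀ p, Measurable fun z : ℝ × ℝ => if u p || decide (p ∈ T) then z.2 else z.1 := by
    intro p; split_ifs <;> fun_prop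
  have hpm : ∀ p, IsProbabilityMeasure ((Q₀.prod Q₁).map
      fun z : ℝ × ℝ => if u p || decide (p ∈ T) then z.2 else z.1) := fun p =>
    Measure.isProbabilityMeasure_map (hm p).aemeasurable
  have hmap : (Measure.pi fun p => if u p then Q₁ else if p ∈ T then Q₁ else Q₀) =
      (Measure.pi fun _ : ι => Q₀.prod Q₁).map
        fun y p => if u p || decide (p ∈ T) then (y p).2 else (y p).1 := by
    rw [Measure.pi_map_pi (μ := fun _ : ι => Q₀.prod Q₁)
      (f := fun p z => if u p || decide (p ∈ T) then z.2 else z.1) fun p => (hm p).aemeasurable]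
    congr 1
    funext p
    by_cases h1 : u p <;> by_cases h2 : p ∈ T <;> simp [h1, h2]
  have hm' : Measurable fun (y : ι → ℝ × ℝ) p =>
      if u p || decide (p ∈ T) then (y p).2 else (y p).1 :=
    measurable_pi_lambda _ fun p => (hm p).comp (measurable_pi_apply p)
  rw [hmap, lintegral_map hh hm']

/-- Once `Q₁` is replaced by `N(ν,1)`, planting is a deterministic shift of a standard Gaussian
vector, so the noise completion of the null case applies to the planted case too. -/
theorem lintegral_pi_ite_le_shift {ι : Type*} [Fintype ι] {ν : ℝ} {δ : ℝ≥0∞} (hδ : δ ≠ ∞)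
    (Q₁ : Measure ℝ) [IsProbabilityMeasure Q₁]
    (hQ₁ : Q₁ ≤ gaussianReal ν 1 + δ • gaussianReal 0 1) (T : Set ι) [H : DecidablePred (· ∈ T)]
    {h : (ι → ℝ) → ℝ≥0∞} (hh : Measurable h) (h1 : ∀ y, h y ≤ 1) :
    ∫⁻ y, h y ∂(Measure.pi fun p => if p ∈ T then Q₁ else gaussianReal 0 1) ≤
      ∫⁻ y, h (fun p => y p + if p ∈ T then ν else 0) ∂(Measure.pi fun _ => gaussianReal 0 1) +
        ((1 + δ) ^ Fintype.card ι - 1) := by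
  have hp1 : ∀ p, IsProbabilityMeasure (if p ∈ T then Q₁ else gaussianReal 0 1) := by
    intro p; split_ifs <;> infer_instance
  have hp2 : ∀ p, IsProbabilityMeasure (if p ∈ T then gaussianReal ν 1 else gaussianReal 0 1) := by
    intro p; split_ifs <;> infer_instance
  have hp3 : ∀ p, IsProbabilityMeasure
      ((gaussianReal 0 1).map (fun x => x + if p ∈ T then ν else 0)) := fun p =>
    Measure.isProbabilityMeasure_map (by fun_prop)
  have hshift : (Measure.pi fun p => if p ∈ T then gaussianReal ν 1 else gaussianReal 0 1) =
      (Measure.pi fun _ : ι => gaussianReal 0 1).map fun y p => y p + if p ∈ T then ν else 0 := by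
    rw [Measure.pi_map_pi (μ := fun _ : ι => gaussianReal 0 1)
      (f := fun p x => x + if p ∈ T then ν else 0) fun p => by fun_prop]
    congr 1
    funext p
    rw [gaussianReal_map_add_const]
    split_ifs <;> simp
  rw [← lintegral_map (μ := Measure.pi fun _ : ι => gaussianReal 0 1)
    (g := fun y p => y p + if p ∈ T then ν else 0) hh (by fun_prop), ← hshift]
  refine pi_le_pi_add_smul _ _ (gaussianReal 0 1) hδ (fun p => ?_) h1
  split_ifs
  · exact hQ₁
  · exact Measure.le_add_right le_rfl

-- For each value of the seed, the bound `m` holds for an explicit program; integrating over the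
-- seed keeps the bound. The seed laws only have to exist, not to be samplable.
open Classical in
theorem reduction_bound (φ : RealProgram) {n N d k : ℕ} {ν : ℝ} {δ : ℝ≥0∞} (hδ : δ ≠ ∞)
    (Q₀ Q₁ : Measure ℝ) [IsProbabilityMeasure Q₀] [IsProbabilityMeasure Q₁]
    (hQ : Q₀ + Q₁ = (2 : ℝ≥0∞) • gaussianReal 0 1)
    (hQ₁ : Q₁ ≤ gaussianReal ν 1 + δ • gaussianReal 0 1)
    (τ : EdgeIndex n → Fin N → EuclideanSpace ℝ (Fin d))
    (ρ : Measure (Fin N → EuclideanSpace ℝ (Fin d))) [IsProbabilityMeasure ρ]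
    (hρ : (ρ.prod (Measure.pi fun _ : EdgeIndex n => gaussianReal 0 1)).map
        (fun q a => q.1 a + ∑ p, q.2 p • τ p a) =
        Measure.pi fun _ => stdGaussian (EuclideanSpace ℝ (Fin d)))
    {m : ℝ≥0∞}
    (hm : ∀ P : RealProgram, P.length ≤ (3 * (n * n) + 4) * (N * d + 1) + φ.length →
      m ≤ typeError P (loadGraph n)
        (SimpleGraph.binomialRandom (Fin n) ⟨1 / 2, by norm_num, by norm_num⟩)
        (plantedClique n k ⟨1 / 2, by norm_num, by norm_num⟩)) :
    m ≤ ∫⁻ X, φ.probOne (loadSamples N d X)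
          ∂(Measure.pi fun _ => stdGaussian (EuclideanSpace ℝ (Fin d))) +
      ∫⁻ S, (∫⁻ Z, φ.probZero (loadSamples N d fun a =>
            Z a + ν • ∑ p : EdgeIndex n,
              if p.1.1 ∈ S ∧ p.1.2 ∈ S then τ p a else 0)
          ∂(Measure.pi fun _ => stdGaussian (EuclideanSpace ℝ (Fin d))) +
            ((1 + δ) ^ Fintype.card (EdgeIndex n) - 1))
        ∂uniformOn {S : Set (Fin n) | S.ncard = k} := by
  let f : (Fin N → EuclideanSpace ℝ (Fin d)) → ℝ≥0∞ := fun X => φ.probOne (loadSamples N d X)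
  let g : (Fin N → EuclideanSpace ℝ (Fin d)) → ℝ≥0∞ := fun X => φ.probZero (loadSamples N d X)
  have hf : Measurable f := (measurable_probOne φ).comp (measurable_loadSamples N d)
  have hg : Measurable g := (measurable_probZero φ).comp (measurable_loadSamples N d)
  let Y : (Fin N → EuclideanSpace ℝ (Fin d)) × ((EdgeIndex n) → ℝ × ℝ) → ((EdgeIndex n) → Bool) →
      Fin N → EuclideanSpace ℝ (Fin d) := fun ω u a =>
    ω.1 a + ∑ p, (if u p then (ω.2 p).2 else (ω.2 p).1) • τ p a
  have hY : ∀ u, Measurable fun ω => Y ω u := by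
    intro u
    refine measurable_pi_lambda _ fun a => Measurable.add (by fun_prop) ?_
    refine Finset.measurable_sum _ fun p _ => Measurable.smul_const ?_ _
    split_ifs <;> fun_prop
  let T : Set (Fin n) → Set (EdgeIndex n) := fun S => {p | p.1.1 ∈ S ∧ p.1.2 ∈ S}
  let D : Set (EdgeIndex n) → (EdgeIndex n → Bool) → EdgeIndex n → Bool :=
    fun T u p => u p || decide (p ∈ T)
  let c : ℝ≥0∞ := ((2 : ℝ≥0∞) ^ Fintype.card (EdgeIndex n))⁻¹
  let π : Measure ((Fin N → EuclideanSpace ℝ (Fin d)) × ((EdgeIndex n) → ℝ × ℝ)) :=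
    ρ.prod (Measure.pi fun _ => Q₀.prod Q₁)
  -- the bound for every choice of the seeds
  have hseed : ∀ ω, m ≤ c * ∑ u : EdgeIndex n → Bool, f (Y ω (D ∅ u)) +
      ∫⁻ S, c * ∑ u : EdgeIndex n → Bool, g (Y ω (D (T S) u))
        ∂uniformOn {S : Set (Fin n) | S.ncard = k} := by
    intro ω
    -- The selected value is the first candidate plus the bit times the difference of the two, hence
    -- affine in the bit.
    obtain ⟨P, hP, hrun⟩ := exists_reduction_program φ n N d
      (fun a => ω.1 a + ∑ p, (ω.2 p).1 • τ p a) (fun p a => ((ω.2 p).2 - (ω.2 p).1) • τ p a)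
    have hX : ∀ u : (EdgeIndex n) → Bool, (fun a => ω.1 a + ∑ p, (ω.2 p).1 • τ p a +
        (∑ p, if u p then (fun a => ((ω.2 p).2 - (ω.2 p).1) • τ p a) a else 0)) = Y ω u := by
      intro u
      funext a
      simp only [Y]
      rw [add_assoc, ← Finset.sum_add_distrib]
      congr 1
      refine Finset.sum_congr rfl fun p _ => ?_
      split_ifs
      · rw [sub_smul]; abel
      · rw [add_zero]
    have h1 := hm P hP
    rw [typeError, lintegral_binomialRandom_half, lintegral_plantedClique] at h1
    simp_rw [lintegral_binomialRandom_half] at h1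
    refine h1.trans_eq ?_
    congr 1
    · congr 1
      refine Finset.sum_congr rfl fun u _ => ?_
      rw [RealProgram.probOne, hrun (graphOfEdges u) (D ∅ u)
        fun p => by simp [D, graphOfEdges_adj u p], hX]
      rfl
    · refine lintegral_congr fun S => ?_
      congr 1
      refine Finset.sum_congr rfl fun u _ => ?_
      rw [RealProgram.probZero, hrun _ (D (T S) u)
        fun p => by rw [graphOfEdges_sup_clique_adj]; simp [D, T], hX]
      rfl
  have hint : ∀ (T : Set (EdgeIndex n))
      (h : (Fin N → EuclideanSpace ℝ (Fin d)) → ℝ≥0∞), Measurable h →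
      ∫⁻ ω, c * ∑ u : EdgeIndex n → Bool, h (Y ω (D T u)) ∂π =
        ∫⁻ W, ∫⁻ y, h (fun a => W a + ∑ p, y p • τ p a)
          ∂(Measure.pi fun p => if p ∈ T then Q₁ else gaussianReal 0 1) ∂ρ := by
    intro T h hh
    have hmeas : ∀ u : (EdgeIndex n) → Bool, Measurable fun ω => h (Y ω (D T u)) :=
      fun u => hh.comp (hY _)
    rw [lintegral_prod _ (by fun_prop)]
    refine lintegral_congr fun W => ?_
    have hmeas' : ∀ u : EdgeIndex n → Bool, Measurable fun y =>
        h (Y (W, y) (D T u)) := fun u => (hmeas u).comp measurable_prodMk_left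
    rw [lintegral_const_mul _ (by fun_prop), lintegral_finsetSum _ fun u _ => hmeas' u]
    exact sum_lintegral_select_eq Q₀ Q₁ hQ T (h := fun y => h fun a => W a + ∑ p, y p • τ p a)
      (hh.comp (by fun_prop))
  have hstd : ∀ h : (Fin N → EuclideanSpace ℝ (Fin d)) → ℝ≥0∞, Measurable h →
      ∫⁻ W, ∫⁻ y, h (fun a => W a + ∑ p, y p • τ p a)
          ∂(Measure.pi fun _ : (EdgeIndex n) => gaussianReal 0 1) ∂ρ =
        ∫⁻ Z, h Z ∂(Measure.pi fun _ => stdGaussian (EuclideanSpace ℝ (Fin d))) := by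
    intro h hh
    rw [← hρ, lintegral_map hh (by fun_prop), lintegral_prod _ (by fun_prop)]
  have hmeasS : ∀ S, Measurable fun ω => c * ∑ u : EdgeIndex n → Bool, g (Y ω (D (T S) u)) :=
    fun S => (Finset.measurable_sum _ fun u _ => hg.comp (hY _)).const_mul _
  calc m = ∫⁻ _, m ∂π := by simp [π]
    _ ≤ ∫⁻ ω, (c * ∑ u : EdgeIndex n → Bool, f (Y ω (D ∅ u)) +
          ∫⁻ S, c * ∑ u : EdgeIndex n → Bool, g (Y ω (D (T S) u))
            ∂uniformOn {S : Set (Fin n) | S.ncard = k}) ∂π := lintegral_mono hseed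
    _ = ∫⁻ ω, c * ∑ u : EdgeIndex n → Bool, f (Y ω (D ∅ u)) ∂π +
          ∫⁻ S, ∫⁻ ω, c * ∑ u : EdgeIndex n → Bool, g (Y ω (D (T S) u)) ∂π
            ∂uniformOn {S : Set (Fin n) | S.ncard = k} := by
        have hmeasf : ∀ u : EdgeIndex n → Bool, Measurable fun ω =>
            f (Y ω (D ∅ u)) := fun u => hf.comp (hY _)
        rw [lintegral_add_left (by fun_prop), lintegral_lintegral_swap]
        exact (measurable_from_prod_countable_left hmeasS).aemeasurable
    _ ≤ _ := by
        refine add_le_add (le_of_eq ?_) (lintegral_mono fun S => ?_)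
        · rw [hint ∅ f hf]
          simp only [Set.mem_empty_iff_false, if_false]
          exact hstd f hf
        · simp only
          rw [hint (T S) g hg]
          have hgτ : ∀ W : Fin N → EuclideanSpace ℝ (Fin d),
              Measurable fun y : EdgeIndex n → ℝ => g fun a => W a + ∑ p, y p • τ p a :=
            fun W => hg.comp (by fun_prop)
          have hgS : Measurable fun Z : Fin N → EuclideanSpace ℝ (Fin d) => g fun a =>
              Z a + ν • ∑ p : EdgeIndex n, if p.1.1 ∈ S ∧ p.1.2 ∈ S then τ p a else 0 :=
            hg.comp (by fun_prop)
          refine (lintegral_mono fun W => lintegral_pi_ite_le_shift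
            (H := fun p => Classical.propDecidable (p ∈ T S)) hδ Q₁ hQ₁ (T S) (hgτ W)
            fun y => probZero_le_one _ _).trans_eq ?_
          rw [lintegral_add_right _ measurable_const, ← hstd _ hgS]
          congr 1
          · refine lintegral_congr fun W => lintegral_congr fun y => ?_
            congr 1
            funext a
            simp only [add_smul, Finset.sum_add_distrib, add_assoc, Finset.smul_sum]
            congr 2
            refine Finset.sum_congr rfl fun p _ => ?_
            by_cases hp : p.1.1 ∈ S ∧ p.1.2 ∈ S <;> simp [T, hp]
          · simp

/-! ### The reduction with random coefficients -/

-- Grouping the pairs by endpoint shows that the shift caused by a clique is linear in the row `x`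
-- of `A`, so it becomes Gaussian when `A` is averaged.
open Classical in
theorem sum_edgeIndex_clique_smul {n : ℕ} {E : Type*} [AddCommGroup E] [Module ℝ E]
    (b : Fin n → E) (S : Finset (Fin n)) (ν : ℝ) (x : Fin n → ℝ) :
    ν • ∑ p : EdgeIndex n, (if p.1.1 ∈ S ∧ p.1.2 ∈ S then
        (√2)⁻¹ • (x p.1.1 • b p.1.2 + x p.1.2 • b p.1.1) else 0) =
      ∑ i, x i • if i ∈ S then (ν / √2) • ∑ j ∈ S.erase i, b j else 0 := by
  let F : Fin n × Fin n → E := fun p =>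
    if p.1 ∈ S ∧ p.2 ∈ S then (ν / √2) • x p.1 • b p.2 else 0
  have h1 : ν • ∑ p : EdgeIndex n, (if p.1.1 ∈ S ∧ p.1.2 ∈ S then
        (√2)⁻¹ • (x p.1.1 • b p.1.2 + x p.1.2 • b p.1.1) else 0) =
      ∑ p : EdgeIndex n, (F p.1 + F p.1.swap) := by
    rw [Finset.smul_sum]
    refine Finset.sum_congr rfl fun p _ => ?_
    simp only [F, Prod.fst_swap, Prod.snd_swap, and_comm (a := p.1.2 ∈ S)]
    split_ifs
    · rw [smul_smul, smul_add, div_eq_mul_inv]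
    · simp
  rw [h1, sum_edgeIndex_add_swap, Finset.sum_filter, Fintype.sum_prod_type]
  refine Finset.sum_congr rfl fun i _ => ?_
  by_cases hi : i ∈ S
  · rw [if_pos hi, Finset.smul_sum, Finset.smul_sum, ← Finset.sum_filter_add_sum_filter_not
      Finset.univ (· ∈ S.erase i)]
    rw [Finset.filter_univ_mem, Finset.sum_eq_zero (s := Finset.univ.filter _), add_zero]
    · refine Finset.sum_congr rfl fun j hj => ?_
      rw [Finset.mem_erase] at hj
      simp [F, hi, hj.2, hj.1.symm, smul_comm (x i)]
    · intro j hj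
      simp only [Finset.mem_filter, Finset.mem_univ, true_and, Finset.mem_erase, not_and] at hj
      simp only [F, hi, true_and]
      split_ifs with h1 h2
      · exact absurd h2 (hj (Ne.symm h1))
      · rfl
      · rfl
  · simp [F, hi]

/-- `uniformOn ∅` is the zero measure, which occurs for clique sizes above `n`. The inequality
avoids treating that case separately. -/
theorem uniformOn_univ_le_one {X : Type*} [MeasurableSpace X] (V : Set X) :
    uniformOn V Set.univ ≤ 1 := by
  rcases eq_zero_or_isProbabilityMeasure (uniformOn V) with h | h
  · simp [h]
  · simp

-- The bound `m ≤ H A` holds for every contraction `A`. Markov's inequality turns it into a bound on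
-- `∫ H`, where `A` is again an unconditioned Gaussian matrix, so that the planted rows can be
-- averaged exactly.
open Classical in
theorem reduction_bound_of_orthonormal (φ : RealProgram) {n N d k : ℕ} {ν σ2 θ : ℝ} {v : ℝ≥0}
    {δ : ℝ≥0∞} {b : Fin n → EuclideanSpace ℝ (Fin d)} (hb : Orthonormal ℝ b) (hk : 2 < k)
    (hN : 0 < N) (hn : n ≤ N) (hv : 0 < v) (hNv : N * v ≤ 1 / 200) (hν : 0 < ν) (hδ : δ ≤ 1 / 2)
    (hexp : ENNReal.ofReal (Real.exp (ν + 1 / 2 - 1 / (3 * ν))) ≤ δ)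
    (hσ : v * (ν / √2) ^ 2 = σ2) (hσ1 : σ2 < 1) (hθ : θ = σ2 * (k * (k - 2)))
    {m : ℝ≥0∞}
    (hm : ∀ P : RealProgram, P.length ≤ (3 * (n * n) + 4) * (N * d + 1) + φ.length →
      m ≤ typeError P (loadGraph n)
        (SimpleGraph.binomialRandom (Fin n) ⟨1 / 2, by norm_num, by norm_num⟩)
        (plantedClique n k ⟨1 / 2, by norm_num, by norm_num⟩)) :
    m * (1 - ENNReal.ofReal ((1 / 2) ^ N)) ≤
      ∫⁻ X, φ.probOne (loadSamples N d X) ∂pcaNull N d +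
      ∫⁻ S, (∫⁻ X, φ.probZero (loadSamples N d X)
          ∂spikedSamples N d θ ((√k)⁻¹ • ∑ j, if j ∈ S then b j else 0))
        ∂uniformOn {S : Set (Fin n) | S.ncard = k} +
      (((1 + δ) ^ Fintype.card (EdgeIndex n) - 1) +
        ((ENNReal.ofReal (√(1 - σ2 ^ 2))⁻¹ ^ n) ^ N - 1) ^ (1 / 2 : ℝ)) := by
  let μ : Measure (Fin N → Fin n → ℝ) := Measure.pi fun _ => Measure.pi fun _ => gaussianReal 0 v
  let γ : Measure (Fin N → EuclideanSpace ℝ (Fin d)) := Measure.pi fun _ => stdGaussian _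
  let υ : Measure (Set (Fin n)) := uniformOn {S : Set (Fin n) | S.ncard = k}
  let g : (Fin N → EuclideanSpace ℝ (Fin d)) → ℝ≥0∞ := fun X => φ.probZero (loadSamples N d X)
  have hg : Measurable g := (measurable_probZero φ).comp (measurable_loadSamples N d)
  have hυ : υ Set.univ ≤ 1 := uniformOn_univ_le_one _
  have hδ' : δ ≠ ∞ := ne_top_of_le_ne_top (by simp) hδ
  obtain ⟨Q₀, Q₁, hQ0p, hQ1p, hQ, hQ₁⟩ := exists_gaussian_rejection_pair hν hδ hexp
  let Y : (Fin N → Fin n → ℝ) → Set (Fin n) → (Fin N → EuclideanSpace ℝ (Fin d)) →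
      Fin N → EuclideanSpace ℝ (Fin d) := fun A S Z a =>
    Z a + ∑ i, A a i • if i ∈ S.toFinset then
      (ν / √2) • ∑ j ∈ S.toFinset.erase i, b j else 0
  let p₀ : ℝ≥0∞ := ∫⁻ X, φ.probOne (loadSamples N d X) ∂pcaNull N d
  let ε : ℝ≥0∞ := (1 + δ) ^ Fintype.card (EdgeIndex n) - 1
  let η : ℝ≥0∞ := ((ENNReal.ofReal (√(1 - σ2 ^ 2))⁻¹ ^ n) ^ N - 1) ^ (1 / 2 : ℝ)
  let H : (Fin N → Fin n → ℝ) → ℝ≥0∞ := fun A => p₀ + ε + ∫⁻ S, ∫⁻ Z, g (Y A S Z) ∂γ ∂υ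
  have hYm : ∀ S, Measurable fun q : (Fin N → Fin n → ℝ) × (Fin N → EuclideanSpace ℝ (Fin d)) =>
      g (Y q.1 S q.2) := fun S => hg.comp (by fun_prop)
  have hIm : ∀ S, Measurable fun A => ∫⁻ Z, g (Y A S Z) ∂γ := fun S => (hYm S).lintegral_prod_right'
  have hIm2 : Measurable fun q : (Fin N → Fin n → ℝ) × Set (Fin n) => ∫⁻ Z, g (Y q.1 q.2 Z) ∂γ :=
    measurable_from_prod_countable_left hIm
  have hHm : Measurable H := (hIm2.lintegral_prod_right').const_add _
  have hgood : ∀ A, (∀ z ∈ integerBall N (7 * N), ∑ i, (∑ a, A a i * (z a : ℝ)) ^ 2 ≤ (2 * N : ℝ)) →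
      m ≤ H A := by
    intro A hA
    obtain ⟨ρ, hρ, hmap⟩ := exists_noise hb A (contraction_of_integerBall A hA)
    refine (reduction_bound φ hδ' Q₀ Q₁ hQ hQ₁ _ ρ hmap hm).trans ?_
    rw [lintegral_add_right _ measurable_const, lintegral_const, add_comm (∫⁻ _, _ ∂_) (_ * _),
      ← add_assoc]
    refine add_le_add (add_le_add (le_of_eq ?_) ?_) (lintegral_mono fun S =>
      lintegral_mono fun Z => le_of_eq ?_)
    · simp [p₀, pcaNull]
    · exact mul_le_of_le_one_right' hυ
    · simp only [g, Y]
      congr 2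
      funext a
      rw [← sum_edgeIndex_clique_smul]
      simp
  have hprob : 1 - ENNReal.ofReal ((1 / 2) ^ N) ≤ μ {A | m ≤ H A} := by
    rw [tsub_le_iff_right]
    calc (1 : ℝ≥0∞) = μ Set.univ := by simp [μ]
      _ ≤ μ ({A | m ≤ H A} ∪ {A | ¬ ∀ z ∈ integerBall N (7 * N),
            ∑ i, (∑ a, A a i * (z a : ℝ)) ^ 2 ≤ (2 * N : ℝ)}) :=
          measure_mono fun A _ => or_iff_not_imp_right.2 fun h => hgood A (not_not.1 h)
      _ ≤ _ := (measure_union_le _ _).trans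
          (add_le_add_right (gaussian_matrix_integerBall_bound hN hn hv hNv) _)
  calc m * (1 - ENNReal.ofReal ((1 / 2) ^ N)) ≤ m * μ {A | m ≤ H A} := mul_le_mul_right hprob _
    _ ≤ ∫⁻ A, H A ∂μ := mul_meas_ge_le_lintegral₀ hHm.aemeasurable _
    _ = p₀ + ε + ∫⁻ S, ∫⁻ A, ∫⁻ Z, g (Y A S Z) ∂γ ∂μ ∂υ := by
        rw [lintegral_add_left measurable_const, lintegral_lintegral_swap hIm2.aemeasurable]
        simp [μ]
    _ ≤ p₀ + ε + ∫⁻ S, (∫⁻ X, g X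
          ∂spikedSamples N d θ ((√k)⁻¹ • ∑ j, if j ∈ S then b j else 0) + η) ∂υ := by
        refine add_le_add_right (lintegral_mono_ae ?_) _
        have hae : ∀ᵐ S ∂υ, S ∈ {S : Set (Fin n) | S.ncard = k} :=
          ae_cond_mem (Set.toFinite _).measurableSet
        filter_upwards [hae] with S hS
        have hcard : S.toFinset.card = k := by rw [← Set.ncard_eq_toFinset_card']; exact hS
        have := lintegral_planted_le (N := N) (σ2 := σ2) (θ := θ) hb S.toFinset
          (by rw [hcard]; exact hk) v
          (ν / √2) hσ hσ1 (by rw [hcard]; exact hθ) hg fun X => probZero_le_one _ _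
        have hsum : ∑ j ∈ S.toFinset, b j = ∑ j, if j ∈ S then b j else 0 := by
          rw [← Finset.sum_filter]
          congr 1
          ext j
          simp
        rw [hcard, hsum] at this
        exact this
    _ ≤ _ := by
        rw [lintegral_add_right _ measurable_const, lintegral_const]
        calc _ ≤ p₀ + ε + (∫⁻ S, ∫⁻ X, g X
              ∂spikedSamples N d θ ((√k)⁻¹ • ∑ j, if j ∈ S then b j else 0) ∂υ + η) := by
              gcongr
              exact mul_le_of_le_one_right' hυ
          _ = _ := by
              simp only [p₀, ε, η, υ, g]
              ring

/-! ### Averaging over signed permutations -/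

theorem lintegral_uniformOn_finset {X : Type*} [MeasurableSpace X] [MeasurableSingletonClass X]
    (V : Finset X) (F : X → ℝ≥0∞) :
    ∫⁻ x, F x ∂uniformOn (V : Set X) = (V.card : ℝ≥0∞)⁻¹ * ∑ x ∈ V, F x := by
  rw [uniformOn, ProbabilityTheory.cond, lintegral_smul_measure, lintegral_finset,
    Measure.count_apply_finset]
  simp

/-- This makes it unnecessary to prove that the spiked law depends measurably on its spike. -/
theorem aemeasurable_uniformOn {X Y : Type*} [MeasurableSpace X] [MeasurableSingletonClass X]
    [MeasurableSpace Y] {V : Set X} (hV : V.Finite) (F : X → Y) : AEMeasurable F (uniformOn V) := by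
  have := hV.to_subtype
  exact AEMeasurable.smul_measure
    (aemeasurable_restrict_of_measurable_subtype hV.measurableSet (measurable_of_finite _)) _

/-- Double counting: each `h i` permutes the finite set `V`, so the sum over all pairs `(i, w)` can
be evaluated in either order. -/
theorem sum_comp_eq_of_transitive {I X : Type*} [Fintype I] [MeasurableSpace X]
    [MeasurableSingletonClass X] {V : Set X} (hV : V.Finite) (h : I → X → X)
    (hmaps : ∀ i, Set.MapsTo (h i) V V) (hinj : ∀ i, Set.InjOn (h i) V) (F : X → ℝ≥0∞) {v : X}
    (hv : v ∈ V) (hconst : ∀ w ∈ V, ∑ i, F (h i w) = ∑ i, F (h i v)) :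
    ∑ i, F (h i v) = Fintype.card I * ∫⁻ x, F x ∂uniformOn V := by
  lift V to Finset X using hV
  have hcard : (V.card : ℝ≥0∞) ≠ 0 := by
    simpa using Finset.ne_empty_of_mem (by simpa using hv)
  have h1 : (V.card : ℝ≥0∞) * ∑ i, F (h i v) = Fintype.card I * ∑ w ∈ V, F w := by
    calc (V.card : ℝ≥0∞) * ∑ i, F (h i v) = ∑ w ∈ V, ∑ i, F (h i w) := by
          rw [Finset.sum_congr rfl fun w hw => hconst w (by simpa using hw)]
          simp
      _ = ∑ i, ∑ w ∈ V, F (h i w) := Finset.sum_comm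
      _ = ∑ i : I, ∑ w ∈ V, F w := by
          refine Finset.sum_congr rfl fun i _ => ?_
          exact Finset.sum_nbij (h i) (fun w hw => hmaps i hw) (hinj i)
            (Finset.surjOn_of_injOn_of_card_le (h i) (hmaps i) (hinj i) le_rfl) fun _ _ => rfl
      _ = _ := by simp
  rw [lintegral_uniformOn_finset, mul_left_comm, ← h1, ← mul_assoc,
    ENNReal.inv_mul_cancel hcard (by simp), one_mul]

/-- The linear isometry which permutes the coordinates and changes their signs. -/
noncomputable def signedPermutation {d : ℕ} (π : Equiv.Perm (Fin d)) (s : Fin d → ℤˣ) :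
    EuclideanSpace ℝ (Fin d) →ₗᵢ[ℝ] EuclideanSpace ℝ (Fin d) where
  toFun v := WithLp.toLp 2 fun i => (s i : ℤ) * v (π.symm i)
  map_add' v w := by ext i; simp [mul_add]
  map_smul' c v := by ext i; simp [mul_left_comm]
  norm_map' v := by
    rw [← sq_eq_sq₀ (norm_nonneg _) (norm_nonneg _)]
    simp only [LinearMap.coe_mk, AddHom.coe_mk, EuclideanSpace.real_norm_sq_eq, mul_pow]
    rw [← Equiv.sum_comp π.symm fun i => v i ^ 2]
    refine Finset.sum_congr rfl fun i _ => ?_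
    rcases Int.units_eq_one_or (s i) with h | h <;> simp [h]

theorem signedPermutation_apply {d : ℕ} (π : Equiv.Perm (Fin d)) (s : Fin d → ℤˣ)
    (v : EuclideanSpace ℝ (Fin d)) (i : Fin d) :
    signedPermutation π s v i = (s i : ℤ) * v (π.symm i) := rfl

/-- Unit vectors with at most `k` nonzero coordinates, which are all of the form `± 1 / √k` with
signs in `U`. -/
def spikes (U : Subgroup ℤˣ) (d k : ℕ) : Set (EuclideanSpace ℝ (Fin d)) :=
  {v | ‖v‖ = 1 ∧ {i | v i ≠ 0}.ncard ≤ k ∧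
    ∀ i, v i ≠ 0 → ∃ s ∈ U, v i = (s : ℤ) * (1 / √k)}

theorem biasedSpikes_eq (d k : ℕ) : biasedSpikes d k = spikes ⊥ d k := by
  simp [biasedSpikes, spikes]

theorem signedSpikes_eq (d k : ℕ) : signedSpikes d k = spikes ⊤ d k := by
  have : ∀ x y : ℝ, (x = y ∨ x = -y) ↔ ∃ s : ℤˣ, x = (s : ℤ) * y := by
    intro x y
    constructor
    · rintro (rfl | rfl)
      · exact ⟨1, by simp⟩
      · exact ⟨-1, by simp⟩
    · rintro ⟨s, rfl⟩
      rcases Int.units_eq_one_or s with h | h <;> simp [h]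
  simp only [signedSpikes, spikes, this, Subgroup.mem_top, true_and]

theorem spikes_finite (U : Subgroup ℤˣ) (d k : ℕ) : (spikes U d k).Finite := by
  let A : Set ℝ := insert 0 (Set.range fun s : ℤˣ => ((s : ℤ) : ℝ) * (1 / √k))
  have hA : A.Finite := (Set.finite_range _).insert 0
  have : (Set.pi Set.univ fun _ : Fin d => A).Finite := Set.Finite.pi fun _ => hA
  refine (this.image (WithLp.toLp 2)).subset fun v hv => ⟨v.ofLp, fun i _ => ?_, rfl⟩
  by_cases h : v i = 0
  · exact Or.inl h
  · obtain ⟨s, -, hs⟩ := hv.2.2 i h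
    exact Or.inr ⟨s, hs.symm⟩

/-- Nonzero coordinates have square `1 / k` and the squares sum to `1`, so sparsity is attained
exactly. Without this, signed permutations could not act transitively. -/
theorem ncard_support_of_mem_spikes {U : Subgroup ℤˣ} {d k : ℕ} {v : EuclideanSpace ℝ (Fin d)}
    (hv : v ∈ spikes U d k) : {i | v i ≠ 0}.ncard = k := by
  classical
  obtain ⟨h1, -, h2⟩ := hv
  have hsq : ∀ i, v i ^ 2 = if v i ≠ 0 then (k : ℝ)⁻¹ else 0 := by
    intro i
    split_ifs with h
    · obtain ⟨s, -, hs⟩ := h2 i h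
      rw [hs, mul_pow, div_pow, Real.sq_sqrt (by positivity)]
      rcases Int.units_eq_one_or s with h | h <;> simp [h]
    · simp [not_not.1 h]
  have h3 : ∑ i, v i ^ 2 = 1 := by rw [← EuclideanSpace.real_norm_sq_eq, h1, one_pow]
  rw [Finset.sum_congr rfl fun i _ => hsq i, ← Finset.sum_filter, Finset.sum_const,
    nsmul_eq_mul] at h3
  have hk : (k : ℝ) ≠ 0 := by rintro h; simp [h] at h3
  rw [mul_inv_eq_one₀ hk] at h3
  rw [Set.ncard_eq_toFinset_card', Set.toFinset_ofPred]
  exact_mod_cast h3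

theorem signedPermutation_mem_spikes {U : Subgroup ℤˣ} {d k : ℕ} (π : Equiv.Perm (Fin d))
    (s : Fin d → U) {v : EuclideanSpace ℝ (Fin d)} (hv : v ∈ spikes U d k) :
    signedPermutation π (fun i => s i) v ∈ spikes U d k := by
  have hne : ∀ i, signedPermutation π (fun i => (s i : ℤˣ)) v i ≠ 0 ↔ v (π.symm i) ≠ 0 := by
    intro i
    simp [signedPermutation_apply]
  refine ⟨by rw [LinearIsometry.norm_map]; exact hv.1, ?_, fun i hi => ?_⟩
  · simp only [hne]
    refine le_trans (le_of_eq ?_) hv.2.1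
    exact Set.ncard_preimage_of_injective_subset_range (s := {i | v i ≠ 0}) π.symm.injective
      (by simp)
  · obtain ⟨r, hr, h⟩ := hv.2.2 _ ((hne i).1 hi)
    exact ⟨s i * r, U.mul_mem (s i).2 hr, by simp [signedPermutation_apply, h, mul_assoc]⟩

theorem exists_signedPermutation_eq {U : Subgroup ℤˣ} {d k : ℕ} {v w : EuclideanSpace ℝ (Fin d)}
    (hv : v ∈ spikes U d k) (hw : w ∈ spikes U d k) :
    ∃ (π : Equiv.Perm (Fin d)) (s : Fin d → U), signedPermutation π (fun i => s i) v = w := by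
  classical
  have hcard : Fintype.card {i // v i ≠ 0} = Fintype.card {i // w i ≠ 0} := by
    have := (ncard_support_of_mem_spikes hv).trans (ncard_support_of_mem_spikes hw).symm
    simpa [Set.ncard_eq_toFinset_card', Fintype.card_subtype] using this
  let π := (Fintype.equivOfCardEq hcard).extendSubtype
  have hπ : ∀ i, v (π.symm i) ≠ 0 ↔ w i ≠ 0 := by
    intro i
    constructor
    · intro h
      simpa [π] using (Fintype.equivOfCardEq hcard).extendSubtype_mem _ h
    · intro h h'
      refine (Fintype.equivOfCardEq hcard).extendSubtype_not_mem (π.symm i) (not_not.2 h') ?_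
      simpa [π] using h
  have : ∀ i, ∃ s : U, w i = ((s : ℤˣ) : ℤ) * v (π.symm i) := by
    intro i
    by_cases h : w i = 0
    · have h' : v (π.symm i) = 0 := by
        by_contra h'
        exact (hπ i).1 h' h
      exact ⟨1, by simp [h, h']⟩
    · obtain ⟨r, hr, hr'⟩ := hw.2.2 i h
      obtain ⟨q, hq, hq'⟩ := hv.2.2 _ ((hπ i).2 h)
      -- A sign is its own inverse, so `r * q` carries the sign `q` to `r`.
      refine ⟨⟨r * q, U.mul_mem hr hq⟩, ?_⟩
      rw [hr', hq']
      rcases Int.units_eq_one_or q with h | h <;> simp [h]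
  choose s hs using this
  refine ⟨π, s, ?_⟩
  ext i
  rw [signedPermutation_apply, hs i]

theorem sum_signedPermutation_eq (U : Subgroup ℤˣ) [Fintype U] {d k : ℕ}
    (F : EuclideanSpace ℝ (Fin d) → ℝ≥0∞) {v : EuclideanSpace ℝ (Fin d)} (hv : v ∈ spikes U d k) :
    ∑ i : Equiv.Perm (Fin d) × (Fin d → U), F (signedPermutation i.1 (fun j => i.2 j) v) =
      Fintype.card (Equiv.Perm (Fin d) × (Fin d → U)) * ∫⁻ x, F x ∂uniformOn (spikes U d k) := by
  refine sum_comp_eq_of_transitive (spikes_finite U d k)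
    (fun i : Equiv.Perm (Fin d) × (Fin d → U) => signedPermutation i.1 (fun j => i.2 j))
    (fun i w hw => signedPermutation_mem_spikes _ _ hw)
    (fun i => (signedPermutation i.1 _).injective.injOn) F hv fun w hw => ?_
  obtain ⟨ρ, r, rfl⟩ := exists_signedPermutation_eq hv hw
  symm
  -- Orbit sums agree by right translation in the group of signed permutations: `π` becomes `π * ρ`,
  -- and the signs absorb `r` transported along `π`.
  rw [Fintype.sum_prod_type, Fintype.sum_prod_type, ← Equiv.sum_comp (Equiv.mulRight ρ)]
  refine Finset.sum_congr rfl fun π _ => ?_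
  rw [← Equiv.sum_comp (Equiv.mulRight fun i => r (π.symm i))]
  refine Finset.sum_congr rfl fun s _ => ?_
  congr 1
  ext i
  simp [signedPermutation_apply, mul_assoc, Equiv.Perm.mul_def]

/-! ### The reduction with a uniformly random basis -/

/-- The `j`-th of `n` orthonormal vectors in `ℝ^(n * t)` with disjoint supports of size `t`. -/
noncomputable def blockVector (n t : ℕ) (j : Fin n) : EuclideanSpace ℝ (Fin (n * t)) :=
  WithLp.toLp 2 fun c => if (finProdFinEquiv.symm c).1 = j then (√t)⁻¹ else 0

theorem orthonormal_blockVector {n t : ℕ} (ht : 0 < t) : Orthonormal ℝ (blockVector n t) := by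
  have ht' : (t : ℝ) ≠ 0 := by positivity
  rw [orthonormal_iff_ite]
  intro i j
  rw [PiLp.inner_apply, ← Equiv.sum_comp finProdFinEquiv, Fintype.sum_prod_type]
  simp only [blockVector, Equiv.symm_apply_apply]
  by_cases h : i = j
  · subst h
    simp [ht', ite_pow]
  · simp [h]

-- On the union of the `k` selected blocks every entry is `1/√k * 1/√t = 1/√(k t)`. All signs are
-- positive, which is allowed for every `U`.
open Classical in
theorem blockVector_spike_mem {n t k : ℕ} (ht : 0 < t) (hk : 0 < k) (U : Subgroup ℤˣ)
    {S : Set (Fin n)} (hS : S.ncard = k) :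
    (√k)⁻¹ • ∑ j, (if j ∈ S then blockVector n t j else 0) ∈ spikes U (n * t) (k * t) := by
  have hk' : (k : ℝ) ≠ 0 := by positivity
  have ht' : (t : ℝ) ≠ 0 := by positivity
  have hSc : S.toFinset.card = k := by rw [← Set.ncard_eq_toFinset_card']; exact hS
  have hval : ∀ c, ((√k)⁻¹ • ∑ j, (if j ∈ S then blockVector n t j else 0) :
      EuclideanSpace ℝ (Fin (n * t))) c =
      if (finProdFinEquiv.symm c).1 ∈ S then 1 / √((k * t : ℕ) : ℝ) else 0 := by
    intro c
    simp only [PiLp.smul_apply, WithLp.ofLp_sum, Finset.sum_apply, apply_ite WithLp.ofLp,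
      ite_apply, blockVector, WithLp.ofLp_zero, Pi.zero_apply, smul_eq_mul]
    rw [Finset.sum_eq_single (finProdFinEquiv.symm c).1]
    · rw [if_pos rfl, Nat.cast_mul, Real.sqrt_mul (Nat.cast_nonneg k), one_div, mul_inv]
      split_ifs <;> simp only [mul_zero]
    · intro j _ hj
      rw [if_neg hj.symm, ite_self]
    · exact fun h => absurd (Finset.mem_univ _) h
  refine ⟨?_, ?_, fun c hc => ⟨1, U.one_mem, ?_⟩⟩
  · rw [← sq_eq_sq₀ (norm_nonneg _) zero_le_one, EuclideanSpace.real_norm_sq_eq, one_pow]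
    simp_rw [hval]
    rw [← Equiv.sum_comp finProdFinEquiv, Fintype.sum_prod_type]
    simp only [Equiv.symm_apply_apply, ite_pow]
    rw [Finset.sum_comm, Finset.sum_const, Finset.card_fin, ← Finset.sum_filter_add_sum_filter_not
      Finset.univ (· ∈ S), Finset.sum_congr rfl fun x hx => if_pos (Finset.mem_filter.1 hx).2,
      Finset.sum_eq_zero (s := Finset.univ.filter (· ∉ S)) fun x hx => by
        rw [if_neg (Finset.mem_filter.1 hx).2, zero_pow two_ne_zero],
      Finset.sum_const, ← Set.toFinset_ofPred, div_pow, Real.sq_sqrt (Nat.cast_nonneg _)]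
    have : (Set.toFinset {x | x ∈ S}).card = k := hSc
    rw [this]
    simp only [nsmul_eq_mul, Nat.cast_mul]
    field_simp
    simp
  · refine (Set.ncard_le_ncard (t := finProdFinEquiv '' (S ×ˢ Set.univ)) (fun c hc => ?_)
      (Set.toFinite _)).trans ?_
    · refine ⟨finProdFinEquiv.symm c, ⟨?_, Set.mem_univ _⟩,
        finProdFinEquiv.apply_symm_apply c⟩
      by_contra h
      rw [Set.mem_ofPred_eq, hval, if_neg h] at hc
      exact hc rfl
    · rw [Set.ncard_image_of_injective _ finProdFinEquiv.injective, Set.ncard_prod, hS]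
      simp
  · rw [hval] at hc ⊢
    split_ifs at hc ⊢ with h
    · simp
    · simp at hc

/-- The conditions on the parameters under which a test for planted clique on `n` vertices with a
clique of size `k` is obtained from a test for sparse PCA with `n * t` samples in dimension
`n * t`. -/
structure ReductionParameters (n t k : ℕ) (θ : ℝ) (δ : ℝ≥0∞) (σ2 : ℝ) : Prop where
  block_pos : 0 < t
  vertices_pos : 0 < n
  clique_size : 2 < k
  delta_le : δ ≤ 1 / 2
  variance_lt : σ2 < 1
  theta_eq : θ = σ2 * (k * (k - 2))
  exists_shift : ∃ (ν : ℝ) (v : ℝ≥0), 0 < ν ∧ 0 < v ∧ (n * t : ℕ) * v ≤ 1 / 200 ∧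
    v * (ν / √2) ^ 2 = σ2 ∧ ENNReal.ofReal (Real.exp (ν + 1 / 2 - 1 / (3 * ν))) ≤ δ

/-- The loss of the reduction. -/
noncomputable def reductionLoss (n t : ℕ) (δ : ℝ≥0∞) (σ2 : ℝ) : ℝ≥0∞ :=
  ((1 + δ) ^ Fintype.card (EdgeIndex n) - 1) +
    ((ENNReal.ofReal (√(1 - σ2 ^ 2))⁻¹ ^ n) ^ (n * t) - 1) ^ (1 / 2 : ℝ)

/-- The bound for an orthonormal family is applied to the image of the block vectors under every
signed permutation, and the results are averaged. The null term does not change, and the spike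
becomes uniform whatever the clique is. -/
theorem ReductionParameters.le_typeError (φ : RealProgram) {n t k : ℕ} {θ σ2 : ℝ} {δ : ℝ≥0∞}
    (h : ReductionParameters n t k θ δ σ2) (U : Subgroup ℤˣ) {m : ℝ≥0∞}
    (hm : ∀ P : RealProgram,
      P.length ≤ (3 * (n * n) + 4) * (n * t * (n * t) + 1) + φ.length →
      m ≤ typeError P (loadGraph n)
        (SimpleGraph.binomialRandom (Fin n) ⟨1 / 2, by norm_num, by norm_num⟩)
        (plantedClique n k ⟨1 / 2, by norm_num, by norm_num⟩)) :
    m * (1 - ENNReal.ofReal ((1 / 2) ^ (n * t))) ≤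
      typeError φ (loadSamples (n * t) (n * t)) (pcaNull (n * t) (n * t))
        (pcaPlanted (n * t) (n * t) θ (spikes U (n * t) (k * t))) + reductionLoss n t δ σ2 := by
  classical
  obtain ⟨ht, hn, hk, hδ, hσ1, hθ, ν, v, hν, hv, hNv, hσ, hexp⟩ := h
  let V := spikes U (n * t) (k * t)
  let G : EuclideanSpace ℝ (Fin (n * t)) → ℝ≥0∞ := fun w =>
    ∫⁻ X, φ.probZero (loadSamples (n * t) (n * t) X) ∂spikedSamples (n * t) (n * t) θ w
  let p₀ : ℝ≥0∞ := ∫⁻ X, φ.probOne (loadSamples (n * t) (n * t) X) ∂pcaNull (n * t) (n * t)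
  let w : Set (Fin n) → EuclideanSpace ℝ (Fin (n * t)) := fun S =>
    (√k)⁻¹ • ∑ j, if j ∈ S then blockVector n t j else 0
  let I := Equiv.Perm (Fin (n * t)) × (Fin (n * t) → U)
  let f : I → EuclideanSpace ℝ (Fin (n * t)) →ₗᵢ[ℝ] EuclideanSpace ℝ (Fin (n * t)) := fun i =>
    signedPermutation i.1 fun j => i.2 j
  let υ : Measure (Set (Fin n)) := uniformOn {S : Set (Fin n) | S.ncard = k}
  let L := reductionLoss n t δ σ2
  have hplanted : ∫⁻ X, φ.probZero (loadSamples (n * t) (n * t) X)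
      ∂pcaPlanted (n * t) (n * t) θ V = ∫⁻ w, G w ∂uniformOn V := by
    rw [pcaPlanted, Measure.lintegral_bind (aemeasurable_uniformOn (spikes_finite _ _ _) _)]
    exact ((measurable_probZero φ).comp (measurable_loadSamples _ _)).aemeasurable
  have hi : ∀ i : I, m * (1 - ENNReal.ofReal ((1 / 2) ^ (n * t))) ≤
      p₀ + ∫⁻ S, G (f i (w S)) ∂υ + L := by
    intro i
    have := reduction_bound_of_orthonormal φ
      ((orthonormal_blockVector ht).comp_linearIsometry (f i))
      hk (Nat.mul_pos hn ht) (Nat.le_mul_of_pos_right n ht) hv hNv hν hδ hexp hσ hσ1 hθ hm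
    refine this.trans_eq ?_
    simp only [w, map_smul, map_sum, apply_ite (f i), map_zero]
    rfl
  have hsum : ∫⁻ S, ∑ i, G (f i (w S)) ∂υ ≤ Fintype.card I * ∫⁻ w, G w ∂uniformOn V := by
    have hae : ∀ᵐ S ∂υ, S ∈ {S : Set (Fin n) | S.ncard = k} :=
      ae_cond_mem (Set.toFinite _).measurableSet
    calc ∫⁻ S, ∑ i, G (f i (w S)) ∂υ
        = ∫⁻ S, Fintype.card I * ∫⁻ w, G w ∂uniformOn V ∂υ := by
          refine lintegral_congr_ae ?_
          filter_upwards [hae] with S hS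
          exact sum_signedPermutation_eq U G (blockVector_spike_mem ht (by omega) U hS)
      _ ≤ _ := by
          rw [lintegral_const]
          exact mul_le_of_le_one_right' (uniformOn_univ_le_one _)
  have hI : (Fintype.card I : ℝ≥0∞) ≠ 0 := by simp
  have hmul : (Fintype.card I : ℝ≥0∞) * (m * (1 - ENNReal.ofReal ((1 / 2) ^ (n * t)))) ≤
      Fintype.card I * (p₀ + ∫⁻ w, G w ∂uniformOn V + L) := by
    calc _ = ∑ i : I, m * (1 - ENNReal.ofReal ((1 / 2) ^ (n * t))) := by
          rw [Finset.sum_const, nsmul_eq_mul, Finset.card_univ]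
      _ ≤ ∑ i : I, (p₀ + ∫⁻ S, G (f i (w S)) ∂υ + L) := Finset.sum_le_sum fun i _ => hi i
      _ = Fintype.card I * p₀ + ∫⁻ S, ∑ i, G (f i (w S)) ∂υ + Fintype.card I * L := by
          rw [lintegral_finsetSum _ fun i _ => measurable_of_finite _]
          simp [Finset.sum_add_distrib]
      _ ≤ Fintype.card I * p₀ + Fintype.card I * ∫⁻ w, G w ∂uniformOn V +
          Fintype.card I * L := by gcongr
      _ = _ := by ring
  rw [typeError, hplanted]
  exact (ENNReal.mul_le_mul_iff_right hI (by simp)).1 hmul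

/-! ### Growth exponents -/

/-- `x n = n ^ (a + o(1))`. -/
def HasExponent (x : ℕ → ℝ) (a : ℝ) : Prop :=
  (∀ᶠ n in atTop, 0 < x n) ∧ Tendsto (fun n => Real.log (x n) / Real.log n) atTop (𝓝 a)

theorem eventually_log_pos : ∀ᶠ n : ℕ in atTop, 0 < Real.log n := by
  filter_upwards [eventually_gt_atTop 1] with n hn
  exact Real.log_pos (by exact_mod_cast hn)

theorem tendsto_log_natCast : Tendsto (fun n : ℕ => Real.log n) atTop atTop :=
  Real.tendsto_log_atTop.comp tendsto_natCast_atTop_atTop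

namespace HasExponent

theorem mul {x y : ℕ → ℝ} {a b : ℝ} (hx : HasExponent x a) (hy : HasExponent y b) :
    HasExponent (fun n => x n * y n) (a + b) := by
  refine ⟨by filter_upwards [hx.1, hy.1] with n h1 h2 using mul_pos h1 h2,
    (hx.2.add hy.2).congr' ?_⟩
  filter_upwards [hx.1, hy.1] with n h1 h2
  rw [Real.log_mul h1.ne' h2.ne', add_div]

theorem rpow {x : ℕ → ℝ} {a : ℝ} (hx : HasExponent x a) (r : ℝ) :
    HasExponent (fun n => x n ^ r) (r * a) := by
  refine ⟨by filter_upwards [hx.1] with n h1 using Real.rpow_pos_of_pos h1 r,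
    (hx.2.const_mul r).congr' ?_⟩
  filter_upwards [hx.1] with n h1
  rw [Real.log_rpow h1, mul_div_assoc]

theorem const {c : ℝ} (hc : 0 < c) : HasExponent (fun _ => c) 0 :=
  ⟨Eventually.of_forall fun _ => hc, tendsto_log_natCast.const_div_atTop _⟩

theorem natCast : HasExponent (fun n => n) 1 := by
  refine ⟨?_, tendsto_const_nhds.congr' ?_⟩
  · filter_upwards [eventually_gt_atTop 0] with n hn using by exact_mod_cast hn
  · filter_upwards [eventually_log_pos] with n hn using (div_self hn.ne').symm

theorem of_le_of_le {x y z : ℕ → ℝ} {a : ℝ} (hx : HasExponent x a) (hz : HasExponent z a)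
    (hxy : ∀ᶠ n in atTop, x n ≤ y n) (hyz : ∀ᶠ n in atTop, y n ≤ z n) : HasExponent y a := by
  refine ⟨by filter_upwards [hx.1, hxy] with n h1 h2 using h1.trans_le h2,
    tendsto_of_tendsto_of_tendsto_of_le_of_le' hx.2 hz.2 ?_ ?_⟩
  · filter_upwards [hx.1, hxy, eventually_log_pos] with n h1 h2 h3
    gcongr
  · filter_upwards [hx.1, hxy, hyz, eventually_log_pos] with n h1 h2 h3 h4
    have := h1.trans_le h2
    gcongr

theorem tendsto_zero {x : ℕ → ℝ} {a : ℝ} (hx : HasExponent x a) (ha : a < 0) :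
    Tendsto x atTop (𝓝 0) := by
  have h1 : Tendsto (fun n : ℕ => Real.log (x n) / Real.log n * Real.log n) atTop atBot :=
    hx.2.neg_mul_atTop ha tendsto_log_natCast
  refine (Real.tendsto_exp_atBot.comp h1).congr' ?_
  filter_upwards [hx.1, eventually_log_pos] with n h2 h3
  simp [div_mul_cancel₀ _ h3.ne', Real.exp_log h2]

theorem natCeil_rpow {r : ℝ} (hr : 0 ≤ r) : HasExponent (fun n : ℕ => (⌈(n : ℝ) ^ r⌉₊ : ℝ)) r := by
  have h1 : HasExponent (fun n : ℕ => (n : ℝ) ^ r) r := by simpa using natCast.rpow r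
  refine of_le_of_le h1 (by simpa using (const two_pos).mul h1)
    (Eventually.of_forall fun n => Nat.le_ceil _) ?_
  filter_upwards [eventually_ge_atTop 1] with n hn
  have : (1 : ℝ) ≤ (n : ℝ) ^ r := Real.one_le_rpow (by exact_mod_cast hn) hr
  have := Nat.ceil_lt_add_one (zero_le_one.trans this)
  linarith

end HasExponent

/-! ### The parameters -/

/-- The number of coordinates of a block. -/
noncomputable def blockSize (b : ℝ) (n : ℕ) : ℕ := ⌈(n : ℝ) ^ b⌉₊

/-- The size of the planted clique. -/
noncomputable def cliqueSize (g : ℝ) (n : ℕ) : ℕ := max 1 ⌈(n : ℝ) ^ g⌉₊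

/-- The `max 1` in the definition matters only at `n = 0`; the conjecture asks for positive sizes at
every `n`. -/
theorem cliqueSize_pos (g : ℝ) (n : ℕ) : 0 < cliqueSize g n :=
  Nat.lt_of_lt_of_le one_pos (le_max_left _ _)

theorem hasExponent_cliqueSize {g : ℝ} (hg : 0 ≤ g) : HasExponent (fun n => cliqueSize g n) g := by
  have h := HasExponent.natCeil_rpow hg
  refine HasExponent.of_le_of_le h h (Eventually.of_forall fun n => ?_) ?_
  · exact_mod_cast le_max_right _ _
  · filter_upwards [eventually_gt_atTop 0] with n hn
    have : 0 < ⌈(n : ℝ) ^ g⌉₊ := Nat.ceil_pos.2 (Real.rpow_pos_of_pos (by exact_mod_cast hn) g)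
    exact_mod_cast max_le this le_rfl

theorem hasExponent_mul_blockSize {b : ℝ} (hb : 0 ≤ b) :
    HasExponent (fun n => ((n * blockSize b n : ℕ) : ℝ)) (1 + b) := by
  simpa [blockSize] using HasExponent.natCast.mul (HasExponent.natCeil_rpow hb)

theorem tendsto_cliqueSize {g : ℝ} (hg : 0 < g) : Tendsto (cliqueSize g) atTop atTop := by
  refine tendsto_atTop_mono (fun n => le_max_right _ _) ?_
  exact tendsto_nat_ceil_atTop.comp ((tendsto_rpow_atTop hg).comp tendsto_natCast_atTop_atTop)

/-- This is the total rejection error over at most `n²` edges for `ν = n ^ (-ε)`: the factor `exp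
(-n ^ ε / 3)` beats every power of `n`. -/
theorem tendsto_sq_mul_exp_zero {ε : ℝ} (hε : 0 < ε) :
    Tendsto (fun n : ℕ => (n : ℝ) ^ 2 *
      Real.exp ((n : ℝ) ^ (-ε) + 1 / 2 - 1 / (3 * (n : ℝ) ^ (-ε)))) atTop (𝓝 0) := by
  have h1 : Tendsto (fun n : ℕ => Real.exp (3 / 2) *
      (((n : ℝ) ^ ε) ^ (2 / ε) * Real.exp (-(1 / 3) * (n : ℝ) ^ ε))) atTop (𝓝 0) := by
    simpa using ((tendsto_rpow_mul_exp_neg_mul_atTop_nhds_zero (2 / ε) (1 / 3) (by norm_num)).comp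
      ((tendsto_rpow_atTop hε).comp tendsto_natCast_atTop_atTop)).const_mul (Real.exp (3 / 2))
  refine squeeze_zero' (Eventually.of_forall fun n => by positivity) ?_ h1
  filter_upwards [eventually_ge_atTop 1] with n hn
  have hn' : (1 : ℝ) ≤ n := by exact_mod_cast hn
  have h2 : ((n : ℝ) ^ ε) ^ (2 / ε) = (n : ℝ) ^ 2 := by
    rw [← Real.rpow_mul (by positivity), mul_div_cancel₀ _ hε.ne']
    norm_num
  have h3 : (n : ℝ) ^ (-ε) ≤ 1 := Real.rpow_le_one_of_one_le_of_nonpos hn' (by linarith)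
  rw [h2, mul_left_comm, ← Real.exp_add]
  gcongr
  rw [Real.rpow_neg (by positivity)] at h3 ⊢
  have : 1 / (3 * ((n : ℝ) ^ ε)⁻¹) = 1 / 3 * (n : ℝ) ^ ε := by field_simp
  rw [this]
  linarith

theorem inv_sqrt_one_sub_sq_le {σ : ℝ} (hσ : σ ^ 2 ≤ 1 / 2) :
    (√(1 - σ ^ 2))⁻¹ ≤ Real.exp (2 * σ ^ 2) := by
  have h0 : 0 < 1 - σ ^ 2 := by linarith
  have h1 : 1 - σ ^ 2 ≤ √(1 - σ ^ 2) := Real.le_sqrt_of_sq_le (by nlinarith [sq_nonneg σ])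
  calc (√(1 - σ ^ 2))⁻¹ ≤ (1 - σ ^ 2)⁻¹ := inv_anti₀ h0 h1
    _ ≤ 2 * σ ^ 2 + 1 := by
        rw [inv_le_iff_one_le_mul₀ h0]
        nlinarith [sq_nonneg σ]
    _ ≤ _ := Real.add_one_le_exp _

theorem reductionLoss_le {n t : ℕ} {D σ2 : ℝ} (hD : 0 ≤ D) (hσ : σ2 ^ 2 ≤ 1 / 2) :
    reductionLoss n t (ENNReal.ofReal D) σ2 ≤ (ENNReal.ofReal (Real.exp (n ^ 2 * D)) - 1) +
      (ENNReal.ofReal (Real.exp (2 * (n * (n * t : ℕ) * σ2 ^ 2))) - 1) ^ (1 / 2 : ℝ) := by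
  unfold reductionLoss
  gcongr
  · have hcard : Fintype.card (EdgeIndex n) ≤ n ^ 2 := by
      refine (Fintype.card_subtype_le _).trans ?_
      simp [sq]
    rw [← ENNReal.ofReal_one, ← ENNReal.ofReal_add zero_le_one hD,
      ← ENNReal.ofReal_pow (by positivity)]
    refine ENNReal.ofReal_le_ofReal ?_
    calc (1 + D) ^ Fintype.card (EdgeIndex n) ≤ (1 + D) ^ n ^ 2 :=
          pow_le_pow_right₀ (by linarith) hcard
      _ ≤ Real.exp D ^ n ^ 2 := by
          gcongr
          linarith [Real.add_one_le_exp D]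
      _ = _ := by rw [← Real.exp_nat_mul]; push_cast; rfl
  · rw [← pow_mul, ← ENNReal.ofReal_pow (by positivity)]
    refine ENNReal.ofReal_le_ofReal ?_
    calc ((√(1 - σ2 ^ 2))⁻¹) ^ (n * (n * t)) ≤ Real.exp (2 * σ2 ^ 2) ^ (n * (n * t)) := by
          gcongr
          exact inv_sqrt_one_sub_sq_le hσ
      _ = _ := by
          rw [← Real.exp_nat_mul]
          push_cast
          ring_nf

theorem exists_reductionParameters {α g b : ℝ} (hg : 0 < g) (hb : 0 ≤ b)
    (h : (1 + b) * (1 - α) < 2 * g) :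
    ∃ (δ : ℕ → ℝ≥0∞) (σ2 : ℕ → ℝ), (∀ᶠ n in atTop, ReductionParameters n (blockSize b n)
        (cliqueSize g n) (((n * blockSize b n : ℕ) : ℝ) ^ (-α)) (δ n) (σ2 n)) ∧
      Tendsto (fun n => reductionLoss n (blockSize b n) (δ n) (σ2 n)) atTop (𝓝 0) := by
  -- A quarter of the gap: `N v` has order `N θ k^{-2} n^{2ε}`, whose exponent is then `-2ε`.
  let ε : ℝ := (2 * g - (1 + b) * (1 - α)) / 4
  have hε : 0 < ε := by simp only [ε]; linarith
  let t := blockSize b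
  let κ := cliqueSize g
  let N : ℕ → ℝ := fun n => ((n * t n : ℕ) : ℝ)
  let θ : ℕ → ℝ := fun n => N n ^ (-α)
  let ν : ℕ → ℝ := fun n => (n : ℝ) ^ (-ε)
  let D : ℕ → ℝ := fun n => Real.exp (ν n + 1 / 2 - 1 / (3 * ν n))
  let σ2 : ℕ → ℝ := fun n => θ n / (κ n * (κ n - 2))
  have hNexp : HasExponent N (1 + b) := hasExponent_mul_blockSize hb
  have hθexp : HasExponent θ (-α * (1 + b)) := hNexp.rpow _
  have hκexp : HasExponent (fun n => κ n) g := hasExponent_cliqueSize hg.le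
  have hNv : Tendsto (fun n => 6 * (N n * (θ n * ((κ n : ℝ) ^ (-2 : ℝ) * (n : ℝ) ^ (2 * ε)))))
      atTop (𝓝 0) := by
    have := (hNexp.mul (hθexp.mul ((hκexp.rpow (-2)).mul (HasExponent.natCast.rpow (2 * ε)))))
    simpa using (this.tendsto_zero (by simp only [ε]; linarith)).const_mul 6
  -- The exponent is `2 * ((1 + b) * (1 - α) - 2 * g) - b`, negative by the same condition and `b ≥
  -- 0`.
  have hNσ : Tendsto (fun n : ℕ => 9 * (n * (N n * (θ n ^ (2 : ℝ) * (κ n : ℝ) ^ (-4 : ℝ)))))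
      atTop (𝓝 0) := by
    have := HasExponent.natCast.mul (hNexp.mul ((hθexp.rpow 2).mul (hκexp.rpow (-4))))
    simpa using (this.tendsto_zero (by linarith)).const_mul 9
  -- For `k ≥ 3` one has `k * (k - 2) ≥ k² / 3`; hence the constants `6 = 2 * 3` and `9 = 3²` above.
  have hσle : ∀ᶠ n in atTop, 0 < σ2 n ∧ σ2 n ≤ 3 * (θ n * (κ n : ℝ) ^ (-2 : ℝ)) := by
    filter_upwards [(tendsto_cliqueSize hg).eventually_ge_atTop 3, hθexp.1] with n hn hθ
    have hκ : (3 : ℝ) ≤ κ n := by exact_mod_cast hn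
    refine ⟨div_pos hθ (mul_pos (by linarith) (by linarith)), ?_⟩
    rw [Real.rpow_neg (by linarith), Real.rpow_two]
    rw [div_le_iff₀ (mul_pos (by linarith) (by linarith))]
    have : (3 : ℝ) * (θ n * ((κ n : ℝ) ^ 2)⁻¹) * (κ n * (κ n - 2)) =
        θ n * (3 * (κ n - 2) / κ n) := by
      field_simp
    rw [this]
    refine le_mul_of_one_le_right hθ.le ?_
    rw [le_div_iff₀ (by linarith)]
    linarith
  have hNσ' : Tendsto (fun n : ℕ => n * N n * σ2 n ^ 2) atTop (𝓝 0) := by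
    refine squeeze_zero' (Eventually.of_forall fun n => by positivity) ?_ hNσ
    filter_upwards [hσle, hκexp.1] with n hn hκ
    have h4 : (κ n : ℝ) ^ (-4 : ℝ) = ((κ n : ℝ) ^ (-2 : ℝ)) ^ 2 := by
      rw [← Real.rpow_natCast, ← Real.rpow_mul hκ.le]
      norm_num
    calc n * N n * σ2 n ^ 2 ≤ n * N n * (3 * (θ n * (κ n : ℝ) ^ (-2 : ℝ))) ^ 2 := by
          have := hn.1
          gcongr
          exact hn.2
      _ = _ := by rw [h4, Real.rpow_two]; ring
  have hD := tendsto_sq_mul_exp_zero hε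
  have hN1 : ∀ᶠ n : ℕ in atTop, (1 : ℝ) ≤ n ∧ 1 ≤ N n := by
    filter_upwards [eventually_ge_atTop 1, hNexp.1] with n hn hN
    refine ⟨by exact_mod_cast hn, ?_⟩
    have : 0 < n * t n := Nat.cast_pos.1 hN
    exact Nat.one_le_cast.2 this
  have hσsq : ∀ᶠ n : ℕ in atTop, σ2 n ^ 2 ≤ 1 / 2 := by
    filter_upwards [hNσ'.eventually_le_const (by norm_num : (0 : ℝ) < 1 / 2), hN1] with n h1 h2
    refine le_trans (le_mul_of_one_le_left (sq_nonneg _) ?_) h1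
    nlinarith
  refine ⟨fun n => ENNReal.ofReal (D n), σ2, ?_, ?_⟩
  · filter_upwards [eventually_ge_atTop 1, (tendsto_cliqueSize hg).eventually_ge_atTop 3, hN1,
      hσsq, hσle, hκexp.1, hNv.eventually_le_const (by norm_num : (0 : ℝ) < 1 / 200),
      hD.eventually_le_const (by norm_num : (0 : ℝ) < 1 / 2)] with n hn hκ3 hN hσ hσ' hκ hNvn hDn
    have hκ' : (3 : ℝ) ≤ κ n := by exact_mod_cast hκ3
    have hNpos : 0 < n * t n := Nat.one_le_cast.1 hN.2
    have hνpos : 0 < ν n := Real.rpow_pos_of_pos (by linarith [hN.1]) _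
    have hv : 0 < 2 * σ2 n / ν n ^ 2 := by
      have := hσ'.1
      positivity
    have hvN : (2 * σ2 n / ν n ^ 2).toNNReal = 2 * σ2 n / ν n ^ 2 := Real.coe_toNNReal _ hv.le
    refine ⟨Nat.pos_of_mul_pos_left hNpos, hn, hκ3, ?_, ?_, ?_, ν n, (2 * σ2 n / ν n ^ 2).toNNReal,
      hνpos, Real.toNNReal_pos.2 hv, ?_, ?_, le_rfl⟩
    · rw [show (1 / 2 : ℝ≥0∞) = ENNReal.ofReal (1 / 2) by
        rw [ENNReal.ofReal_div_of_pos two_pos]; simp]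
      refine ENNReal.ofReal_le_ofReal (le_trans (le_mul_of_one_le_left (Real.exp_pos _).le ?_) hDn)
      exact one_le_pow₀ hN.1
    · nlinarith [hσ'.1]
    · refine (div_mul_cancel₀ _ ?_).symm
      exact (mul_pos (by linarith) (by linarith)).ne'
    · rw [← NNReal.coe_le_coe]
      push_cast [hvN]
      refine le_trans ?_ hNvn
      have h2 : (n : ℝ) ^ (2 * ε) = (ν n ^ 2)⁻¹ := by
        rw [← Real.rpow_natCast, ← Real.rpow_mul (by linarith [hN.1]), ← Real.rpow_neg
          (by linarith [hN.1])]
        congr 1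
        push_cast
        ring
      rw [h2]
      calc (n : ℝ) * t n * (2 * σ2 n / ν n ^ 2)
          ≤ n * t n * (2 * (3 * (θ n * (κ n : ℝ) ^ (-2 : ℝ))) / ν n ^ 2) := by
            gcongr
            exact hσ'.2
        _ = _ := by simp only [N]; push_cast; ring
    · rw [hvN, div_pow, Real.sq_sqrt zero_le_two]
      field_simp
  · have hlim : Tendsto (fun n : ℕ => (ENNReal.ofReal (Real.exp (n ^ 2 * D n)) - 1) +
        (ENNReal.ofReal (Real.exp (2 * (n * N n * σ2 n ^ 2))) - 1) ^ (1 / 2 : ℝ)) atTop (𝓝 0) := by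
      have hexp : ∀ {x : ℕ → ℝ}, Tendsto x atTop (𝓝 0) →
          Tendsto (fun n => ENNReal.ofReal (Real.exp (x n)) - 1) atTop (𝓝 0) := by
        intro x hx
        have := ENNReal.tendsto_ofReal ((Real.continuous_exp.tendsto 0).comp hx)
        simpa using ENNReal.Tendsto.sub this (tendsto_const_nhds (x := (1 : ℝ≥0∞)))
          (Or.inr ENNReal.one_ne_top)
      have h1 := hexp hD
      have h2 := hexp (by simpa using hNσ'.const_mul 2)
      have h3 := (ENNReal.continuous_rpow_const (y := 1 / 2)).tendsto 0 |>.comp h2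
      rw [show (0 : ℝ≥0∞) = 0 + 0 ^ (1 / 2 : ℝ) by simp]
      exact h1.add h3
    refine tendsto_of_tendsto_of_tendsto_of_le_of_le' tendsto_const_nhds hlim
      (Eventually.of_forall fun _ => zero_le) ?_
    filter_upwards [hσsq] with n hn
    exact reductionLoss_le (Real.exp_pos _).le hn

/-! ### Transfer of hardness -/

theorem Polynomial.monotone_eval_nat (p : Polynomial ℕ) : Monotone fun n => p.eval n := by
  intro a b hab
  simp only [Polynomial.eval_eq_sum]
  exact Finset.sum_le_sum fun i _ => Nat.mul_le_mul_left _ (Nat.pow_le_pow_left hab i)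

theorem exists_polynomial_blockSize_le (b : ℝ) :
    ∃ q : Polynomial ℕ, ∀ n, blockSize b n ≤ q.eval n := by
  refine ⟨Polynomial.X ^ ⌈b⌉₊ + 1, fun n => ?_⟩
  simp only [blockSize, Polynomial.eval_add, Polynomial.eval_pow, Polynomial.eval_X,
    Polynomial.eval_one]
  rw [Nat.ceil_le]
  push_cast
  rcases Nat.eq_zero_or_pos n with rfl | hn
  · refine le_trans ?_ (le_add_of_nonneg_left (by positivity))
    rw [Nat.cast_zero]
    exact Real.zero_rpow_le_one b
  · refine le_trans ?_ (le_add_of_nonneg_right zero_le_one)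
    rw [← Real.rpow_natCast]
    exact Real.rpow_le_rpow_of_exponent_le (by exact_mod_cast hn) (Nat.le_ceil b)

/-- The averaging argument bounds an infimum over programs, whereas the conjecture concerns one
program for each `n`. The infimum need not be attained, hence the slack `ε`. -/
theorem exists_program_typeError_le {Ω : Type*} [MeasurableSpace Ω] (load : Ω → ℕ → ℝ)
    (μ₀ μ₁ : Measure Ω) (L : ℕ) {ε : ℝ≥0∞} (hε : ε ≠ 0) :
    ∃ A : RealProgram, A.length ≤ L ∧ ∀ P : RealProgram, P.length ≤ L →
      typeError A load μ₀ μ₁ ≤ typeError P load μ₀ μ₁ + ε := by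
  let m : ℝ≥0∞ := ⨅ P : {P : RealProgram // P.length ≤ L}, typeError P.1 load μ₀ μ₁
  have hm : ∀ P : RealProgram, P.length ≤ L → m ≤ typeError P load μ₀ μ₁ := fun P hP =>
    iInf_le (fun P : {P : RealProgram // P.length ≤ L} => typeError P.1 load μ₀ μ₁) ⟨P, hP⟩
  by_cases h : m = ∞
  · refine ⟨[], Nat.zero_le _, fun P hP => ?_⟩
    have := hm P hP
    rw [h, top_le_iff] at this
    simp [this]
  · obtain ⟨⟨A, hA⟩, hlt⟩ := iInf_lt_iff.1 (ENNReal.lt_add_right h hε)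
    exact ⟨A, hA, fun P hP => hlt.le.trans (add_le_add_left (hm P hP) _)⟩

theorem one_le_liminf_of_perturbation {x y η ε : ℕ → ℝ≥0∞} (hx : 1 ≤ liminf x atTop)
    (hη : Tendsto η atTop (𝓝 0)) (hε : Tendsto ε atTop (𝓝 0))
    (h : ∀ᶠ n in atTop, x n * (1 - η n) ≤ y n + ε n) : 1 ≤ liminf y atTop := by
  rw [le_liminf_iff] at hx ⊢
  intro c hc
  obtain ⟨c', hcc', hc'⟩ := exists_between hc
  have hlim : Tendsto (fun n => c' * (1 - η n) - ε n) atTop (𝓝 (c' * (1 - 0) - 0)) :=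
    ENNReal.Tendsto.sub (ENNReal.Tendsto.const_mul (ENNReal.Tendsto.sub tendsto_const_nhds hη
      (Or.inl ENNReal.one_ne_top)) (Or.inr hc'.ne_top)) hε (Or.inr ENNReal.zero_ne_top)
  rw [tsub_zero, tsub_zero, mul_one] at hlim
  filter_upwards [hx c' hc', h, hlim.eventually_const_lt hcc'] with n h1 h2 h3
  refine h3.trans_le (tsub_le_iff_right.2 (le_trans ?_ h2))
  gcongr

/-- The conjecture is applied to programs that are optimal up to `1 / n` among those as long as the
reduction followed by the test. This length is polynomial in `n`, since `blockSize b n` is. -/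
theorem one_le_liminf_typeError {g b : ℝ} (hg0 : 0 < g) (hg : g < 1 / 2)
    (θ : ℕ → ℝ) (δ : ℕ → ℝ≥0∞) (σ2 : ℕ → ℝ)
    (hpar : ∀ᶠ n in atTop,
      ReductionParameters n (blockSize b n) (cliqueSize g n) (θ n) (δ n) (σ2 n))
    (hloss : Tendsto (fun n => reductionLoss n (blockSize b n) (δ n) (σ2 n)) atTop (𝓝 0))
    (hPC : PCConjecture ⟨1 / 2, by norm_num, by norm_num⟩) (U : Subgroup ℤˣ)
    (φ : ℕ → RealProgram)
    (hφ : IsPolyTime φ fun n => n * blockSize b n * (n * blockSize b n)) :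
    1 ≤ liminf (fun n => typeError (φ n) (loadSamples (n * blockSize b n) (n * blockSize b n))
      (pcaNull (n * blockSize b n) (n * blockSize b n))
      (pcaPlanted (n * blockSize b n) (n * blockSize b n) (θ n)
        (spikes U (n * blockSize b n) (cliqueSize g n * blockSize b n)))) atTop := by
  obtain ⟨p, hp⟩ := hφ
  obtain ⟨q, hq⟩ := exists_polynomial_blockSize_le b
  let t := blockSize b
  let L : ℕ → ℕ := fun n => (3 * (n * n) + 4) * (n * t n * (n * t n) + 1) + (φ n).length
  choose A hA hAm using fun n : ℕ => exists_program_typeError_le (loadGraph n)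
    (SimpleGraph.binomialRandom (Fin n) ⟨1 / 2, by norm_num, by norm_num⟩)
    (plantedClique n (cliqueSize g n) ⟨1 / 2, by norm_num, by norm_num⟩) (L n)
    (ε := (n : ℝ≥0∞)⁻¹) (by simp)
  have hpoly : IsPolyTime A fun n => n := by
    let s : Polynomial ℕ := Polynomial.X * q * (Polynomial.X * q)
    refine ⟨(3 * (Polynomial.X * Polynomial.X) + 4) * (s + 1) + p.comp s, fun n => ?_⟩
    have hs : n * t n * (n * t n) ≤ s.eval n := by
      simp only [s, Polynomial.eval_mul, Polynomial.eval_X]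
      exact Nat.mul_le_mul (Nat.mul_le_mul_left _ (hq n)) (Nat.mul_le_mul_left _ (hq n))
    refine (hA n).trans ?_
    simp only [Polynomial.eval_add, Polynomial.eval_mul, Polynomial.eval_X, Polynomial.eval_comp,
      Polynomial.eval_one, Polynomial.eval_ofNat]
    refine Nat.add_le_add (Nat.mul_le_mul_left _ (Nat.add_le_add_right hs _)) ?_
    exact (hp n).trans (p.monotone_eval_nat hs)
  have hlim : limsup (fun n : ℕ => ((Real.log (cliqueSize g n) / Real.log n : ℝ) : EReal)) atTop
      < ((1 / 2 : ℝ) : EReal) := by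
    have := (continuous_coe_real_ereal.tendsto g).comp (hasExponent_cliqueSize hg0.le).2
    refine (this.limsup_eq).trans_lt ?_
    exact_mod_cast hg
  have hN : Tendsto (fun n => n * t n) atTop atTop := by
    refine tendsto_atTop_mono' _ ?_ tendsto_id
    filter_upwards [hpar] with n hn using Nat.le_mul_of_pos_right n hn.block_pos
  have hη : Tendsto (fun n => ENNReal.ofReal ((1 / 2) ^ (n * t n))) atTop (𝓝 0) := by
    have := ENNReal.tendsto_ofReal ((tendsto_pow_atTop_nhds_zero_of_lt_one
      (by norm_num : (0 : ℝ) ≤ 1 / 2) (by norm_num)).comp hN)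
    simpa using this
  have hε := hloss.add ENNReal.tendsto_inv_nat_nhds_zero
  rw [add_zero] at hε
  refine one_le_liminf_of_perturbation
    (hPC A hpoly (cliqueSize g) (cliqueSize_pos g) hlim) hη hε ?_
  filter_upwards [hpar] with n hn
  have := hn.le_typeError (φ n) U (m := typeError (A n) (loadGraph n)
    (SimpleGraph.binomialRandom (Fin n) ⟨1 / 2, by norm_num, by norm_num⟩)
    (plantedClique n (cliqueSize g n) ⟨1 / 2, by norm_num, by norm_num⟩) - (n : ℝ≥0∞)⁻¹)
    fun P hP => tsub_le_iff_right.2 (hAm n P hP)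
  rw [← add_assoc]
  calc _ ≤ (typeError (A n) (loadGraph n)
          (SimpleGraph.binomialRandom (Fin n) ⟨1 / 2, by norm_num, by norm_num⟩)
          (plantedClique n (cliqueSize g n) ⟨1 / 2, by norm_num, by norm_num⟩) - (n : ℝ≥0∞)⁻¹ +
          (n : ℝ≥0∞)⁻¹) * (1 - ENNReal.ofReal ((1 / 2) ^ (n * t n))) :=
        mul_le_mul_left le_tsub_add _
    _ ≤ _ := by
        rw [add_mul]
        exact add_le_add this (mul_le_of_le_one_right' tsub_le_self)

/-! ### The main theorem -/

/-- For `β < 1/2` blocks of bounded size suffice and the condition is the lower bound on `β`. For `β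
≥ 1/2` the clique is taken just below the threshold and `b` is determined by `β`; in the limit `g =
1/2` the condition reads `(1 - α) / 2 < 1 - β`, the upper bound on `β`. -/
theorem exists_exponents {α β : ℝ} (hβ₀ : 0 < β) (hβ₁ : β < 1)
    (hlow : (1 - α) / 2 < β) (hupp : β < (1 + α) / 2) (hα : 0 < α) :
    ∃ g b : ℝ, 0 < g ∧ g < 1 / 2 ∧ 0 ≤ b ∧ (1 + b) * (1 - α) < 2 * g ∧ g + b = β * (1 + b) := by
  rcases lt_or_ge β (1 / 2) with h | h
  · exact ⟨β, 0, hβ₀, h, le_rfl, by linarith, by ring⟩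
  · let x : ℝ := min (1 / 4) (((1 + α) / 2 - β) / 4)
    have hx0 : 0 < x := lt_min (by norm_num) (by linarith)
    have hx1 : x ≤ 1 / 4 := min_le_left _ _
    have hx2 : x ≤ ((1 + α) / 2 - β) / 4 := min_le_right _ _
    have hβ : 0 < 1 - β := by linarith
    refine ⟨1 / 2 - x, (β - (1 / 2 - x)) / (1 - β), by linarith, by linarith,
      div_nonneg (by linarith) hβ.le, ?_, ?_⟩
    · have h1 : 1 + (β - (1 / 2 - x)) / (1 - β) = (1 / 2 + x) / (1 - β) := by
        field_simp
        ring
      rw [h1, div_mul_eq_mul_div, div_lt_iff₀ hβ]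
      nlinarith [mul_pos hx0 hα, mul_nonneg hx0.le (sub_nonneg.2 h)]
    · field_simp
      ring

theorem mainTheorem10 (α β : ℝ) (hα : 0 < α) (hβ₀ : 0 < β) (hβ₁ : β < 1)
    (hlow : (1 - α) / 2 < β) (hupp : β < (1 + α) / 2) :
    ∃ (N K d : ℕ → ℕ) (θ : ℕ → ℝ),
      (∀ n, 0 < N n ∧ 0 < K n ∧ K n ≤ d n ∧ 0 < θ n) ∧
      Tendsto N atTop atTop ∧
      (fun n => (d n : ℝ)) =Θ[atTop] (fun n => (N n : ℝ)) ∧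
      Tendsto (fun n => Real.log (θ n)⁻¹ / Real.log (N n)) atTop (𝓝 α) ∧
      Tendsto (fun n => Real.log (K n) / Real.log (N n)) atTop (𝓝 β) ∧
      (PCConjecture ⟨1 / 2, by norm_num, by norm_num⟩ →
        ∀ φ : ℕ → RealProgram, IsPolyTime φ (fun n => N n * d n) →
          1 ≤ liminf (fun n => uspcaError (N n) (K n) (d n) (θ n) (φ n)) atTop ∧
          1 ≤ liminf (fun n => ubspcaError (N n) (K n) (d n) (θ n) (φ n)) atTop) := by
  obtain ⟨g, b, hg0, hg, hb, hgb, hβ⟩ := exists_exponents hβ₀ hβ₁ hlow hupp hα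
  obtain ⟨δ, σ2, hpar, hloss⟩ := exists_reductionParameters hg0 hb hgb
  -- All sequences are shifted to `n + 1` below, because `M 0 = 0` is not an admissible number of
  -- samples.
  let M : ℕ → ℕ := fun n => n * blockSize b n
  have hMpos : ∀ n, 0 < M (n + 1) := fun n => Nat.mul_pos n.succ_pos
    (Nat.ceil_pos.2 (Real.rpow_pos_of_pos (by positivity) b))
  have hMexp : HasExponent (fun n => (M n : ℝ)) (1 + b) := hasExponent_mul_blockSize hb
  have hMtop : Tendsto (fun n => M (n + 1)) atTop atTop :=
    tendsto_atTop_mono (fun n => n.le_succ.trans (Nat.le_mul_of_pos_right _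
      (Nat.pos_of_mul_pos_left (hMpos n)))) tendsto_id
  refine ⟨fun n => M (n + 1), fun n => cliqueSize g (n + 1) * blockSize b (n + 1),
    fun n => M (n + 1), fun n => (M (n + 1) : ℝ) ^ (-α), fun n => ⟨hMpos n, ?_, ?_, ?_⟩, hMtop,
    Asymptotics.isTheta_refl _ _, ?_, ?_, fun hPC φ hφ => ?_⟩
  · exact Nat.mul_pos (cliqueSize_pos g _) (Nat.pos_of_mul_pos_left (hMpos n))
  · refine Nat.mul_le_mul_right _ (max_le (Nat.le_add_left 1 n) (Nat.ceil_le.2 ?_))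
    refine (Real.rpow_le_rpow_of_exponent_le ?_ (by linarith : g ≤ 1)).trans_eq (Real.rpow_one _)
    exact_mod_cast Nat.le_add_left 1 n
  · exact Real.rpow_pos_of_pos (by exact_mod_cast hMpos n) _
  · refine tendsto_const_nhds.congr' ?_
    filter_upwards [hMtop.eventually_gt_atTop 1] with n hn
    have h1 : 0 < Real.log (M (n + 1)) := Real.log_pos (by exact_mod_cast hn)
    rw [Real.log_inv, Real.log_rpow (by exact_mod_cast hMpos n)]
    field_simp
  · have hKexp : HasExponent (fun n => ((cliqueSize g n * blockSize b n : ℕ) : ℝ)) (g + b) := by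
      simpa [blockSize] using (hasExponent_cliqueSize hg0.le).mul (HasExponent.natCeil_rpow hb)
    have h := hKexp.2.div hMexp.2 (by linarith)
    rw [hβ, mul_div_cancel_right₀ _ (by linarith : 1 + b ≠ 0)] at h
    refine ((tendsto_add_atTop_iff_nat 1).2 h).congr' ?_
    filter_upwards [(tendsto_add_atTop_nat 1).eventually eventually_log_pos] with n hn
    exact div_div_div_cancel_right₀ hn.ne' _ _
  -- Undoes the shift; the empty program at index `0` affects neither the running time bound nor the
  -- lower limit.
  · let φ' : ℕ → RealProgram := fun n => n.casesOn [] φ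
    have hφ' : IsPolyTime φ' fun n => n * blockSize b n * (n * blockSize b n) := by
      obtain ⟨p, hp⟩ := hφ
      refine ⟨p, fun n => ?_⟩
      cases n with
      | zero => exact Nat.zero_le _
      | succ n => exact hp n
    have h : ∀ U : Subgroup ℤˣ, _ := fun U =>
      one_le_liminf_typeError hg0 hg _ δ σ2 hpar hloss hPC U φ' hφ'
    constructor
    · simp only [uspcaError, signedSpikes_eq]
      exact (h ⊤).trans_eq (liminf_nat_add _ 1).symm
    · simp only [ubspcaError, biasedSpikes_eq]
      exact (h ⊥).trans_eq (liminf_nat_add _ 1).symm
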